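/- **Model.** For $N\in\{2,3,\dots\}\cup\{\infty\}$ let $I_N=\{x\in\mathbb Z:0\le x\le N\}$ (with $I_\infty=\mathbb Z_+$), $\partial I_N=\{0,N\}$ if $N<\infty$, $\partial I_\infty=\{0\}$, and let $I_N^\circ=I_N\setminus\partial I_N$ be the interior. For $M\in\mathbb N=\{1,2,\dots\}$ and $z=(x,y)\in I_N\times I_M$, the $(N,M,z)$-model is the Markov chain $\zeta_n=(X_n,\eta_n)$ with $\zeta_0=z$ (law $\mathbb P^{N,M}_z$, expectation $\mathbb E^{N,M}_z$) and the following transitions. From $(x,i)$ with $x\in I_N^\circ$ and $i\ge1$ it moves to $(x+1,i-1)$ or $(x-1,i-1)$, with probability $1/2$ each. From $(x,0)$ with $x\in I_N^\circ$ it stays put. From $(x,i)$ with $x\in\partial I_N$ it moves to $(x',M)$, where $x'$ is the unique interior neighbour of $x$. The lifetime is $\lambda=\min\{n\ge0: X_n\in I_N^\circ,\ \eta_n=0\}\in\mathbb Z_+\cup\{\infty\}$, with $\min\emptyset=\infty$. **Limit objects.** Let $\mathcal I(t)=t\int_0^1 v^{-1/2}e^{vt}\,dv$ and $t_0=\inf\{t\in\mathbb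 R: e^t-\mathcal I(t)\le0\}$. A random variable $\xi\ge0$ has the Darling–Mandelbrot distribution $\mathrm{DM}(1/2)$ if $\mathbb E e^{t\xi}=1/(e^t-\mathcal I(t))$ for all $t<t_0$. A random variable $\tau$ has the Lévy distribution $S_+(1/2)$ (the law of the hitting time of $1$ by standard Brownian motion) if it has density $(2\pi t^3)^{-1/2}e^{-1/(2t)}$ on $t>0$. With $\overline\Phi$ the standard normal tail, put, for $u\in(0,1]$, $$g(a,u)=u+(4-2u-2a)\,\overline\Phi\big(\sqrt{a/u}\big)+\sqrt{\tfrac{2au}{\pi}}\;e^{-a/(2u)}\quad(0\le a<\infty),\qquad g(\infty,u)=u .$$ **Theorem.** For each $M\in\mathbb N$ let $N_M\in\{2,3,\dots\}\cup\{\infty\}$ and $z_M=(x_M,y_M)\in I_{N_M}\times I_M$, and suppose that for some $a\in[0,\infty]$ and $u\in(0,1]$, as $M\to\infty$, $$\frac{\min\{x_M^2,(N_M-x_M)^2\}}{M}\to a,\qquad \frac{y_M}{M}\to u,\qquad \frac{M}{N_M^2}\to0 .$$ The distribution $\mathrm{DM}(1/2)$ exists, and under $\mathbb P^{N_M,M}_{z_M}$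 the lifetime $\lambda$ is almost surely finite for all sufficiently large $M$. If $\xi\sim\mathrm{DM}(1/2)$ and $\tau\sim S_+(1/2)$ are independent, then, as $M\to\infty$, $$\frac{\lambda}{M}\ \xrightarrow{\ d\ }\ \min(u,a\tau)+(1+\xi)\,\mathbf 1\{a\tau<u\}\quad\text{under }\mathbb P^{N_M,M}_{z_M},$$ and $$\lim_{M\to\infty}\frac{\mathbb E^{N_M,M}_{z_M}\lambda}{M}=g(a,u).$$ In particular, if $a=0$ the two limits are $1+\xi$ and $2=1+\mathbb E\xi$; if $a=\infty$ both are $u$. -/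

import Mathlib

open MeasureTheory ProbabilityTheory Filter Topology
open scoped ENNReal

namespace EnergyWalk

/-- The interior `{x : 0 < x < N}` of `I_N = {x : 0 ≤ x ≤ N}`, where `N ∈ ℕ ∪ {∞}`
(for `N = ∞` this is `{1, 2, 3, …}`). -/
def IsInterior (N : ℕ∞) (x : ℕ) : Prop := 0 < x ∧ (x : ℕ∞) < N

open Classical in
/-- One-step transition law of the finite-capacity chain `(X, η)` on `I_N × I_M`, `2 ≤ N ≤ ∞`.
At a boundary site the walk steps to the neighbouring interior site and the energy becomes `M`;
at an interior site with energy `0` the chain stays put; at an interior site with positive energy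
the walk makes a simple random walk step and loses one unit of energy. -/
noncomputable def step (N : ℕ∞) (M : ℕ) (z : ℕ × ℕ) : PMF (ℕ × ℕ) :=
  if z.1 = 0 then PMF.pure (1, M)
  else if (z.1 : ℕ∞) = N then PMF.pure (z.1 - 1, M)
  else if z.2 = 0 then PMF.pure z
  else (PMF.uniformOfFintype Bool).map
    (fun b => (if b = true then z.1 + 1 else z.1 - 1, z.2 - 1))

/-- The transition law as a Markov kernel on `ℕ × ℕ`. -/
noncomputable def stepKernel (N : ℕ∞) (M : ℕ) : Kernel (ℕ × ℕ) (ℕ × ℕ) :=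
  Kernel.ofFunOfCountable (fun z => (step N M z).toMeasure)

instance (N : ℕ∞) (M : ℕ) : IsMarkovKernel (stepKernel N M) :=
  ⟨fun z => PMF.toMeasure.isProbabilityMeasure (step N M z)⟩

/-- The law of the next state given the history up to time `n`: it depends on the history through
the present state only. -/
noncomputable def historyKernel (N : ℕ∞) (M : ℕ) (n : ℕ) :
    Kernel ((i : Finset.Iic n) → (fun _ : ℕ => ℕ × ℕ) i) (ℕ × ℕ) :=
  (stepKernel N M).comap (fun h => h ⟨n, Finset.mem_Iic.2 le_rfl⟩) (measurable_pi_apply _)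

instance (N : ℕ∞) (M n : ℕ) : IsMarkovKernel (historyKernel N M n) := by
  unfold historyKernel; infer_instance

/-- The law, on the space of trajectories, of the `(N, M, z)`-model: the Markov chain started at
`z = (x, y)` with transition law `step N M`. -/
noncomputable def chainLaw (N : ℕ∞) (M : ℕ) (z : ℕ × ℕ) : Measure (ℕ → ℕ × ℕ) :=
  Kernel.trajMeasure (X := fun _ => ℕ × ℕ) (Measure.dirac z) (historyKernel N M)

instance (N : ℕ∞) (M : ℕ) (z : ℕ × ℕ) : IsProbabilityMeasure (chainLaw N M z) := by
  unfold chainLaw; infer_instance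

/-- The total lifetime: the first time at which the trajectory `ζ = (X, η)` has its location in the
interior and its energy equal to zero (`∞` if there is no such time). -/
noncomputable def lifetime (N : ℕ∞) (ζ : ℕ → ℕ × ℕ) : ℕ∞ :=
  ⨅ (n : ℕ) (_ : IsInterior N (ζ n).1 ∧ (ζ n).2 = 0), (n : ℕ∞)

/-- `𝓘(t) = t ∫₀¹ u^{-1/2} e^{ut} du`. -/
noncomputable def calI (t : ℝ) : ℝ :=
  t * ∫ u in (0 : ℝ)..1, u ^ (-(1 / 2) : ℝ) * Real.exp (u * t)

/-- `t₀ = inf {t : e^t - 𝓘(t) ≤ 0}`. -/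
noncomputable def tZero : ℝ := sInf {t : ℝ | Real.exp t - calI t ≤ 0}

/-- The Darling–Mandelbrot distribution `DM(1/2)`: a law on `[0, ∞)` whose moment generating
function is `1 / (e^t - 𝓘(t))` for `t < t₀`. (For `t < t₀` this value is positive, so the equation
includes the integrability of `x ↦ e^{tx}`.) -/
structure IsDarlingMandelbrot (μ : Measure ℝ) : Prop where
  isProbabilityMeasure : IsProbabilityMeasure μ
  nonneg : ∀ᵐ x ∂μ, 0 ≤ x
  mgf_eq : ∀ t < tZero, ∫ x, Real.exp (t * x) ∂μ = 1 / (Real.exp t - calI t)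

/-- The positive `1/2`-stable (Lévy) law `S₊(1/2)`, with density `(2πt³)^{-1/2} e^{-1/(2t)}`
on `(0, ∞)`. -/
noncomputable def levyHalf : Measure ℝ :=
  (volume.restrict (Set.Ioi (0 : ℝ))).withDensity fun t =>
    ENNReal.ofReal ((2 * Real.pi * t ^ 3) ^ (-(1 / 2) : ℝ) * Real.exp (-(1 / (2 * t))))

/-- The standard normal tail `Φ̄(s)`. -/
noncomputable def normalTail (s : ℝ) : ℝ := (gaussianReal 0 1).real (Set.Ioi s)

/-- `g(a, u) = u + (4 - 2u - 2a) Φ̄(√(a/u)) + √(2au/π) e^{-a/(2u)}` for `0 ≤ a < ∞`, and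
`g(∞, u) = u` (its limit as `a → ∞`). -/
noncomputable def g (a : ℝ≥0∞) (u : ℝ) : ℝ :=
  if a = ⊤ then u
  else u + (4 - 2 * u - 2 * a.toReal) * normalTail (√(a.toReal / u))
    + √(2 * a.toReal * u / Real.pi) * Real.exp (-(a.toReal / (2 * u)))

open Classical in
/-- `min (u, a τ) + (1 + ξ) 1{a τ < u}` for `a ∈ [0, ∞]` and `u, ξ, τ ∈ ℝ`, `τ > 0`;
the product `a τ` is computed in `[0, ∞]`. -/
noncomputable def limitValue (a : ℝ≥0∞) (u ξ τ : ℝ) : ℝ :=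
  (min (ENNReal.ofReal u) (a * ENNReal.ofReal τ)).toReal
    + if a * ENNReal.ofReal τ < ENNReal.ofReal u then 1 + ξ else 0

end EnergyWalk

/-!
The walk renews itself each time it visits the boundary: the next state is one step inside the
interval with energy `M`, and by the symmetry `x ↦ N - x` it does not matter at which end. Let `T`
be the exit time of simple random walk from the interior and `S(k, x) = P_x(T > k)` (`exitTail`).
From `(x, y)` the chain dies at time `y` if `T > y`; otherwise it reaches the boundary at time
`T ≤ y` and restarts from `(1, M)` one step later. Solving the resulting linear equation gives
(`hasSum_pow_mul_lifeProb`)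

  `E r^λ = r^y S(y, x) + E_x[r^T; T ≤ y] · r · r^M S(M, 1) / (1 - r E_1[r^T; T ≤ M])`,

and a similar formula holds for `E λ` (`hasSum_mul_lifeProb`). Put `r = e^{t/M}`. Summation by parts
turns the truncated generating functions into sums of `r^k S(k, x)`, which are Riemann sums
(`tendsto_riemann_sum`) for the limits of two rescaled tails:

* `S(vM, x_M) → 1 - 2 Φ̄(√(a/v)) = P(aτ > v)`, by the reflection principle and the central limit
  theorem (`DiffusiveRegime.tendsto_exitTail`);
* `√M S(vM, 1) → √(2/π) v^{-1/2}`, by a binomial formula and Wallis' product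
  (`DiffusiveRegime.tendsto_sqrt_mul_exitTail_one`), with a domination by `2 √M / √(k + 1)` that
  is integrable at `v = 0` in the limit.

Both are computed on the half-line; explicit subsolutions of the recursion for `S` show that the far
end is negligible when `M / N² → 0`. The second tail makes the renewal denominator, divided by
`S(M, 1)`, converge to `e^t - 𝓘(t)`. Hence the moment generating function of `λ / M` converges
wherever `e^t - 𝓘(t) > 0` (`DiffusiveRegime.tendsto_lifetime_mgf`).

For `a = 0` and `u = 1` on the half-line the limit is `e^t / (e^t - 𝓘(t))`. Since `λ ≥ M` there,
the laws of `λ / M - 1` live on `[0, ∞)`; they are tight, and any limit point is the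
Darling–Mandelbrot law (`exists_isDarlingMandelbrot`). In general, independence of `ξ` and `τ`
identifies the limit for `t < 0` as the Laplace transform of the proposed limit variable
(`integral_exp_limitValue`), and the continuity theorem for Laplace transforms
(`tendsto_of_tendsto_laplace`) yields the convergence in distribution. The limit of `E λ / M` comes
out as `∫₀ᵘ P(aτ > v) dv + 2 P(aτ ≤ u)`, which is `g(a, u)` (`g_eq_meanLimit`).
-/

namespace EnergyWalk

/-! ### The law of the lifetime by first-step analysis -/

/-- The absorbing states: interior location, no energy left. -/
def IsTerminal (N : ℕ∞) (z : ℕ × ℕ) : Prop := IsInterior N z.1 ∧ z.2 = 0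

open Classical in
/-- The probability that the lifetime equals `n`, as a function of the starting point, defined by
first-step analysis. From a boundary site the chain moves to the neighbouring interior site with
energy `M`; a terminal state has lifetime `0`, so it contributes nothing at positive times. The
values at sites outside `I_N` are irrelevant. -/
noncomputable def lifeProb (N : ℕ∞) (M : ℕ) : ℕ → ℕ × ℕ → ℝ
  | 0, z => if IsTerminal N z then 1 else 0
  | n + 1, z =>
    if z.1 = 0 then lifeProb N M n (1, M)
    else if (z.1 : ℕ∞) = N then lifeProb N M n (z.1 - 1, M)
    else if z.2 = 0 then 0
    else (lifeProb N M n (z.1 + 1, z.2 - 1) + lifeProb N M n (z.1 - 1, z.2 - 1)) / 2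

lemma lifeProb_nonneg (N : ℕ∞) (M n : ℕ) (z : ℕ × ℕ) : 0 ≤ lifeProb N M n z := by
  induction n generalizing z with
  | zero => unfold lifeProb; split_ifs <;> norm_num
  | succ n ih =>
    unfold lifeProb
    split_ifs
    · exact ih _
    · exact ih _
    · exact le_rfl
    · have := ih (z.1 + 1, z.2 - 1)
      have := ih (z.1 - 1, z.2 - 1)
      positivity

lemma lintegral_step (N : ℕ∞) (M : ℕ) (z : ℕ × ℕ) (f : ℕ × ℕ → ℝ≥0∞) :
    ∫⁻ w, f w ∂(stepKernel N M z) =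
      if z.1 = 0 then f (1, M)
      else if (z.1 : ℕ∞) = N then f (z.1 - 1, M)
      else if z.2 = 0 then f z
      else (f (z.1 + 1, z.2 - 1) + f (z.1 - 1, z.2 - 1)) / 2 := by
  have : stepKernel N M z = (step N M z).toMeasure := rfl
  rw [this]
  unfold step
  split_ifs
  · rw [PMF.toMeasure_pure, lintegral_dirac]
  · rw [PMF.toMeasure_pure, lintegral_dirac]
  · rw [PMF.toMeasure_pure, lintegral_dirac]
  · rw [← PMF.toMeasure_map _ _ (measurable_of_countable _),
      lintegral_map (measurable_of_countable _) (measurable_of_countable _), lintegral_fintype]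
    simp [ENNReal.div_eq_inv_mul]
    ring

open Classical in
/-- The transition operator, killed at the absorbing states. -/
noncomputable def killedStep (N : ℕ∞) (M : ℕ) (f : ℕ × ℕ → ℝ≥0∞) (z : ℕ × ℕ) : ℝ≥0∞ :=
  if IsTerminal N z then 0 else ∫⁻ w, f w ∂(stepKernel N M z)

open Classical in
/-- The killed operator applied `n` times to the indicator of the absorbing states solves the
recursion that defines `lifeProb`. -/
lemma killedStep_iterate (N : ℕ∞) (M n : ℕ) (z : ℕ × ℕ) :
    (killedStep N M)^[n] (fun z => if IsTerminal N z then 1 else 0) z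
      = ENNReal.ofReal (lifeProb N M n z) := by
  induction n generalizing z with
  | zero => simp only [Function.iterate_zero, id, lifeProb]; split_ifs <;> simp
  | succ n ih =>
    rw [Function.iterate_succ_apply']
    set F := (killedStep N M)^[n] (fun z => if IsTerminal N z then 1 else 0) with hF
    unfold killedStep lifeProb
    rw [lintegral_step]
    have hz : z.1 ≠ 0 → (z.1 : ℕ∞) ≠ N → z.2 = 0 → ¬ IsTerminal N z →
        lifeProb N M n z = 0 := by
      intro h1 h2 h3 h4
      cases n with
      | zero => simp [lifeProb, h4]
      | succ n => simp [lifeProb, h1, h2, h3]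
    by_cases h : IsTerminal N z
    · have h1 : z.1 ≠ 0 := h.1.1.ne'
      have h2 : (z.1 : ℕ∞) ≠ N := h.1.2.ne
      have h3 : z.2 = 0 := h.2
      simp [h, h1, h2, h3]
    · rw [if_neg h]
      split_ifs with h1 h2 h3
      · exact ih _
      · exact ih _
      · rw [ih, hz h1 h2 h3 h]
      · rw [ih, ih, ENNReal.ofReal_div_of_pos (by norm_num),
          ENNReal.ofReal_add (lifeProb_nonneg _ _ _ _) (lifeProb_nonneg _ _ _ _)]
        simp

/-- The one-step Markov property of the chain. -/
lemma lintegral_chainLaw_succ (N : ℕ∞) (M : ℕ) (z : ℕ × ℕ) (n : ℕ)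
    (Φ : ((i : Finset.Iic n) → (fun _ : ℕ => ℕ × ℕ) i) → ℝ≥0∞) (hΦ : Measurable Φ)
    (f : ℕ × ℕ → ℝ≥0∞) :
    ∫⁻ ζ, Φ (Preorder.frestrictLe n ζ) * f (ζ (n + 1)) ∂(chainLaw N M z) =
      ∫⁻ ζ, Φ (Preorder.frestrictLe n ζ) * ∫⁻ w, f w ∂(stepKernel N M (ζ n))
        ∂(chainLaw N M z) := by
  have hf : Measurable f := measurable_of_countable _
  have key := Kernel.map_frestrictLe_trajMeasure_compProd_eq_map_trajMeasure
    (X := fun _ => ℕ × ℕ) (μ₀ := Measure.dirac z) (κ := historyKernel N M) (a := n)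
  have h1 := congrArg (fun μ => ∫⁻ p, Φ p.1 * f p.2 ∂μ) key
  rw [Measure.lintegral_compProd (by fun_prop), lintegral_map _ (by fun_prop),
    lintegral_map (by fun_prop) (by fun_prop)] at h1
  · unfold chainLaw
    rw [← h1]
    refine lintegral_congr fun ζ => ?_
    have e : historyKernel N M n (Preorder.frestrictLe n ζ) = stepKernel N M (ζ n) := rfl
    rw [e]
    exact lintegral_const_mul (Φ (Preorder.frestrictLe n ζ)) hf
  · exact Measurable.lintegral_kernel_prod_right (by fun_prop)

lemma lintegral_chainLaw_zero (N : ℕ∞) (M : ℕ) (z : ℕ × ℕ) (f : ℕ × ℕ → ℝ≥0∞) :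
    ∫⁻ ζ, f (ζ 0) ∂(chainLaw N M z) = f z := by
  have hf : Measurable f := measurable_of_countable _
  have h0 : (chainLaw N M z).map (fun ζ => ζ 0) = Measure.dirac z := by
    have h : (fun ζ : ℕ → ℕ × ℕ => ζ 0) =
        (fun x => x ⟨0, Finset.mem_Iic.2 le_rfl⟩) ∘
          Preorder.frestrictLe (π := fun _ => ℕ × ℕ) 0 := rfl
    unfold chainLaw Kernel.trajMeasure
    have hd := Measure.map_dirac'
      (MeasurableEquiv.piUnique (fun i : Finset.Iic 0 => (fun _ : ℕ => ℕ × ℕ) i)).symm.measurable z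
    rw [hd, Measure.dirac_bind (Kernel.measurable _), h,
      ← Measure.map_map (by fun_prop) (by fun_prop), Kernel.traj_map_frestrictLe_apply,
      Kernel.partialTraj_self, Kernel.id_apply, Measure.map_dirac' (by fun_prop)]
    rfl
  rw [← lintegral_map hf (measurable_pi_apply 0), h0, lintegral_dirac]

open Classical in
/-- The `n`-th power of the killed operator computes expectations at time `n` on the event that no
absorbing state was visited before. -/
lemma lintegral_chainLaw_killed (N : ℕ∞) (M : ℕ) (z : ℕ × ℕ) (n : ℕ) (f : ℕ × ℕ → ℝ≥0∞) :
    ∫⁻ ζ, (∏ k ∈ Finset.range n, if IsTerminal N (ζ k) then 0 else 1) * f (ζ n)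
      ∂(chainLaw N M z) = (killedStep N M)^[n] f z := by
  induction n generalizing f with
  | zero => simpa using lintegral_chainLaw_zero N M z f
  | succ n ih =>
    rw [Function.iterate_succ_apply, ← ih]
    have := lintegral_chainLaw_succ N M z n
      (fun h => ∏ k : Finset.Iic n, if IsTerminal N (h k) then 0 else 1)
      (Finset.measurable_prod _ fun k _ =>
        (measurable_of_countable (fun w : ℕ × ℕ => if IsTerminal N w then (0 : ℝ≥0∞) else 1)).comp
          (measurable_pi_apply k)) f
    have e : ∀ ζ : ℕ → ℕ × ℕ, (∏ k : Finset.Iic n,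
        if IsTerminal N ((Preorder.frestrictLe (π := fun _ => ℕ × ℕ) n ζ) k) then (0 : ℝ≥0∞) else 1)
        = ∏ k ∈ Finset.range (n + 1), if IsTerminal N (ζ k) then 0 else 1 := by
      intro ζ
      have : Finset.range (n + 1) = Finset.Iic n := by ext; simp
      rw [this]
      exact Finset.prod_coe_sort (Finset.Iic n)
        (fun k => if IsTerminal N (ζ k) then (0 : ℝ≥0∞) else 1)
    simp only [e] at this
    rw [this]
    refine lintegral_congr fun ζ => ?_
    rw [Finset.prod_range_succ, mul_assoc]
    congr 1
    unfold killedStep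
    split_ifs <;> simp

lemma lifetime_eq_iff (N : ℕ∞) (ζ : ℕ → ℕ × ℕ) (n : ℕ) :
    lifetime N ζ = n ↔ (∀ k < n, ¬ IsTerminal N (ζ k)) ∧ IsTerminal N (ζ n) := by
  have hle : ∀ k, IsTerminal N (ζ k) → lifetime N ζ ≤ k := fun k hk => iInf₂_le k hk
  constructor
  · intro h
    have h1 : ∀ k < n, ¬ IsTerminal N (ζ k) := by
      intro k hk hT
      have := hle k hT
      rw [h] at this
      exact absurd (Nat.cast_le.1 this) (by omega)
    refine ⟨h1, ?_⟩
    by_contra hn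
    have : ((n + 1 : ℕ) : ℕ∞) ≤ lifetime N ζ := by
      refine le_iInf₂ fun k hk => ?_
      have : n < k := by
        rcases lt_trichotomy k n with h' | h' | h'
        · exact absurd hk (h1 k h')
        · exact absurd hk (h' ▸ hn)
        · exact h'
      exact_mod_cast this
    rw [h] at this
    exact absurd (Nat.cast_le.1 this) (by omega)
  · rintro ⟨h1, h2⟩
    refine le_antisymm (hle n h2) (le_iInf₂ fun k hk => ?_)
    by_contra hlt
    exact h1 k (by exact_mod_cast not_le.1 hlt) hk

lemma measurable_lifetime (N : ℕ∞) : Measurable (lifetime N) := by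
  have h : ∀ n : ℕ, MeasurableSet (lifetime N ⁻¹' {(n : ℕ∞)}) := by
    intro n
    have e : lifetime N ⁻¹' {(n : ℕ∞)} =
        (⋂ k ∈ Finset.range n, (fun ζ : ℕ → ℕ × ℕ => ζ k) ⁻¹' {z | ¬ IsTerminal N z}) ∩
          (fun ζ : ℕ → ℕ × ℕ => ζ n) ⁻¹' {z | IsTerminal N z} := by
      ext ζ
      simp [lifetime_eq_iff]
    rw [e]
    refine MeasurableSet.inter (Finset.measurableSet_biInter _ fun k _ => ?_) ?_
    · exact measurable_pi_apply k (Set.to_countable _).measurableSet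
    · exact measurable_pi_apply n (Set.to_countable _).measurableSet
  refine measurable_to_countable' fun y => ?_
  induction y using ENat.recTopCoe with
  | top =>
    have e : lifetime N ⁻¹' {⊤} = (⋃ n : ℕ, lifetime N ⁻¹' {(n : ℕ∞)})ᶜ := by
      ext ζ
      simp only [Set.mem_preimage, Set.mem_singleton_iff, Set.mem_compl_iff, Set.mem_iUnion,
        ← ENat.ne_top_iff_exists, eq_comm (a := lifetime N ζ) (b := ((_ : ℕ) : ℕ∞)), not_not]
    rw [e]
    exact (MeasurableSet.iUnion h).compl
  | coe n => exact h n

/-- The law of the lifetime is given by `lifeProb`. -/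
lemma chainLaw_lifetime_eq (N : ℕ∞) (M : ℕ) (z : ℕ × ℕ) (n : ℕ) :
    chainLaw N M z {ζ | lifetime N ζ = n} = ENNReal.ofReal (lifeProb N M n z) := by
  classical
  rw [← killedStep_iterate, ← lintegral_chainLaw_killed]
  have hm : MeasurableSet {ζ | lifetime N ζ = n} :=
    measurable_lifetime N (measurableSet_singleton _)
  rw [← lintegral_indicator_one hm]
  refine lintegral_congr fun ζ => ?_
  rw [Set.indicator_apply]
  simp only [Set.mem_ofPred_eq, lifetime_eq_iff]
  by_cases h : ∀ k < n, ¬ IsTerminal N (ζ k)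
  · rw [Finset.prod_eq_one]
    · simp only [one_mul, Pi.one_apply]
      exact if_congr (and_iff_right h) rfl rfl
    · intro k hk
      simp [h k (Finset.mem_range.1 hk)]
  · rw [if_neg (fun h' => h h'.1)]
    push Not at h
    obtain ⟨k, hk, hT⟩ := h
    rw [Finset.prod_eq_zero (Finset.mem_range.2 hk) (by simp [hT]), zero_mul]

/-! ### Renewal formulas for the generating function and the mean of the lifetime -/

section

open Classical in
/-- The probability that simple random walk started at `x` is still in the interior at all times
`0, …, k`. -/
noncomputable def exitTail (N : ℕ∞) : ℕ → ℕ → ℝ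
  | 0, x => if IsInterior N x then 1 else 0
  | k + 1, x => if IsInterior N x then (exitTail N k (x + 1) + exitTail N k (x - 1)) / 2 else 0

variable {N : ℕ∞}

lemma exitTail_zero {x : ℕ} (h : IsInterior N x) : exitTail N 0 x = 1 := by
  simp [exitTail, h]

lemma exitTail_succ {x : ℕ} (h : IsInterior N x) (k : ℕ) :
    exitTail N (k + 1) x = (exitTail N k (x + 1) + exitTail N k (x - 1)) / 2 := by
  simp [exitTail, h]

lemma exitTail_of_not_isInterior {x : ℕ} (h : ¬ IsInterior N x) (k : ℕ) :
    exitTail N k x = 0 := by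
  cases k <;> simp [exitTail, h]

lemma exitTail_mem_Icc (N : ℕ∞) (k x : ℕ) : exitTail N k x ∈ Set.Icc (0 : ℝ) 1 := by
  induction k generalizing x with
  | zero => unfold exitTail; split_ifs <;> simp
  | succ k ih =>
    by_cases h : IsInterior N x
    · rw [exitTail_succ h]
      have h1 := ih (x + 1)
      have h2 := ih (x - 1)
      constructor <;> linarith [h1.1, h1.2, h2.1, h2.2]
    · rw [exitTail_of_not_isInterior h]; simp

lemma exitTail_nonneg (N : ℕ∞) (k x : ℕ) : 0 ≤ exitTail N k x := (exitTail_mem_Icc N k x).1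

lemma exitTail_le_one (N : ℕ∞) (k x : ℕ) : exitTail N k x ≤ 1 := (exitTail_mem_Icc N k x).2

/-- The generating function `E_x[r ^ T; T ≤ i]` of the exit time `T` from the interior, truncated
at time `i`, in terms of the tails of `T` (summation by parts). -/
noncomputable def exitGF (N : ℕ∞) (r : ℝ) (x i : ℕ) : ℝ :=
  1 + ∑ k ∈ Finset.range i, (r ^ (k + 1) - r ^ k) * exitTail N k x - r ^ i * exitTail N i x

/-- The solution `f x i` of the first-step equations: `f = K` off the interior, `f x 0 = w` in the
interior, and `f x (i + 1) = c + r (f (x + 1) i + f (x - 1) i) / 2` there. So `K` is the exit value,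
`w` the terminal value, `c` the running cost and `r` the discount factor. -/
noncomputable def firstStepSol (N : ℕ∞) (r w c K : ℝ) (x i : ℕ) : ℝ :=
  w * (r ^ i * exitTail N i x) + c * ∑ k ∈ Finset.range i, r ^ k * exitTail N k x
    + exitGF N r x i * K

lemma firstStepSol_boundary {x : ℕ} (h : ¬ IsInterior N x) (r w c K : ℝ) (i : ℕ) :
    firstStepSol N r w c K x i = K := by
  simp [firstStepSol, exitGF, exitTail_of_not_isInterior h]

lemma firstStepSol_zero {x : ℕ} (h : IsInterior N x) (r w c K : ℝ) :
    firstStepSol N r w c K x 0 = w := by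
  simp [firstStepSol, exitGF, exitTail_zero h]

lemma firstStepSol_succ {x : ℕ} (h : IsInterior N x) (r w c K : ℝ) (i : ℕ) :
    firstStepSol N r w c K x (i + 1) = c + r *
      ((firstStepSol N r w c K (x + 1) i + firstStepSol N r w c K (x - 1) i) / 2) := by
  unfold firstStepSol exitGF
  rw [Finset.sum_range_succ', Finset.sum_range_succ']
  simp only [exitTail_succ h, exitTail_zero h]
  have e1 : ∀ i, ∑ k ∈ Finset.range i, r ^ (k + 1) *
      ((exitTail N k (x + 1) + exitTail N k (x - 1)) / 2) =
      r * ((∑ k ∈ Finset.range i, r ^ k * exitTail N k (x + 1) +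
        ∑ k ∈ Finset.range i, r ^ k * exitTail N k (x - 1)) / 2) := by
    intro i
    rw [← Finset.sum_add_distrib, Finset.sum_div, Finset.mul_sum]
    exact Finset.sum_congr rfl fun k _ => by ring
  have e2 : ∑ k ∈ Finset.range i, (r ^ (k + 1 + 1) - r ^ (k + 1)) *
      ((exitTail N k (x + 1) + exitTail N k (x - 1)) / 2) =
      r * ((∑ k ∈ Finset.range i, (r ^ (k + 1) - r ^ k) * exitTail N k (x + 1) +
        ∑ k ∈ Finset.range i, (r ^ (k + 1) - r ^ k) * exitTail N k (x - 1)) / 2) := by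
    rw [← Finset.sum_add_distrib, Finset.sum_div, Finset.mul_sum]
    exact Finset.sum_congr rfl fun k _ => by ring
  rw [e1, e2]
  ring

lemma isInterior_neighbours {x : ℕ} (h : IsInterior N x) :
    ((x + 1 : ℕ) : ℕ∞) ≤ N ∧ ((x - 1 : ℕ) : ℕ∞) ≤ N := by
  constructor
  · push_cast
    exact Order.add_one_le_of_lt h.2
  · exact le_trans (by exact_mod_cast Nat.sub_le x 1) h.2.le

/-- Comparison principle for the first-step equations. -/
lemma le_firstStepSol {r w c K : ℝ} (hr : 0 ≤ r) {f : ℕ → ℕ → ℝ}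
    (hb : ∀ x i : ℕ, (x : ℕ∞) ≤ N → ¬ IsInterior N x → f x i ≤ K)
    (h0 : ∀ x, IsInterior N x → f x 0 ≤ w)
    (hs : ∀ x i, IsInterior N x → f x (i + 1) ≤ c + r * ((f (x + 1) i + f (x - 1) i) / 2))
    (x i : ℕ) (hx : (x : ℕ∞) ≤ N) : f x i ≤ firstStepSol N r w c K x i := by
  induction i generalizing x with
  | zero =>
    by_cases h : IsInterior N x
    · rw [firstStepSol_zero h]; exact h0 x h
    · rw [firstStepSol_boundary h]; exact hb x 0 hx h
  | succ i ih =>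
    by_cases h : IsInterior N x
    · rw [firstStepSol_succ h]
      refine (hs x i h).trans ?_
      have h1 := ih _ (isInterior_neighbours h).1
      have h2 := ih _ (isInterior_neighbours h).2
      gcongr
    · rw [firstStepSol_boundary h]; exact hb x _ hx h

/-- Uniqueness for the first-step equations. -/
lemma eq_firstStepSol {r w c K : ℝ} {f : ℕ → ℕ → ℝ}
    (hb : ∀ x i : ℕ, (x : ℕ∞) ≤ N → ¬ IsInterior N x → f x i = K)
    (h0 : ∀ x, IsInterior N x → f x 0 = w)
    (hs : ∀ x i, IsInterior N x → f x (i + 1) = c + r * ((f (x + 1) i + f (x - 1) i) / 2))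
    (x i : ℕ) (hx : (x : ℕ∞) ≤ N) : f x i = firstStepSol N r w c K x i := by
  induction i generalizing x with
  | zero =>
    by_cases h : IsInterior N x
    · rw [firstStepSol_zero h]; exact h0 x h
    · rw [firstStepSol_boundary h]; exact hb x 0 hx h
  | succ i ih =>
    by_cases h : IsInterior N x
    · rw [firstStepSol_succ h, hs x i h, ih _ (isInterior_neighbours h).1,
        ih _ (isInterior_neighbours h).2]
    · rw [firstStepSol_boundary h]; exact hb x _ hx h

lemma exitGF_nonneg {r : ℝ} (hr : 0 ≤ r) (x i : ℕ) : 0 ≤ exitGF N r x i := by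
  have e : ∀ x i, exitGF N r x i = firstStepSol N r 0 0 1 x i := by simp [firstStepSol]
  induction i generalizing x with
  | zero =>
    by_cases h : IsInterior N x
    · rw [e, firstStepSol_zero h]
    · rw [e, firstStepSol_boundary h]; norm_num
  | succ i ih =>
    by_cases h : IsInterior N x
    · rw [e, firstStepSol_succ h, ← e, ← e]
      have := ih (x + 1)
      have := ih (x - 1)
      positivity
    · rw [e, firstStepSol_boundary h]; norm_num

lemma exitGF_one (x i : ℕ) : exitGF N 1 x i = 1 - exitTail N i x := by
  simp [exitGF]

lemma isInterior_one (hN : 2 ≤ N) : IsInterior N 1 :=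
  ⟨one_pos, lt_of_lt_of_le (by norm_num) hN⟩

lemma one_le_of_two_le (hN : 2 ≤ N) : ((1 : ℕ) : ℕ∞) ≤ N := (isInterior_one hN).2.le

/-- A nonnegative series whose partial sums satisfy the renewal inequalities converges as soon as
the expected factor `r E_1[r ^ T; T ≤ M]` picked up over one renewal cycle is smaller than `1`. This
covers factors `r > 1`, where the convergence is not automatic. -/
lemma summable_of_firstStep {M : ℕ} {r w c : ℝ} (hN : 2 ≤ N) (hr : 0 ≤ r)
    {v : ℕ → ℕ → ℕ → ℝ} (hv : ∀ n x i, 0 ≤ v n x i)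
    (hb : ∀ n x i : ℕ, (x : ℕ∞) ≤ N → ¬ IsInterior N x →
      ∑ k ∈ Finset.range (n + 1), v k x i ≤ c + r * ∑ k ∈ Finset.range n, v k 1 M)
    (h0 : ∀ n x, IsInterior N x → ∑ k ∈ Finset.range n, v k x 0 ≤ w)
    (hs : ∀ n x i, IsInterior N x → ∑ k ∈ Finset.range (n + 1), v k x (i + 1) ≤ c + r *
      ((∑ k ∈ Finset.range n, v k (x + 1) i + ∑ k ∈ Finset.range n, v k (x - 1) i) / 2))
    (hA : r * exitGF N r 1 M < 1) (x i : ℕ) (hx : (x : ℕ∞) ≤ N) :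
    Summable (fun n => v n x i) := by
  have hmono : ∀ n x i, ∑ k ∈ Finset.range n, v k x i ≤ ∑ k ∈ Finset.range (n + 1), v k x i :=
    fun n x i => by rw [Finset.sum_range_succ]; linarith [hv n x i]
  have key : ∀ n x i : ℕ, (x : ℕ∞) ≤ N → ∑ k ∈ Finset.range n, v k x i ≤
      firstStepSol N r w c (c + r * ∑ k ∈ Finset.range n, v k 1 M) x i := by
    intro n x i hx
    refine le_firstStepSol (f := fun x i => ∑ k ∈ Finset.range n, v k x i) hr ?_ ?_ ?_ x i hx
    · exact fun x i hx h => (hmono n x i).trans (hb n x i hx h)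
    · exact fun x h => h0 n x h
    · exact fun x i h => (hmono n x (i + 1)).trans (hs n x i h)
  -- At the renewal state the bound refers to itself, with a coefficient below `1`: solve for it.
  have hbound : ∀ n, ∑ k ∈ Finset.range n, v k 1 M ≤
      firstStepSol N r w c c 1 M / (1 - r * exitGF N r 1 M) := by
    intro n
    rw [le_div_iff₀ (by linarith)]
    have := key n 1 M (one_le_of_two_le hN)
    unfold firstStepSol at this ⊢
    nlinarith
  refine summable_of_sum_range_le (c := firstStepSol N r w c
    (c + r * (firstStepSol N r w c c 1 M / (1 - r * exitGF N r 1 M))) x i)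
    (fun n => hv n x i) fun n => (key n x i hx).trans ?_
  unfold firstStepSol
  have := exitGF_nonneg (N := N) hr x i
  have := hbound n
  unfold firstStepSol at this
  gcongr

variable {M : ℕ}

lemma eq_zero_or_eq_of_not_isInterior {x : ℕ} (hx : (x : ℕ∞) ≤ N) (h : ¬ IsInterior N x) :
    x = 0 ∨ (x ≠ 0 ∧ (x : ℕ∞) = N) := by
  unfold IsInterior at h
  rcases Nat.eq_zero_or_pos x with h0 | h0
  · exact Or.inl h0
  · refine Or.inr ⟨h0.ne', le_antisymm hx ?_⟩
    by_contra hlt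
    exact h ⟨h0, not_le.1 hlt⟩

lemma isInterior_reflect {m x : ℕ} (hx : x ≤ m) :
    IsInterior (m : ℕ∞) (m - x) ↔ IsInterior (m : ℕ∞) x := by
  unfold IsInterior
  simp only [Nat.cast_lt]
  omega

/-- The model is invariant under the reflection `x ↦ N - x`. -/
lemma lifeProb_reflect {m : ℕ} (hm : 2 ≤ m) (n x i : ℕ) (hx : x ≤ m) :
    lifeProb m M n (m - x, i) = lifeProb m M n (x, i) := by
  induction n generalizing x i with
  | zero =>
    classical exact if_congr (and_congr_left' (isInterior_reflect hx)) rfl rfl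
  | succ n ih =>
    simp only [lifeProb, Nat.cast_inj]
    rcases Nat.eq_zero_or_pos x with rfl | h0
    · have := ih 1 M (by omega)
      simp [show m ≠ 0 by omega, this]
    rcases hx.eq_or_lt with rfl | h1
    · have := ih 1 M (by omega)
      simp [show x ≠ 0 by omega, this]
    · simp only [show ¬ m - x = 0 by omega, show ¬ m - x = m by omega, show ¬ x = 0 by omega,
        show ¬ x = m by omega, if_false]
      refine if_congr Iff.rfl rfl ?_
      have e1 := ih (x + 1) (i - 1) (by omega)
      have e2 := ih (x - 1) (i - 1) (by omega)
      rw [show m - x + 1 = m - (x - 1) by omega, show m - x - 1 = m - (x + 1) by omega, e1, e2,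
        add_comm]

lemma exitTail_reflect {m : ℕ} (k x : ℕ) (hx : x ≤ m) :
    exitTail m k (m - x) = exitTail m k x := by
  induction k generalizing x with
  | zero =>
    classical exact if_congr (isInterior_reflect hx) rfl rfl
  | succ k ih =>
    by_cases h : IsInterior (m : ℕ∞) x
    · have h' := (isInterior_reflect hx).2 h
      have h1 := h.1
      have h2 : x < m := by exact_mod_cast h.2
      rw [exitTail_succ h, exitTail_succ h', show m - x + 1 = m - (x - 1) by omega,
        show m - x - 1 = m - (x + 1) by omega, ih _ (by omega), ih _ (by omega), add_comm]
    · rw [exitTail_of_not_isInterior h,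
        exitTail_of_not_isInterior (mt (isInterior_reflect hx).1 h)]

lemma lifeProb_zero_boundary {x i : ℕ} (h : ¬ IsInterior N x) : lifeProb N M 0 (x, i) = 0 := by
  simp [lifeProb, IsTerminal, h]

lemma lifeProb_succ_boundary (hN : 2 ≤ N) {x : ℕ} (hx : (x : ℕ∞) ≤ N) (h : ¬ IsInterior N x)
    (n i : ℕ) : lifeProb N M (n + 1) (x, i) = lifeProb N M n (1, M) := by
  rcases eq_zero_or_eq_of_not_isInterior hx h with rfl | ⟨h0, rfl⟩
  · simp [lifeProb]
  · have hm : 2 ≤ x := by exact_mod_cast hN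
    rw [← lifeProb_reflect hm n 1 M (by omega)]
    simp [lifeProb, h0]

lemma lifeProb_zero_terminal {x : ℕ} (h : IsInterior N x) : lifeProb N M 0 (x, 0) = 1 := by
  simp [lifeProb, IsTerminal, h]

lemma lifeProb_succ_terminal {x : ℕ} (h : IsInterior N x) (n : ℕ) :
    lifeProb N M (n + 1) (x, 0) = 0 := by
  simp [lifeProb, h.1.ne', h.2.ne]

lemma lifeProb_zero_interior (x i : ℕ) : lifeProb N M 0 (x, i + 1) = 0 := by
  simp [lifeProb, IsTerminal]

lemma lifeProb_succ_interior {x : ℕ} (h : IsInterior N x) (n i : ℕ) :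
    lifeProb N M (n + 1) (x, i + 1) =
      (lifeProb N M n (x + 1, i) + lifeProb N M n (x - 1, i)) / 2 := by
  simp [lifeProb, h.1.ne', h.2.ne]

/-- The lifetime is at least the initial energy. -/
lemma lifeProb_eq_zero_of_lt (hN : 2 ≤ N) (n x i : ℕ) (hx : (x : ℕ∞) ≤ N) (hi : i ≤ M)
    (hn : n < i) : lifeProb N M n (x, i) = 0 := by
  induction n generalizing x i with
  | zero =>
    obtain ⟨j, rfl⟩ : ∃ j, i = j + 1 := ⟨i - 1, by omega⟩
    exact lifeProb_zero_interior x j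
  | succ n ih =>
    by_cases h : IsInterior N x
    · obtain ⟨j, rfl⟩ : ∃ j, i = j + 1 := ⟨i - 1, by omega⟩
      rw [lifeProb_succ_interior h, ih _ _ (isInterior_neighbours h).1 (by omega) (by omega),
        ih _ _ (isInterior_neighbours h).2 (by omega) (by omega)]
      simp
    · rw [lifeProb_succ_boundary hN hx h]
      exact ih _ _ (one_le_of_two_le hN) le_rfl (by omega)

lemma summable_pow_mul_lifeProb {r : ℝ} (hN : 2 ≤ N) (hr : 0 ≤ r) (hA : r * exitGF N r 1 M < 1)
    (x i : ℕ) (hx : (x : ℕ∞) ≤ N) : Summable (fun n => r ^ n * lifeProb N M n (x, i)) := by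
  refine summable_of_firstStep (M := M) (r := r) (w := 1) (c := 0) hN hr
    (v := fun n x i => r ^ n * lifeProb N M n (x, i))
    (fun n x i => mul_nonneg (pow_nonneg hr _) (lifeProb_nonneg _ _ _ _)) ?_ ?_ ?_ hA x i hx
  · intro n x i hx h
    rw [Finset.sum_range_succ', lifeProb_zero_boundary h, Finset.mul_sum]
    simp only [mul_zero, add_zero, zero_add]
    refine (Finset.sum_congr rfl fun k _ => ?_).le
    rw [lifeProb_succ_boundary hN hx h]; ring
  · intro n x h
    cases n with
    | zero => simp
    | succ n => rw [Finset.sum_range_succ']; simp [lifeProb_zero_terminal h,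
        lifeProb_succ_terminal h]
  · intro n x i h
    rw [Finset.sum_range_succ', lifeProb_zero_interior, ← Finset.sum_add_distrib, Finset.sum_div,
      Finset.mul_sum]
    simp only [mul_zero, add_zero, zero_add]
    refine (Finset.sum_congr rfl fun k _ => ?_).le
    rw [lifeProb_succ_interior h]; ring

/-- The generating function of the lifetime: either the first excursion outlasts the initial energy
`i`, or the chain renews itself at `(1, M)` one step after it reaches the boundary. The last factor
is the generating function from `(1, M)`, found by solving the same equation there. -/
lemma hasSum_pow_mul_lifeProb {r : ℝ} (hN : 2 ≤ N) (hr : 0 ≤ r) (hA : r * exitGF N r 1 M < 1)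
    (x i : ℕ) (hx : (x : ℕ∞) ≤ N) :
    HasSum (fun n => r ^ n * lifeProb N M n (x, i))
      (r ^ i * exitTail N i x + exitGF N r x i *
        (r * (r ^ M * exitTail N M 1 / (1 - r * exitGF N r 1 M)))) := by
  have hsum := summable_pow_mul_lifeProb (M := M) hN hr hA
  set f : ℕ → ℕ → ℝ := fun x i => ∑' n, r ^ n * lifeProb N M n (x, i) with hf
  have key : ∀ x i : ℕ, (x : ℕ∞) ≤ N → f x i = firstStepSol N r 1 0 (r * f 1 M) x i := by
    refine eq_firstStepSol ?_ ?_ ?_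
    · intro x i hx h
      simp only [hf]
      rw [(hsum x i hx).tsum_eq_zero_add, lifeProb_zero_boundary h, ← tsum_mul_left]
      simp only [mul_zero, zero_add]
      refine tsum_congr fun n => ?_
      rw [lifeProb_succ_boundary hN hx h]; ring
    · intro x h
      simp only [hf]
      rw [(hsum x 0 h.2.le).tsum_eq_zero_add]
      simp [lifeProb_zero_terminal h, lifeProb_succ_terminal h]
    · intro x i h
      simp only [hf]
      rw [(hsum x (i + 1) h.2.le).tsum_eq_zero_add, lifeProb_zero_interior,
        ← (hsum _ i (isInterior_neighbours h).1).tsum_add (hsum _ i (isInterior_neighbours h).2),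
        ← tsum_div_const, ← tsum_mul_left]
      simp only [mul_zero, zero_add]
      refine tsum_congr fun n => ?_
      rw [lifeProb_succ_interior h]; ring
  -- The equation at the renewal state `(1, M)` is linear in `f 1 M`.
  have h1 := key 1 M (one_le_of_two_le hN)
  have hB : f 1 M = r ^ M * exitTail N M 1 / (1 - r * exitGF N r 1 M) := by
    rw [eq_div_iff (by linarith)]
    unfold firstStepSol at h1
    linarith
  have h2 := key x i hx
  rw [hB] at h2
  have := (hsum x i hx).hasSum
  convert this using 1
  change _ = f x i
  rw [h2]; unfold firstStepSol; ring

lemma mul_exitGF_one_lt (hS : 0 < exitTail N M 1) : 1 * exitGF N 1 1 M < 1 := by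
  rw [exitGF_one]; linarith

/-- The lifetime is almost surely finite when an excursion can last longer than `M`. -/
lemma hasSum_lifeProb (hN : 2 ≤ N) (hS : 0 < exitTail N M 1) (x i : ℕ) (hx : (x : ℕ∞) ≤ N) :
    HasSum (fun n => lifeProb N M n (x, i)) 1 := by
  have := hasSum_pow_mul_lifeProb hN zero_le_one (mul_exitGF_one_lt hS) x i hx
  simp only [one_pow, one_mul, exitGF_one] at this
  rw [sub_sub_cancel, div_self hS.ne', mul_one, add_sub_cancel] at this
  exact this

lemma sum_range_lifeProb_le_one (hN : 2 ≤ N) (hS : 0 < exitTail N M 1) (n x i : ℕ)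
    (hx : (x : ℕ∞) ≤ N) : ∑ k ∈ Finset.range n, lifeProb N M k (x, i) ≤ 1 :=
  sum_le_hasSum _ (fun _ _ => lifeProb_nonneg _ _ _ _) (hasSum_lifeProb hN hS x i hx)

/-- The expected lifetime, by the same renewal argument as for the generating function. -/
lemma hasSum_mul_lifeProb (hN : 2 ≤ N) (hS : 0 < exitTail N M 1) (x i : ℕ)
    (hx : (x : ℕ∞) ≤ N) :
    HasSum (fun n : ℕ => (n : ℝ) * lifeProb N M n (x, i))
      (∑ k ∈ Finset.range i, exitTail N k x + (1 - exitTail N i x) *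
        (1 + (∑ k ∈ Finset.range M, exitTail N k 1 + (1 - exitTail N M 1)) / exitTail N M 1)) := by
  have hle := sum_range_lifeProb_le_one (M := M) hN hS
  have hone := hasSum_lifeProb (M := M) hN hS
  have hsum : ∀ x i : ℕ, (x : ℕ∞) ≤ N → Summable fun n : ℕ => (n : ℝ) * lifeProb N M n (x, i) := by
    refine summable_of_firstStep (M := M) (r := 1) (w := 0) (c := 1) hN zero_le_one
      (v := fun n x i => (n : ℝ) * lifeProb N M n (x, i))
      (fun n x i => mul_nonneg (Nat.cast_nonneg _) (lifeProb_nonneg _ _ _ _)) ?_ ?_ ?_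
      (mul_exitGF_one_lt hS)
    · intro n x i hx h
      rw [Finset.sum_range_succ', lifeProb_zero_boundary h]
      simp only [lifeProb_succ_boundary hN hx h, Nat.cast_add, Nat.cast_one, add_mul, one_mul,
        mul_zero, add_zero, Finset.sum_add_distrib]
      linarith [hle n 1 M (one_le_of_two_le hN)]
    · intro n x h
      cases n with
      | zero => simp
      | succ n => rw [Finset.sum_range_succ']; simp [lifeProb_succ_terminal h]
    · intro n x i h
      rw [Finset.sum_range_succ', lifeProb_zero_interior]
      simp only [lifeProb_succ_interior h, Nat.cast_add, Nat.cast_one, add_mul, one_mul,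
        mul_zero, add_zero, Finset.sum_add_distrib, add_div, mul_add, mul_div_assoc',
        ← Finset.sum_div]
      linarith [hle n _ i (isInterior_neighbours h).1, hle n _ i (isInterior_neighbours h).2]
  set f : ℕ → ℕ → ℝ := fun x i => ∑' n : ℕ, (n : ℝ) * lifeProb N M n (x, i) with hf
  have key : ∀ x i : ℕ, (x : ℕ∞) ≤ N → f x i = firstStepSol N 1 0 1 (1 + f 1 M) x i := by
    refine eq_firstStepSol ?_ ?_ ?_
    · intro x i hx h
      simp only [hf]
      rw [(hsum x i hx).tsum_eq_zero_add]
      simp only [lifeProb_succ_boundary hN hx h, Nat.cast_zero, zero_mul, zero_add, Nat.cast_add,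
        Nat.cast_one, add_mul, one_mul]
      have h1 := one_le_of_two_le hN
      rw [(hsum 1 M h1).tsum_add (hone 1 M h1).summable, (hone 1 M h1).tsum_eq, add_comm]
    · intro x h
      simp only [hf]
      rw [(hsum x 0 h.2.le).tsum_eq_zero_add]
      simp [lifeProb_succ_terminal h]
    · intro x i h
      simp only [hf]
      obtain ⟨h1, h2⟩ := isInterior_neighbours h
      rw [(hsum x (i + 1) h.2.le).tsum_eq_zero_add]
      have e : ∀ n : ℕ, ((n + 1 : ℕ) : ℝ) * lifeProb N M (n + 1) (x, i + 1) =
          ((n : ℝ) * lifeProb N M n (x + 1, i) + n * lifeProb N M n (x - 1, i)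
            + (lifeProb N M n (x + 1, i) + lifeProb N M n (x - 1, i))) / 2 := by
        intro n
        rw [lifeProb_succ_interior h]; push_cast; ring
      simp only [e]
      rw [tsum_div_const, Summable.tsum_add ((hsum _ i h1).add (hsum _ i h2))
        ((hone _ i h1).summable.add (hone _ i h2).summable),
        (hsum _ i h1).tsum_add (hsum _ i h2),
        (hone _ i h1).summable.tsum_add (hone _ i h2).summable, (hone _ i h1).tsum_eq,
        (hone _ i h2).tsum_eq]
      push_cast
      ring
  have h1 := key 1 M (one_le_of_two_le hN)
  have hB : f 1 M = (∑ k ∈ Finset.range M, exitTail N k 1 + (1 - exitTail N M 1))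
      / exitTail N M 1 := by
    rw [eq_div_iff hS.ne']
    simp only [firstStepSol, exitGF_one, one_pow, one_mul, zero_mul, zero_add] at h1
    linarith
  have h2 := key x i hx
  rw [hB] at h2
  have := (hsum x i hx).hasSum
  convert this using 1
  change _ = f x i
  rw [h2]; simp only [firstStepSol, exitGF_one, one_pow, one_mul, zero_mul, zero_add]

end

/-! ### Bounds and exact formulas for the exit time of simple random walk -/

section

variable {N : ℕ∞}

/-- Comparison principle: a subsolution of the recursion for `exitTail` lies below it. -/
lemma le_exitTail {f : ℕ → ℕ → ℝ}
    (hb : ∀ k x : ℕ, (x : ℕ∞) ≤ N → ¬ IsInterior N x → f k x ≤ 0)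
    (h0 : ∀ x, IsInterior N x → f 0 x ≤ 1)
    (hs : ∀ k x, IsInterior N x → f (k + 1) x ≤ (f k (x + 1) + f k (x - 1)) / 2)
    (k x : ℕ) (hx : (x : ℕ∞) ≤ N) : f k x ≤ exitTail N k x := by
  induction k generalizing x with
  | zero =>
    by_cases h : IsInterior N x
    · rw [exitTail_zero h]; exact h0 x h
    · rw [exitTail_of_not_isInterior h]; exact hb 0 x hx h
  | succ k ih =>
    by_cases h : IsInterior N x
    · rw [exitTail_succ h]
      linarith [hs k x h, ih _ (isInterior_neighbours h).1, ih _ (isInterior_neighbours h).2]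
    · rw [exitTail_of_not_isInterior h]; exact hb _ x hx h

lemma isInterior_top_iff {x : ℕ} : IsInterior ⊤ x ↔ 0 < x := by
  simp [IsInterior]

/-- On the half-line the walk has fewer ways to exit. -/
lemma exitTail_le_top (k x : ℕ) : exitTail N k x ≤ exitTail ⊤ k x := by
  induction k generalizing x with
  | zero =>
    by_cases h : IsInterior N x
    · rw [exitTail_zero h, exitTail_zero (isInterior_top_iff.2 h.1)]
    · rw [exitTail_of_not_isInterior h]; exact exitTail_nonneg _ _ _
  | succ k ih =>
    by_cases h : IsInterior N x
    · rw [exitTail_succ h, exitTail_succ (isInterior_top_iff.2 h.1)]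
      linarith [ih (x + 1), ih (x - 1)]
    · rw [exitTail_of_not_isInterior h]; exact exitTail_nonneg _ _ _

lemma exitTail_top_zero (k : ℕ) : exitTail ⊤ k 0 = 0 :=
  exitTail_of_not_isInterior (by simp [IsInterior]) k

/-- The far end `N` matters at most as much as the harmonic measure `x / N` of `N`. -/
lemma exitTail_top_sub_le (hN : 2 ≤ N) (k x : ℕ) (hx : (x : ℕ∞) ≤ N) :
    exitTail ⊤ k x - x * ((N : ℝ≥0∞)⁻¹).toReal ≤ exitTail N k x := by
  induction N using ENat.recTopCoe with
  | top => simp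
  | coe m =>
    have hm : (0 : ℝ) < m := by
      have : 2 ≤ m := by exact_mod_cast hN
      positivity
    have e : (((m : ℕ∞) : ℝ≥0∞)⁻¹).toReal = (m : ℝ)⁻¹ := by simp
    rw [e]
    refine le_exitTail (f := fun k x => exitTail ⊤ k x - x * (m : ℝ)⁻¹) ?_ ?_ ?_ k x hx
    · intro k x hx h
      rcases eq_zero_or_eq_of_not_isInterior hx h with rfl | ⟨_, h2⟩
      · simp [exitTail_top_zero]
      · obtain rfl : x = m := by exact_mod_cast h2
        rw [mul_inv_cancel₀ hm.ne']
        linarith [exitTail_le_one ⊤ k x]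
    · intro x h
      have : 0 ≤ (x : ℝ) * (m : ℝ)⁻¹ := by positivity
      linarith [exitTail_le_one ⊤ 0 x]
    · intro k x h
      rw [exitTail_succ (isInterior_top_iff.2 h.1)]
      have : ((x - 1 : ℕ) : ℝ) = x - 1 := by have := h.1; push_cast [this]; ring
      rw [this]
      push_cast
      apply le_of_eq
      ring

/-- The far end `N` is reached within `k` steps with probability at most `(k + x²) / N²`. -/
lemma exitTail_top_sub_sq_le (hN : 2 ≤ N) (k x : ℕ) (hx : (x : ℕ∞) ≤ N) :
    exitTail ⊤ k x - (k + x ^ 2) * ((N : ℝ≥0∞)⁻¹).toReal ^ 2 ≤ exitTail N k x := by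
  induction N using ENat.recTopCoe with
  | top => simp
  | coe m =>
    have hm : (0 : ℝ) < m := by
      have : 2 ≤ m := by exact_mod_cast hN
      positivity
    have e : (((m : ℕ∞) : ℝ≥0∞)⁻¹).toReal = (m : ℝ)⁻¹ := by simp
    rw [e]
    refine le_exitTail (f := fun k x => exitTail ⊤ k x - (k + x ^ 2) * (m : ℝ)⁻¹ ^ 2)
      ?_ ?_ ?_ k x hx
    · intro k x hx h
      rcases eq_zero_or_eq_of_not_isInterior hx h with rfl | ⟨_, h2⟩
      · simp only [exitTail_top_zero, zero_sub, Left.neg_nonpos_iff]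
        positivity
      · obtain rfl : x = m := by exact_mod_cast h2
        have h1 : 0 ≤ (k : ℝ) * (x : ℝ)⁻¹ ^ 2 := by positivity
        have h3 : (x : ℝ) ^ 2 * (x : ℝ)⁻¹ ^ 2 = 1 := by field_simp
        rw [add_mul, h3]
        linarith [exitTail_le_one ⊤ k x]
    · intro x h
      have : 0 ≤ (((0 : ℕ) : ℝ) + (x : ℝ) ^ 2) * (m : ℝ)⁻¹ ^ 2 := by positivity
      linarith [exitTail_le_one ⊤ 0 x]
    · intro k x h
      rw [exitTail_succ (isInterior_top_iff.2 h.1)]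
      have : ((x - 1 : ℕ) : ℝ) = x - 1 := by have := h.1; push_cast [this]; ring
      rw [this]
      push_cast
      apply le_of_eq
      ring

/-- A walk started at distance at least `d` from both ends leaves the interior within `k` steps
with probability at most `k / d²`. -/
lemma one_sub_le_exitTail {d : ℕ} (hd : 0 < d) (hdN : ((2 * d : ℕ) : ℕ∞) ≤ N) (k : ℕ) :
    1 - (k : ℝ) / d ^ 2 ≤ exitTail N k d := by
  have hd' : (0 : ℝ) < d := by exact_mod_cast hd
  have := le_exitTail (N := N) (f := fun k x => 1 - ((k : ℝ) + ((x : ℝ) - d) ^ 2) / d ^ 2)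
    ?_ ?_ ?_ k d (le_trans (by exact_mod_cast (by omega : d ≤ 2 * d)) hdN)
  · simpa using this
  · intro k x hx h
    rw [sub_nonpos, le_div_iff₀ (by positivity), one_mul]
    rcases eq_zero_or_eq_of_not_isInterior hx h with rfl | ⟨_, h2⟩
    · have : (0 : ℝ) ≤ k := Nat.cast_nonneg k
      push_cast
      nlinarith
    · rw [← h2] at hdN
      have h3 : 2 * d ≤ x := by exact_mod_cast hdN
      have h4 : (2 : ℝ) * d ≤ x := by exact_mod_cast h3
      have : (0 : ℝ) ≤ k := Nat.cast_nonneg k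
      nlinarith
  · intro x h
    have : 0 ≤ (((0 : ℕ) : ℝ) + ((x : ℝ) - d) ^ 2) / (d : ℝ) ^ 2 := by positivity
    linarith
  · intro k x h
    have : ((x - 1 : ℕ) : ℝ) = x - 1 := by have := h.1; push_cast [this]; ring
    rw [this]
    push_cast
    apply le_of_eq
    field_simp
    ring

/-- The increment in the starting point of the half-line tail is the probability that the minimum
of the free walk up to time `k` is exactly `-x`, which is a single binomial weight. -/
lemma exitTail_top_succ_sub (k x : ℕ) :
    exitTail ⊤ k (x + 1) - exitTail ⊤ k x = (k.choose ((k + x + 1) / 2) : ℝ) / 2 ^ k := by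
  induction k generalizing x with
  | zero =>
    rw [exitTail_zero (isInterior_top_iff.2 (Nat.succ_pos x))]
    rcases Nat.eq_zero_or_pos x with rfl | h
    · simp [exitTail_top_zero]
    · rw [exitTail_zero (isInterior_top_iff.2 h), Nat.choose_eq_zero_of_lt (by omega)]
      simp
  | succ k ih =>
    rw [exitTail_succ (isInterior_top_iff.2 (Nat.succ_pos x))]
    have hpascal : (k + 1 + x + 1) / 2 = (k + x) / 2 + 1 := by omega
    rw [hpascal, Nat.choose_succ_succ]
    have h1 := ih (x + 1)
    rw [show (k + (x + 1) + 1) / 2 = (k + x) / 2 + 1 by omega] at h1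
    rcases Nat.eq_zero_or_pos x with rfl | h
    · have h0 := ih 0
      rw [exitTail_top_zero] at h0 ⊢
      have hsymm : k.choose ((k + 0 + 1) / 2) = k.choose ((k + 0) / 2) := by
        rw [← Nat.choose_symm (by omega : (k + 0) / 2 ≤ k)]
        congr 1
        omega
      rw [hsymm] at h0
      simp only [zero_add] at *
      push_cast
      rw [pow_succ, exitTail_top_zero]
      linear_combination (h0 + h1) / 2
    · rw [exitTail_succ (isInterior_top_iff.2 h)]
      obtain ⟨y, rfl⟩ : ∃ y, x = y + 1 := ⟨x - 1, by omega⟩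
      have h0 := ih y
      rw [show k + y + 1 = k + (y + 1) by ring] at h0
      simp only [Nat.add_sub_cancel] at *
      push_cast
      rw [pow_succ]
      linear_combination (h0 + h1) / 2

lemma exitTail_top_one (k : ℕ) :
    exitTail ⊤ k 1 = (((k + 1) / 2).centralBinom : ℝ) / 4 ^ ((k + 1) / 2) := by
  have h := exitTail_top_succ_sub k 0
  rw [exitTail_top_zero, sub_zero, zero_add, add_zero] at h
  rw [h]
  rcases Nat.even_or_odd' k with ⟨m, rfl | rfl⟩
  · rw [show (2 * m + 1) / 2 = m by omega, Nat.centralBinom, pow_mul]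
    norm_num
  · have h1 : (2 * (m + 1)).choose (m + 1) = 2 * (2 * m + 1).choose (m + 1) := by
      rw [show 2 * (m + 1) = (2 * m + 1) + 1 by ring, Nat.choose_succ_succ',
        Nat.choose_symm_half]
      ring
    have h2 : (4 : ℝ) ^ (m + 1) = 2 ^ (2 * m + 1) * 2 := by
      rw [show (4 : ℝ) = 2 ^ 2 by norm_num, ← pow_mul, ← pow_succ]; congr 1
    rw [show (2 * m + 1 + 1) / 2 = m + 1 by omega, Nat.centralBinom, h1, h2]
    push_cast
    field_simp

/-- The Wallis products in terms of central binomial coefficients. -/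
lemma centralBinom_sq_mul_W (m : ℕ) :
    ((m.centralBinom : ℝ) / 4 ^ m) ^ 2 * ((2 * m + 1) * Real.Wallis.W m) = 1 := by
  induction m with
  | zero => simp [Real.Wallis.W]
  | succ m ih =>
    have h : ((m : ℝ) + 1) * ((m + 1).centralBinom : ℝ) = 2 * (2 * m + 1) * m.centralBinom := by
      exact_mod_cast Nat.succ_mul_centralBinom_succ m
    have h' : ((m + 1).centralBinom : ℝ) = 2 * (2 * m + 1) * m.centralBinom / (m + 1) := by
      rw [eq_div_iff (by positivity)]; linarith
    refine Eq.trans ?_ ih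
    rw [Real.Wallis.W_succ, h', pow_succ]
    push_cast
    field_simp
    ring

lemma exitTail_top_one_sq (k : ℕ) : exitTail ⊤ k 1 ^ 2 =
    ((2 * ((k + 1) / 2 : ℕ) + 1) * Real.Wallis.W ((k + 1) / 2))⁻¹ := by
  rw [exitTail_top_one]
  exact eq_inv_of_mul_eq_one_left (centralBinom_sq_mul_W _)

/-- The bound on the excursion tail that is uniform in time; it dominates the Riemann sums near
time `0`. -/
lemma exitTail_top_one_le (k : ℕ) : exitTail ⊤ k 1 ≤ 2 * (√(k + 1 : ℝ))⁻¹ := by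
  have hW : (1 : ℝ) / 2 ≤ Real.Wallis.W ((k + 1) / 2) := by
    refine le_trans ?_ (Real.Wallis.le_W _)
    set m : ℝ := (((k + 1) / 2 : ℕ) : ℝ)
    have hm : 0 ≤ m := Nat.cast_nonneg _
    rw [div_mul_eq_mul_div, le_div_iff₀ (by positivity)]
    nlinarith [Real.pi_gt_three]
  have hk : ((k : ℝ) + 1) ≤ 2 * (((k + 1) / 2 : ℕ) : ℝ) + 1 := by
    exact_mod_cast (by omega : k + 1 ≤ 2 * ((k + 1) / 2) + 1)
  refine abs_le_of_sq_le_sq' ?_ (by positivity) |>.2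
  rw [exitTail_top_one_sq, mul_pow, inv_pow, Real.sq_sqrt (by positivity)]
  have h1 : ((k : ℝ) + 1) * (1 / 2) ≤
      (2 * (((k + 1) / 2 : ℕ) : ℝ) + 1) * Real.Wallis.W ((k + 1) / 2) := by gcongr
  have hpos : 0 < ((k : ℝ) + 1) * (1 / 2) := by positivity
  calc _ ≤ (((k : ℝ) + 1) * (1 / 2))⁻¹ := inv_anti₀ hpos h1
    _ ≤ _ := by
      rw [mul_inv]
      have : 0 ≤ ((k : ℝ) + 1)⁻¹ := by positivity
      norm_num
      linarith

/-- The tail asymptotics of the excursion length, from Wallis' product. -/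
lemma tendsto_sqrt_mul_exitTail_top_one :
    Tendsto (fun k : ℕ => √(k : ℝ) * exitTail ⊤ k 1) atTop (𝓝 √(2 / Real.pi)) := by
  have hdiv : Tendsto (fun k : ℕ => (k + 1) / 2) atTop atTop :=
    tendsto_atTop_mono (fun k => (by omega : k / 2 ≤ (k + 1) / 2))
      (Nat.tendsto_div_const_atTop (by norm_num))
  have hW := Real.Wallis.tendsto_W_nhds_pi_div_two.comp hdiv
  have hratio : Tendsto (fun k : ℕ => (k : ℝ) / (2 * ((k + 1) / 2 : ℕ) + 1)) atTop (𝓝 1) := by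
    have h1 : Tendsto (fun k : ℕ => 1 - 2 / ((k : ℝ) + 2)) atTop (𝓝 (1 - 0)) := by
      refine tendsto_const_nhds.sub (Tendsto.div_atTop tendsto_const_nhds ?_)
      exact tendsto_atTop_add_const_right _ _ tendsto_natCast_atTop_atTop
    rw [sub_zero] at h1
    refine tendsto_of_tendsto_of_tendsto_of_le_of_le h1 tendsto_const_nhds ?_ ?_
    · intro k
      have : (2 * ((k + 1) / 2 : ℕ) + 1 : ℝ) ≤ k + 2 := by
        exact_mod_cast (by omega : 2 * ((k + 1) / 2) + 1 ≤ k + 2)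
      calc 1 - 2 / ((k : ℝ) + 2) = k / ((k : ℝ) + 2) := by field_simp; ring
        _ ≤ _ := div_le_div_of_nonneg_left (Nat.cast_nonneg k) (by positivity) this
    · intro k
      have : (k : ℝ) ≤ 2 * ((k + 1) / 2 : ℕ) + 1 := by
        exact_mod_cast (by omega : k ≤ 2 * ((k + 1) / 2) + 1)
      exact div_le_one_of_le₀ this (by positivity)
  have h2 : Tendsto (fun k : ℕ => (k : ℝ) * exitTail ⊤ k 1 ^ 2) atTop (𝓝 (1 * (Real.pi / 2)⁻¹)) := by
    refine (hratio.mul (hW.inv₀ (by positivity))).congr fun k => ?_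
    rw [exitTail_top_one_sq, mul_inv, div_eq_mul_inv]
    simp only [Function.comp]
    ring
  have h3 := (Real.continuous_sqrt.tendsto _).comp h2
  rw [one_mul, inv_div] at h3
  refine h3.congr fun k => ?_
  simp only [Function.comp]
  rw [Real.sqrt_mul (Nat.cast_nonneg k), Real.sqrt_sq (exitTail_nonneg _ _ _)]

end

/-! ### Reflection principle and central limit theorem -/

instance : NullSingletonClass (gaussianReal 0 1) :=
  nullSingletonClass_gaussianReal one_ne_zero

lemma gaussianReal_real_Iio_neg (s : ℝ) :
    (gaussianReal 0 1).real (Set.Iio (-s)) = normalTail s := by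
  have h : (gaussianReal 0 1).map (fun x => -x) = gaussianReal 0 1 := by
    rw [gaussianReal_map_neg, neg_zero]
  unfold normalTail
  conv_rhs => rw [← h]
  rw [map_measureReal_apply measurable_neg measurableSet_Ioi]
  congr 1
  ext x
  simp

lemma gaussianReal_real_Icc {c : ℝ} (hc : 0 ≤ c) :
    (gaussianReal 0 1).real (Set.Icc (-c) c) = 1 - 2 * normalTail c := by
  have h : Set.Icc (-c) c = (Set.Iio (-c) ∪ Set.Ioi c)ᶜ := by
    ext x; simp
  rw [h, probReal_compl_eq_one_sub (by measurability),
    measureReal_union (Set.disjoint_left.2 fun x h1 h2 => by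
      simp only [Set.mem_Iio, Set.mem_Ioi] at h1 h2; linarith) measurableSet_Ioi,
    gaussianReal_real_Iio_neg]
  unfold normalTail
  ring

/-- The formula for `[-c, c]` persists as a lower bound when `c < 0`; this spares a case distinction
when intervals shrink to a point. -/
lemma gaussianReal_real_Icc_ge (c : ℝ) :
    1 - 2 * normalTail c ≤ (gaussianReal 0 1).real (Set.Icc (-c) c) := by
  rcases le_or_gt 0 c with hc | hc
  · rw [gaussianReal_real_Icc hc]
  · have h1 : (1 : ℝ) ≤ (gaussianReal 0 1).real (Set.Iio (-c)) + normalTail c := by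
      unfold normalTail
      rw [← probReal_univ (μ := gaussianReal 0 1)]
      refine le_trans (measureReal_mono ?_) (measureReal_union_le _ _)
      intro x _
      simp only [Set.mem_union, Set.mem_Iio, Set.mem_Ioi]
      rcases lt_or_ge x (-c) with h | h
      · exact Or.inl h
      · exact Or.inr (by linarith)
    rw [gaussianReal_real_Iio_neg] at h1
    have : 0 ≤ (gaussianReal 0 1).real (Set.Icc (-c) c) := measureReal_nonneg
    linarith

lemma normalTail_eq (s : ℝ) :
    normalTail s = normalTail 0 - ∫ x in (0 : ℝ)..s, gaussianPDFReal 0 1 x := by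
  have hi : Integrable (gaussianPDFReal 0 1) := integrable_gaussianPDFReal 0 1
  have h : ∀ s, normalTail s = ∫ x in Set.Ioi s, gaussianPDFReal 0 1 x := by
    intro s
    unfold normalTail
    rw [measureReal_def, gaussianReal_apply_eq_integral 0 one_ne_zero, ENNReal.toReal_ofReal]
    exact setIntegral_nonneg measurableSet_Ioi fun x _ => gaussianPDFReal_nonneg 0 1 x
  have := intervalIntegral.integral_Ioi_sub_Ioi' (a := 0) (b := s) hi.integrableOn hi.integrableOn
  rw [h, h, ← this]
  ring

lemma continuous_gaussianPDFReal : Continuous (gaussianPDFReal 0 1) := by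
  unfold gaussianPDFReal
  fun_prop

lemma hasDerivAt_normalTail (s : ℝ) : HasDerivAt normalTail (-gaussianPDFReal 0 1 s) s := by
  rw [funext normalTail_eq]
  have := intervalIntegral.integral_hasDerivAt_right (a := 0) (b := s)
    (continuous_gaussianPDFReal.intervalIntegrable _ _)
    continuous_gaussianPDFReal.stronglyMeasurable.stronglyMeasurableAtFilter
    continuous_gaussianPDFReal.continuousAt
  simpa using this.const_sub (normalTail 0)

lemma continuous_normalTail : Continuous normalTail :=
  continuous_iff_continuousAt.2 fun s => (hasDerivAt_normalTail s).continuousAt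

lemma normalTail_zero : normalTail 0 = 1 / 2 := by
  have := gaussianReal_real_Icc (le_refl 0)
  rw [neg_zero, Set.Icc_self, measureReal_def, measure_singleton] at this
  simp only [ENNReal.toReal_zero] at this
  linarith

lemma tendsto_normalTail_atTop : Tendsto normalTail atTop (𝓝 0) := by
  have h := tendsto_measure_iInter_atTop (μ := gaussianReal 0 1) (s := fun s : ℝ => Set.Ioi s)
    (fun s => measurableSet_Ioi.nullMeasurableSet) (fun a b h => Set.Ioi_subset_Ioi h)
    ⟨0, measure_ne_top _ _⟩
  have e : ⋂ s : ℝ, Set.Ioi s = ∅ := by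
    ext x
    simp only [Set.mem_iInter, Set.mem_Ioi, Set.mem_empty_iff_false, iff_false, not_forall, not_lt]
    exact ⟨x, le_rfl⟩
  rw [e, measure_empty] at h
  exact (ENNReal.tendsto_toReal ENNReal.zero_ne_top).comp h

/-- The law of simple random walk on `ℤ ⊆ ℝ` after `k` steps. -/
noncomputable def walkLaw : ℕ → Measure ℝ
  | 0 => Measure.dirac 0
  | k + 1 => (2⁻¹ : ℝ≥0∞) • ((walkLaw k).map (· + 1) + (walkLaw k).map (· + (-1)))

instance (k : ℕ) : IsProbabilityMeasure (walkLaw k) := by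
  induction k with
  | zero => unfold walkLaw; infer_instance
  | succ k ih =>
    have h1 : IsProbabilityMeasure ((walkLaw k).map (· + (1 : ℝ))) :=
      Measure.isProbabilityMeasure_map (by fun_prop)
    have h2 : IsProbabilityMeasure ((walkLaw k).map (· + (-1 : ℝ))) :=
      Measure.isProbabilityMeasure_map (by fun_prop)
    refine ⟨?_⟩
    unfold walkLaw
    simp only [Measure.smul_apply, Measure.add_apply, measure_univ, smul_eq_mul]
    rw [one_add_one_eq_two, ENNReal.inv_mul_cancel (by norm_num) (by norm_num)]

lemma charFun_walkLaw_succ (k : ℕ) (t : ℝ) :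
    charFun (walkLaw (k + 1)) t = Real.cos t * charFun (walkLaw k) t := by
  have h1 : IsProbabilityMeasure ((walkLaw k).map (· + (1 : ℝ))) :=
    Measure.isProbabilityMeasure_map (by fun_prop)
  have h2 : IsProbabilityMeasure ((walkLaw k).map (· + (-1 : ℝ))) :=
    Measure.isProbabilityMeasure_map (by fun_prop)
  have e : charFun (walkLaw (k + 1)) t = 2⁻¹ * (charFun ((walkLaw k).map (· + (1 : ℝ))) t
      + charFun ((walkLaw k).map (· + (-1 : ℝ))) t) := by
    simp only [charFun_eq_integral_innerProbChar]
    rw [walkLaw, integral_smul_measure, integral_add_measure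
      (BoundedContinuousFunction.integrable _ _) (BoundedContinuousFunction.integrable _ _)]
    simp [mul_add]
  rw [e, charFun_map_add_const, charFun_map_add_const, Complex.ofReal_cos, Complex.cos]
  simp
  ring_nf

lemma charFun_walkLaw (k : ℕ) (t : ℝ) : charFun (walkLaw k) t = (Real.cos t : ℂ) ^ k := by
  induction k with
  | zero => simp [walkLaw]
  | succ k ih => rw [charFun_walkLaw_succ, ih, pow_succ, mul_comm]

/-- Reflection principle: the walk started at `x` has not hit `0` by time `k` with the probability
that the free walk lies in `[-x, x)` at time `k`. -/
lemma exitTail_top_eq_walkLaw (k x : ℕ) :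
    exitTail ⊤ k x = (walkLaw k).real (Set.Ico (-x : ℝ) x) := by
  have hd : ∀ (k : ℕ) (y : ℝ), 0 ≤ y → (walkLaw k).real (Set.Ico (-y) y) =
      (walkLaw k).real (Set.Iio y) - (walkLaw k).real (Set.Iio (-y)) := by
    intro k y hy
    rw [← measureReal_sdiff (Set.Iio_subset_Iio (by linarith)) measurableSet_Iio]
    congr 1
    ext z; simp [and_comm]
  have hrec : ∀ (k : ℕ) (y : ℝ), (walkLaw (k + 1)).real (Set.Iio y) =
      ((walkLaw k).real (Set.Iio (y - 1)) + (walkLaw k).real (Set.Iio (y + 1))) / 2 := by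
    intro k y
    have e1 : (· + (1 : ℝ)) ⁻¹' Set.Iio y = Set.Iio (y - 1) := by ext z; simp [lt_sub_iff_add_lt]
    have e2 : (· + (-1 : ℝ)) ⁻¹' Set.Iio y = Set.Iio (y + 1) := by
      ext z
      simp only [Set.mem_preimage, Set.mem_Iio]
      constructor <;> intro h <;> linarith
    rw [walkLaw, measureReal_ennreal_smul_apply, measureReal_add_apply,
      map_measureReal_apply (by fun_prop) measurableSet_Iio,
      map_measureReal_apply (by fun_prop) measurableSet_Iio, e1, e2]
    simp
    ring
  induction k generalizing x with
  | zero =>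
    rcases Nat.eq_zero_or_pos x with rfl | h
    · simp [exitTail_top_zero]
    · rw [exitTail_zero (isInterior_top_iff.2 h)]
      have : (0 : ℝ) < x := by exact_mod_cast h
      simp [walkLaw, measureReal_def, this]
  | succ k ih =>
    rcases Nat.eq_zero_or_pos x with rfl | h
    · simp [exitTail_top_zero]
    · rw [exitTail_succ (isInterior_top_iff.2 h), ih, ih, hd _ _ (by positivity),
        hd _ _ (by positivity), hd _ _ (by positivity), hrec, hrec]
      push_cast [h]
      ring_nf

/-- The central limit theorem for simple random walk. -/
lemma tendsto_walkLaw_gaussian :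
    Tendsto (β := ProbabilityMeasure ℝ)
      (fun k : ℕ => ⟨(walkLaw k).map ((√(k : ℝ))⁻¹ * ·),
        Measure.isProbabilityMeasure_map (by fun_prop)⟩) atTop (𝓝 ⟨gaussianReal 0 1, inferInstance⟩) := by
  refine ProbabilityMeasure.tendsto_iff_tendsto_charFun.2 fun t => ?_
  have hint : ∀ f : ℝ → ℝ, Measurable f → ∫ x, f x ∂(walkLaw 1) = (f 1 + f (-1)) / 2 := by
    intro f hf
    simp only [walkLaw]
    rw [Measure.map_dirac, Measure.map_dirac, integral_smul_measure, integral_add_measure]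
    · simp
      ring
    · exact integrable_dirac (by simp)
    · exact integrable_dirac (by simp)
  have h := tendsto_charFun_inv_sqrt_mul_pow (P := walkLaw 1) (X := fun x => x)
    aemeasurable_id (by have := hint (fun x => x) measurable_id; rw [this]; norm_num)
    (by
      have := hint (fun x => x ^ 2) (by fun_prop)
      simp only [Pi.pow_apply]
      rw [this]; norm_num) t
  rw [Measure.map_id'] at h
  simp only [ProbabilityMeasure.coe_mk, charFun_gaussianReal]
  convert h using 2 with k
  · rw [charFun_map_mul, charFun_walkLaw, charFun_walkLaw, pow_one]
  · push_cast
    congr 1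
    ring

/-- The central limit theorem on intervals of converging normalized length. The intervals are
compared with fixed ones on either side of the limit length `b`. -/
lemma tendsto_walkLaw_Ico {k d : ℕ → ℕ} {b : ℝ} (hb : 0 ≤ b) (hk : Tendsto k atTop atTop)
    (hd : Tendsto (fun n => (d n : ℝ) / √(k n : ℝ)) atTop (𝓝 b)) :
    Tendsto (fun n => (walkLaw (k n)).real (Set.Ico (-d n : ℝ) (d n))) atTop
      (𝓝 (1 - 2 * normalTail b)) := by
  have hlim : ∀ c : ℝ, Tendsto (fun n => (walkLaw (k n)).real
      (Set.Icc (-(c * √(k n : ℝ))) (c * √(k n : ℝ)))) atTop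
      (𝓝 ((gaussianReal 0 1).real (Set.Icc (-c) c))) := by
    intro c
    have h1 := ProbabilityMeasure.tendsto_measure_of_null_frontier_of_tendsto'
      tendsto_walkLaw_gaussian (E := Set.Icc (-c) c) (by
        simp only [ProbabilityMeasure.coe_mk]
        refine measure_mono_null (t := {-c, c}) ?_ ((Set.toFinite _).measure_zero _)
        rcases le_or_gt (-c) c with h | h
        · rw [frontier_Icc h]
        · rw [Set.Icc_eq_empty (not_le.2 h)]; simp)
    have h2 := ((ENNReal.tendsto_toReal (measure_ne_top (gaussianReal 0 1) _)).comp h1).comp hk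
    refine h2.congr' ?_
    filter_upwards [hk.eventually_gt_atTop 0] with n hn
    have hs : 0 < √(k n : ℝ) := Real.sqrt_pos.2 (by exact_mod_cast hn)
    simp only [Function.comp, ProbabilityMeasure.coe_mk]
    rw [measureReal_def, Measure.map_apply (by fun_prop) measurableSet_Icc]
    congr 2
    ext x
    simp only [Set.mem_preimage, Set.mem_Icc, ← div_eq_inv_mul, le_div_iff₀ hs, div_le_iff₀ hs,
      neg_mul]
  have hcont : Continuous fun c => 1 - 2 * normalTail c := by
    have := continuous_normalTail
    fun_prop
  have hkpos : ∀ᶠ n in atTop, 0 < √(k n : ℝ) := by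
    filter_upwards [hk.eventually_gt_atTop 0] with n hn
    exact Real.sqrt_pos.2 (by exact_mod_cast hn)
  refine tendsto_order.2 ⟨fun l hl => ?_, fun l hl => ?_⟩
  · obtain ⟨c, hlc, hcb⟩ : ∃ c, l < 1 - 2 * normalTail c ∧ c < b := by
      have := (hcont.tendsto b).eventually_const_lt hl
      obtain ⟨c, hc, hc'⟩ := ((this.filter_mono nhdsWithin_le_nhds).and
        (self_mem_nhdsWithin (s := Set.Iio b))).exists
      exact ⟨c, hc, hc'⟩
    filter_upwards [(hlim c).eventually_const_lt (hlc.trans_le (gaussianReal_real_Icc_ge c)),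
      hd.eventually_const_lt hcb, hkpos] with n h1 h2 h3
    refine h1.trans_le (measureReal_mono ?_)
    rw [lt_div_iff₀ h3] at h2
    intro z hz
    exact ⟨by linarith [hz.1], by linarith [hz.2]⟩
  · obtain ⟨c, hlc, hcb⟩ : ∃ c, 1 - 2 * normalTail c < l ∧ b < c := by
      have := (hcont.tendsto b).eventually_lt_const hl
      obtain ⟨c, hc, hc'⟩ := ((this.filter_mono nhdsWithin_le_nhds).and
        (self_mem_nhdsWithin (s := Set.Ioi b))).exists
      exact ⟨c, hc, hc'⟩
    rw [← gaussianReal_real_Icc (hb.trans hcb.le)] at hlc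
    filter_upwards [(hlim c).eventually_lt_const hlc, hd.eventually_lt_const hcb, hkpos]
      with n h1 h2 h3
    refine lt_of_le_of_lt (measureReal_mono ?_) h1
    rw [div_lt_iff₀ h3] at h2
    intro z hz
    exact ⟨by linarith [hz.1], by linarith [hz.2]⟩

/-! ### Scaling limits of exit probabilities -/

section

/-- The scaling regime: the squared distance of the starting site `x M` from the boundary is
asymptotically `a M`, and the squared length of the interval is of larger order than `M`. -/
structure DiffusiveRegime (N : ℕ → ℕ∞) (x : ℕ → ℕ) (a : ℝ≥0∞) : Prop where
  two_le : ∀ M, 1 ≤ M → 2 ≤ N M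
  le : ∀ M, 1 ≤ M → (x M : ℕ∞) ≤ N M
  tendsto_dist : Tendsto
    (fun M : ℕ => min ((x M : ℝ≥0∞) ^ 2) (((N M : ℝ≥0∞) - (x M : ℝ≥0∞)) ^ 2) / (M : ℝ≥0∞))
    atTop (𝓝 a)
  tendsto_size : Tendsto (fun M : ℕ => (M : ℝ≥0∞) / (N M : ℝ≥0∞) ^ 2) atTop (𝓝 0)

/-- The limiting probability `P(a τ > v)` that an excursion started at diffusive distance `√a` from
the boundary lasts longer than `v`, where `τ` has the Lévy law. Meaningful for `v > 0`. -/
noncomputable def hitTail (a : ℝ≥0∞) (v : ℝ) : ℝ :=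
  if a = ⊤ then 1 else 1 - 2 * normalTail (√(a.toReal / v))

variable {N : ℕ → ℕ∞} {x : ℕ → ℕ} {a : ℝ≥0∞}

/-- By reflection, the starting point may be replaced by its distance from the boundary. -/
lemma exists_boundary_dist {N : ℕ∞} {x : ℕ} (hx : (x : ℕ∞) ≤ N) :
    ∃ d : ℕ, (∀ k, exitTail N k x = exitTail N k d) ∧ ((2 * d : ℕ) : ℕ∞) ≤ N ∧
      min ((x : ℝ≥0∞) ^ 2) (((N : ℝ≥0∞) - (x : ℝ≥0∞)) ^ 2) = (d : ℝ≥0∞) ^ 2 := by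
  induction N using ENat.recTopCoe with
  | top =>
    refine ⟨x, fun _ => rfl, le_top, ?_⟩
    simp [ENNReal.top_sub]
  | coe m =>
    have hxm : x ≤ m := by exact_mod_cast hx
    have e : ((m : ℕ∞) : ℝ≥0∞) - (x : ℝ≥0∞) = ((m - x : ℕ) : ℝ≥0∞) := by simp
    rw [e]
    rcases le_total x (m - x) with h | h
    · refine ⟨x, fun _ => rfl, by exact_mod_cast (by omega : 2 * x ≤ m), ?_⟩
      rw [min_eq_left]
      gcongr
    · refine ⟨m - x, fun k => (exitTail_reflect k x hxm).symm,
        by exact_mod_cast (by omega : 2 * (m - x) ≤ m), ?_⟩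
      rw [min_eq_right]
      gcongr

lemma DiffusiveRegime.tendsto_mul_inv_sq (h : DiffusiveRegime N x a) :
    Tendsto (fun M : ℕ => (M : ℝ) * ((N M : ℝ≥0∞)⁻¹).toReal ^ 2) atTop (𝓝 0) := by
  have := (ENNReal.tendsto_toReal ENNReal.zero_ne_top).comp h.tendsto_size
  refine this.congr fun M => ?_
  simp [ENNReal.toReal_inv, div_eq_mul_inv]

lemma DiffusiveRegime.tendsto_sqrt_mul_inv (h : DiffusiveRegime N x a) :
    Tendsto (fun M : ℕ => √(M : ℝ) * ((N M : ℝ≥0∞)⁻¹).toReal) atTop (𝓝 0) := by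
  have := (Real.continuous_sqrt.tendsto _).comp h.tendsto_mul_inv_sq
  rw [Real.sqrt_zero] at this
  refine this.congr fun M => ?_
  simp only [Function.comp]
  rw [Real.sqrt_mul (Nat.cast_nonneg _), Real.sqrt_sq ENNReal.toReal_nonneg]

lemma tendsto_atTop_of_div_tendsto {k : ℕ → ℕ} {v : ℝ} (hv : 0 < v)
    (hk : Tendsto (fun M : ℕ => (k M : ℝ) / M) atTop (𝓝 v)) : Tendsto k atTop atTop := by
  rw [← tendsto_natCast_atTop_iff (R := ℝ)]
  refine (hk.pos_mul_atTop hv tendsto_natCast_atTop_atTop).congr' ?_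
  filter_upwards [eventually_gt_atTop 0] with M hM
  have : (M : ℝ) ≠ 0 := by positivity
  field_simp

/-- Diffusive scaling limit of the first excursion. For `a < ∞` the half-line walk gives the limit;
for `a = ∞` the walk has no time to reach the boundary, by a second moment bound. -/
lemma DiffusiveRegime.tendsto_exitTail (h : DiffusiveRegime N x a) {k : ℕ → ℕ} {v : ℝ}
    (hv : 0 < v) (hk : Tendsto (fun M : ℕ => (k M : ℝ) / M) atTop (𝓝 v)) :
    Tendsto (fun M => exitTail (N M) (k M) (x M)) atTop (𝓝 (hitTail a v)) := by
  have hex : ∀ M, ∃ d : ℕ, 1 ≤ M → (∀ k, exitTail (N M) k (x M) = exitTail (N M) k d) ∧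
      ((2 * d : ℕ) : ℕ∞) ≤ N M ∧
      min ((x M : ℝ≥0∞) ^ 2) (((N M : ℝ≥0∞) - (x M : ℝ≥0∞)) ^ 2) = (d : ℝ≥0∞) ^ 2 := by
    intro M
    by_cases hM : 1 ≤ M
    · obtain ⟨d, hd⟩ := exists_boundary_dist (h.le M hM)
      exact ⟨d, fun _ => hd⟩
    · exact ⟨0, fun h => absurd h hM⟩
  choose d hd using hex
  have hdist : Tendsto (fun M : ℕ => ENNReal.ofReal ((d M : ℝ) ^ 2 / M)) atTop (𝓝 a) := by
    refine h.tendsto_dist.congr' ?_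
    filter_upwards [eventually_ge_atTop 1] with M hM
    have hM' : (0 : ℝ) < M := by exact_mod_cast hM
    rw [(hd M hM).2.2, ENNReal.ofReal_div_of_pos hM', ENNReal.ofReal_pow (Nat.cast_nonneg _)]
    simp
  have hcongr : (fun M => exitTail (N M) (k M) (d M)) =ᶠ[atTop]
      fun M => exitTail (N M) (k M) (x M) := by
    filter_upwards [eventually_ge_atTop 1] with M hM
    exact ((hd M hM).1 _).symm
  refine Tendsto.congr' hcongr ?_
  by_cases ha : a = ⊤
  · subst ha
    rw [hitTail, if_pos rfl]
    have hd' : Tendsto (fun M : ℕ => (d M : ℝ) ^ 2 / M) atTop atTop :=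
      ENNReal.tendsto_ofReal_nhds_top.1 hdist
    have h0 : Tendsto (fun M : ℕ => 1 - ((k M : ℝ) / M) / ((d M : ℝ) ^ 2 / M)) atTop
        (𝓝 (1 - 0)) := tendsto_const_nhds.sub (hk.div_atTop hd')
    rw [sub_zero] at h0
    refine tendsto_of_tendsto_of_tendsto_of_le_of_le' h0 tendsto_const_nhds ?_
      (Eventually.of_forall fun M => exitTail_le_one _ _ _)
    filter_upwards [eventually_ge_atTop 1, hd'.eventually_gt_atTop 0] with M hM hpos
    have hM' : (0 : ℝ) < M := by exact_mod_cast hM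
    have hdpos : 0 < d M := by
      rcases Nat.eq_zero_or_pos (d M) with h0 | h0
      · rw [h0] at hpos; simp at hpos
      · exact h0
    rw [div_div_div_cancel_right₀ hM'.ne']
    exact one_sub_le_exitTail hdpos (hd M hM).2.1 _
  · rw [hitTail, if_neg ha]
    have hd' : Tendsto (fun M : ℕ => (d M : ℝ) ^ 2 / M) atTop (𝓝 a.toReal) := by
      refine ((ENNReal.tendsto_toReal ha).comp hdist).congr fun M => ?_
      simp only [Function.comp]
      rw [ENNReal.toReal_ofReal (by positivity)]
    have htop : Tendsto (fun M => exitTail ⊤ (k M) (d M)) atTop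
        (𝓝 (1 - 2 * normalTail (√(a.toReal / v)))) := by
      simp only [exitTail_top_eq_walkLaw]
      refine tendsto_walkLaw_Ico (Real.sqrt_nonneg _) (tendsto_atTop_of_div_tendsto hv hk) ?_
      refine ((Real.continuous_sqrt.tendsto _).comp (hd'.div hk hv.ne')).congr' ?_
      filter_upwards [eventually_ge_atTop 1] with M hM
      have hM' : (0 : ℝ) < M := by exact_mod_cast hM
      simp only [Function.comp]
      rw [Pi.div_apply, div_div_div_cancel_right₀ hM'.ne', Real.sqrt_div (sq_nonneg _),
        Real.sqrt_sq (Nat.cast_nonneg _)]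
    have herr : Tendsto (fun M : ℕ => ((k M : ℝ) + d M ^ 2) * ((N M : ℝ≥0∞)⁻¹).toReal ^ 2) atTop
        (𝓝 0) := by
      have := (hk.add hd').mul h.tendsto_mul_inv_sq
      rw [mul_zero] at this
      refine this.congr' ?_
      filter_upwards [eventually_ge_atTop 1] with M hM
      have hM' : (0 : ℝ) < M := by exact_mod_cast hM
      field_simp
    have hlow := htop.sub herr
    rw [sub_zero] at hlow
    refine tendsto_of_tendsto_of_tendsto_of_le_of_le' hlow htop ?_
      (Eventually.of_forall fun M => exitTail_le_top _ _)
    filter_upwards [eventually_ge_atTop 1] with M hM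
    refine exitTail_top_sub_sq_le (h.two_le M hM) _ _ ?_
    exact le_trans (by exact_mod_cast (by omega : d M ≤ 2 * d M)) (hd M hM).2.1

/-- The rescaled tail of an excursion from the site next to the boundary. -/
lemma DiffusiveRegime.tendsto_sqrt_mul_exitTail_one (h : DiffusiveRegime N x a) {k : ℕ → ℕ} {v : ℝ}
    (hv : 0 < v) (hk : Tendsto (fun M : ℕ => (k M : ℝ) / M) atTop (𝓝 v)) :
    Tendsto (fun M : ℕ => √(M : ℝ) * exitTail (N M) (k M) 1) atTop
      (𝓝 (√(2 / Real.pi) * v ^ (-(1 / 2) : ℝ))) := by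
  have hk' := tendsto_atTop_of_div_tendsto hv hk
  have htop : Tendsto (fun M : ℕ => √(M : ℝ) * exitTail ⊤ (k M) 1) atTop
      (𝓝 (√(2 / Real.pi) * v ^ (-(1 / 2) : ℝ))) := by
    have h1 := (tendsto_sqrt_mul_exitTail_top_one.comp hk').mul
      (hk.rpow_const (p := -(1 / 2)) (Or.inl hv.ne'))
    refine h1.congr' ?_
    filter_upwards [eventually_ge_atTop 1, hk'.eventually_ge_atTop 1] with M hM hkM
    have hM' : (0 : ℝ) < M := by exact_mod_cast hM
    have hkM' : (0 : ℝ) < k M := by exact_mod_cast hkM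
    simp only [Function.comp]
    rw [Real.rpow_neg (by positivity), ← Real.sqrt_eq_rpow, Real.sqrt_div hkM'.le]
    have := Real.sqrt_pos.2 hkM'
    have := Real.sqrt_pos.2 hM'
    field_simp
  have hlow := htop.sub h.tendsto_sqrt_mul_inv
  rw [sub_zero] at hlow
  refine tendsto_of_tendsto_of_tendsto_of_le_of_le' hlow htop ?_
    (Eventually.of_forall fun M =>
      mul_le_mul_of_nonneg_left (exitTail_le_top _ _) (Real.sqrt_nonneg _))
  filter_upwards [eventually_ge_atTop 1] with M hM
  have := exitTail_top_sub_le (h.two_le M hM) (k M) 1 (one_le_of_two_le (h.two_le M hM))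
  rw [← mul_sub]
  refine mul_le_mul_of_nonneg_left ?_ (Real.sqrt_nonneg _)
  simpa using this

/-- A normalized sum as the integral of a step function with steps of length `1 / M`. -/
lemma integral_step_eq_sum (f : ℕ → ℝ) {M : ℕ} (hM : 0 < M) (n : ℕ) :
    IntervalIntegrable (fun v : ℝ => f ⌊v * M⌋₊) volume 0 (n / M) ∧
      ∫ v in (0 : ℝ)..(n / M), f ⌊v * M⌋₊ = (∑ k ∈ Finset.range n, f k) / M := by
  have hM' : (0 : ℝ) < M := by exact_mod_cast hM
  have hle : ∀ n : ℕ, (n : ℝ) / M ≤ ((n + 1 : ℕ) : ℝ) / M := fun n => by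
    gcongr; simp
  have hcongr : ∀ n : ℕ, Set.EqOn (fun _ => f n) (fun v : ℝ => f ⌊v * M⌋₊)
      (Set.Ioo ((n : ℝ) / M) (((n + 1 : ℕ) : ℝ) / M)) := by
    intro n v hv
    have h1 : (n : ℝ) ≤ v * M := by rw [← div_le_iff₀ hM']; exact hv.1.le
    have h2 : v * M < n + 1 := by
      have := hv.2
      rw [lt_div_iff₀ hM'] at this
      exact_mod_cast this
    have : ⌊v * M⌋₊ = n := by
      rw [Nat.floor_eq_iff (le_trans (Nat.cast_nonneg n) h1)]
      exact ⟨h1, h2⟩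
    simp [this]
  have hint : ∀ n : ℕ, IntervalIntegrable (fun v : ℝ => f ⌊v * M⌋₊) volume ((n : ℝ) / M)
      (((n + 1 : ℕ) : ℝ) / M) := by
    intro n
    refine (intervalIntegrable_const (c := f n)).congr_uIoo ?_
    rw [Set.uIoo_of_le (hle n)]
    exact hcongr n
  induction n with
  | zero => simp
  | succ n ih =>
    refine ⟨ih.1.trans (hint n), ?_⟩
    rw [← intervalIntegral.integral_add_adjacent_intervals ih.1 (hint n), ih.2,
      ← intervalIntegral.integral_congr_Ioo_of_le (hle n) (hcongr n),
      intervalIntegral.integral_const, Finset.sum_range_succ]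
    push_cast
    rw [smul_eq_mul]
    field_simp
    ring

lemma integrableOn_rpow_neg_half :
    IntegrableOn (fun v : ℝ => v ^ (-(1 / 2) : ℝ)) (Set.Ioc 0 1) := by
  have := intervalIntegral.intervalIntegrable_rpow' (a := 0) (b := 1) (r := -(1 / 2)) (by norm_num)
  exact (intervalIntegrable_iff_integrableOn_Ioc_of_le zero_le_one).1 this

/-- Convergence of Riemann sums with an integrable singularity `v ^ (-1/2)` at `0`. -/
lemma tendsto_riemann_sum {F : ℕ → ℕ → ℝ} {G : ℝ → ℝ} {n : ℕ → ℕ} {u C : ℝ} (hu : u ≤ 1)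
    (hu0 : 0 ≤ u)
    (hn : Tendsto (fun M : ℕ => (n M : ℝ) / M) atTop (𝓝 u)) (hnM : ∀ M, 1 ≤ M → n M ≤ M)
    (hF : ∀ v : ℝ, 0 < v → Tendsto (fun M : ℕ => F M ⌊v * M⌋₊) atTop (𝓝 (G v)))
    (hC : ∀ M k : ℕ, k < M → |F M k| ≤ C * (√(M : ℝ) * (√(k + 1 : ℝ))⁻¹)) :
    Tendsto (fun M : ℕ => (∑ k ∈ Finset.range (n M), F M k) / M) atTop
      (𝓝 (∫ v in (0 : ℝ)..u, G v)) := by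
  have hI : ∀ (w : ℝ) (f : ℝ → ℝ), 0 ≤ w → w ≤ 1 → ∫ v in (0 : ℝ)..w, f v =
      ∫ v in Set.Ioc (0 : ℝ) 1, (Set.Iic w).indicator f v := by
    intro w f hw0 hw
    rw [intervalIntegral.integral_of_le hw0, setIntegral_indicator measurableSet_Iic]
    congr 2
    ext z
    simp only [Set.mem_Ioc, Set.mem_inter_iff, Set.mem_Iic]
    constructor
    · rintro ⟨h1, h2⟩; exact ⟨⟨h1, h2.trans hw⟩, h2⟩
    · rintro ⟨⟨h1, _⟩, h2⟩; exact ⟨h1, h2⟩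
  have hw1 : ∀ M : ℕ, 1 ≤ M → (n M : ℝ) / M ≤ 1 := fun M hM =>
    div_le_one_of_le₀ (by exact_mod_cast hnM M hM) (Nat.cast_nonneg _)
  rw [hI u G hu0 hu]
  have heq : (fun M : ℕ => ∫ v in Set.Ioc (0 : ℝ) 1,
      (Set.Iic ((n M : ℝ) / M)).indicator (fun v : ℝ => F M ⌊v * M⌋₊) v) =ᶠ[atTop]
      fun M : ℕ => (∑ k ∈ Finset.range (n M), F M k) / M := by
    filter_upwards [eventually_ge_atTop 1] with M hM
    rw [← hI _ _ (by positivity) (hw1 M hM), (integral_step_eq_sum (F M) hM (n M)).2]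
  refine Tendsto.congr' heq ?_
  refine tendsto_integral_filter_of_dominated_convergence
    (fun v => C * v ^ (-(1 / 2) : ℝ)) ?_ ?_ (integrableOn_rpow_neg_half.const_mul C) ?_
  · refine Eventually.of_forall fun M => Measurable.aestronglyMeasurable ?_
    refine Measurable.indicator ?_ measurableSet_Iic
    exact (measurable_of_countable (F M)).comp (Nat.measurable_floor.comp (by fun_prop))
  · filter_upwards [eventually_ge_atTop 1] with M hM
    have hM' : (0 : ℝ) < M := by exact_mod_cast hM
    have hne : ∀ᵐ v : ℝ ∂(volume.restrict (Set.Ioc (0 : ℝ) 1)), v ≠ 1 :=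
      ae_restrict_of_ae (by simp [ae_iff])
    filter_upwards [ae_restrict_mem measurableSet_Ioc, hne] with v hv hv1
    have hv0 : 0 < v := hv.1
    have hlt : v < 1 := lt_of_le_of_ne hv.2 hv1
    have hkM : ⌊v * M⌋₊ < M := by
      rw [Nat.floor_lt (by positivity)]
      nlinarith
    have h1 := hC M _ hkM
    have hCnn : 0 ≤ C := by
      have h0 := (abs_nonneg _).trans h1
      by_contra hneg
      have : 0 < √(M : ℝ) * (√(⌊v * M⌋₊ + 1 : ℝ))⁻¹ := by positivity
      nlinarith
    have h2 : √(M : ℝ) * (√(⌊v * M⌋₊ + 1 : ℝ))⁻¹ ≤ v ^ (-(1 / 2) : ℝ) := by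
      rw [Real.rpow_neg hv0.le, ← Real.sqrt_eq_rpow, ← div_eq_mul_inv,
        div_le_iff₀ (by positivity), ← div_eq_inv_mul, le_div_iff₀ (by positivity),
        ← Real.sqrt_mul (by positivity)]
      refine Real.sqrt_le_sqrt ?_
      rw [mul_comm]
      exact (Nat.lt_floor_add_one _).le
    have h3 : |F M ⌊v * M⌋₊| ≤ C * v ^ (-(1 / 2) : ℝ) :=
      h1.trans (mul_le_mul_of_nonneg_left h2 hCnn)
    rw [Real.norm_eq_abs, Set.indicator_apply]
    split_ifs
    · exact h3
    · rw [abs_zero]; positivity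
  · have hne : ∀ᵐ v : ℝ ∂(volume.restrict (Set.Ioc (0 : ℝ) 1)), v ≠ u :=
      ae_restrict_of_ae (by simp [ae_iff])
    filter_upwards [ae_restrict_mem measurableSet_Ioc, hne] with v hv hvu
    rcases lt_or_gt_of_ne hvu with h | h
    · rw [Set.indicator_of_mem (show v ∈ Set.Iic u from h.le)]
      refine (hF v hv.1).congr' ?_
      filter_upwards [hn.eventually_const_lt h] with M hM
      rw [Set.indicator_of_mem (show v ∈ Set.Iic _ from hM.le)]
    · rw [Set.indicator_of_notMem (by simpa using h)]
      refine Tendsto.congr' ?_ tendsto_const_nhds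
      filter_upwards [hn.eventually_lt_const h] with M hM
      rw [Set.indicator_of_notMem (by simpa using hM)]

end

/-! ### Convergence of the moment generating function and of the mean -/

section

variable {N : ℕ → ℕ∞} {x : ℕ → ℕ} {a : ℝ≥0∞}

lemma exp_div_pow (t : ℝ) (M k : ℕ) :
    Real.exp (t / M) ^ k = Real.exp (t * (k / M)) := by
  rw [← Real.exp_nat_mul]
  congr 1
  ring

lemma tendsto_exp_div_sub_one (t : ℝ) :
    Tendsto (fun M : ℕ => (M : ℝ) * (Real.exp (t / M) - 1)) atTop (𝓝 t) := by
  have hd : HasDerivAt (fun y : ℝ => Real.exp (t * y)) t 0 := by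
    simpa using ((hasDerivAt_id (0 : ℝ)).const_mul t).exp
  have h := hd.tendsto_slope_zero.comp (tendsto_nhdsWithin_iff.2
    ⟨tendsto_inv_atTop_zero.comp tendsto_natCast_atTop_atTop, ?_⟩ :
      Tendsto (fun M : ℕ => (M : ℝ)⁻¹) atTop (𝓝[≠] 0))
  · simpa [Function.comp_def, div_eq_mul_inv] using h
  · filter_upwards [eventually_ge_atTop 1] with M hM
    simp only [Set.mem_compl_iff, Set.mem_singleton_iff, inv_eq_zero, Nat.cast_eq_zero]
    omega

lemma tendsto_exp_div (t : ℝ) : Tendsto (fun M : ℕ => Real.exp (t / M)) atTop (𝓝 1) := by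
  rw [← Real.exp_zero]
  exact (Real.continuous_exp.tendsto _).comp
    (tendsto_const_nhds.div_atTop tendsto_natCast_atTop_atTop)

lemma tendsto_self_div : Tendsto (fun M : ℕ => (M : ℝ) / M) atTop (𝓝 1) := by
  refine tendsto_const_nhds.congr' ?_
  filter_upwards [eventually_ge_atTop 1] with M hM
  have : (M : ℝ) ≠ 0 := by positivity
  rw [div_self this]

lemma tendsto_floor_div {v : ℝ} (hv : 0 ≤ v) :
    Tendsto (fun M : ℕ => (⌊v * M⌋₊ : ℝ) / M) atTop (𝓝 v) :=
  (tendsto_nat_floor_mul_div_atTop hv).comp tendsto_natCast_atTop_atTop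

lemma exp_mul_le {t v : ℝ} (hv0 : 0 ≤ v) (hv : v ≤ 1) : Real.exp (t * v) ≤ Real.exp |t| := by
  refine Real.exp_le_exp.2 ((le_abs_self _).trans ?_)
  rw [abs_mul, abs_of_nonneg hv0]
  exact mul_le_of_le_one_right (abs_nonneg _) hv

/-- Discounted occupation sum of the first excursion. -/
lemma DiffusiveRegime.tendsto_sum_exitTail (h : DiffusiveRegime N x a) {n : ℕ → ℕ} {u : ℝ}
    (hu : u ≤ 1) (hu0 : 0 < u) (hn : Tendsto (fun M : ℕ => (n M : ℝ) / M) atTop (𝓝 u))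
    (hnM : ∀ M, 1 ≤ M → n M ≤ M) (t : ℝ) :
    Tendsto (fun M : ℕ => (∑ k ∈ Finset.range (n M),
      Real.exp (t / M) ^ k * exitTail (N M) k (x M)) / M) atTop
      (𝓝 (∫ v in (0 : ℝ)..u, Real.exp (t * v) * hitTail a v)) := by
  refine tendsto_riemann_sum (F := fun M k => Real.exp (t / M) ^ k * exitTail (N M) k (x M))
    (C := Real.exp |t|) hu hu0.le hn hnM ?_ ?_
  · intro v hv
    have hfl := tendsto_floor_div hv.le
    simp only [exp_div_pow]
    exact ((Real.continuous_exp.tendsto _).comp (hfl.const_mul t)).mul (h.tendsto_exitTail hv hfl)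
  · intro M k hk
    have hM : (0 : ℝ) < M := by exact_mod_cast (Nat.zero_le k).trans_lt hk
    rw [exp_div_pow, abs_of_nonneg (mul_nonneg (Real.exp_pos _).le (exitTail_nonneg _ _ _))]
    refine mul_le_mul (exp_mul_le (by positivity) ?_) ?_ (exitTail_nonneg _ _ _) (Real.exp_pos _).le
    · exact div_le_one_of_le₀ (by exact_mod_cast hk.le) hM.le
    · refine (exitTail_le_one _ _ _).trans ?_
      rw [← div_eq_mul_inv, one_le_div (by positivity)]
      exact Real.sqrt_le_sqrt (by exact_mod_cast hk)

/-- Discounted occupation sum of an excursion from the site next to the boundary. -/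
lemma DiffusiveRegime.tendsto_sum_exitTail_one (h : DiffusiveRegime N x a) (t : ℝ) :
    Tendsto (fun M : ℕ => √(M : ℝ) * ((∑ k ∈ Finset.range M,
      Real.exp (t / M) ^ k * exitTail (N M) k 1) / M)) atTop
      (𝓝 (√(2 / Real.pi) * ∫ v in (0 : ℝ)..1, v ^ (-(1 / 2) : ℝ) * Real.exp (v * t))) := by
  have := tendsto_riemann_sum (n := fun M => M) (u := 1) (C := Real.exp |t| * 2)
    (F := fun M k => Real.exp (t / M) ^ k * (√(M : ℝ) * exitTail (N M) k 1))
    (G := fun v => Real.exp (t * v) * (√(2 / Real.pi) * v ^ (-(1 / 2) : ℝ)))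
    le_rfl zero_le_one tendsto_self_div (fun _ _ => le_rfl) ?_ ?_
  · rw [← intervalIntegral.integral_const_mul]
    convert this using 2
    · rw [← mul_div_assoc, Finset.mul_sum]
      congr 1
      exact Finset.sum_congr rfl fun k _ => by ring
    · refine intervalIntegral.integral_congr fun v _ => ?_
      rw [mul_comm t v]; ring
  · intro v hv
    have hfl := tendsto_floor_div hv.le
    simp only [exp_div_pow]
    exact ((Real.continuous_exp.tendsto _).comp (hfl.const_mul t)).mul
      (h.tendsto_sqrt_mul_exitTail_one hv hfl)
  · intro M k hk
    have hM : (0 : ℝ) < M := by exact_mod_cast (Nat.zero_le k).trans_lt hk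
    have hS := exitTail_nonneg (N M) k 1
    rw [exp_div_pow, abs_of_nonneg (by positivity), mul_assoc]
    have h1 : exitTail (N M) k 1 ≤ 2 * (√(k + 1 : ℝ))⁻¹ :=
      (exitTail_le_top _ _).trans (exitTail_top_one_le k)
    refine mul_le_mul (exp_mul_le (by positivity) ?_) ?_ (by positivity) (Real.exp_pos _).le
    · exact div_le_one_of_le₀ (by exact_mod_cast hk.le) hM.le
    · calc _ ≤ √(M : ℝ) * (2 * (√(k + 1 : ℝ))⁻¹) :=
            mul_le_mul_of_nonneg_left h1 (Real.sqrt_nonneg _)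
        _ = _ := by ring

lemma sqrt_two_div_pi_pos : 0 < √(2 / Real.pi) := Real.sqrt_pos.2 (by positivity)

lemma DiffusiveRegime.tendsto_sqrt_mul_survival (h : DiffusiveRegime N x a) :
    Tendsto (fun M : ℕ => √(M : ℝ) * exitTail (N M) M 1) atTop (𝓝 √(2 / Real.pi)) := by
  simpa using h.tendsto_sqrt_mul_exitTail_one one_pos tendsto_self_div

lemma DiffusiveRegime.eventually_survival_pos (h : DiffusiveRegime N x a) :
    ∀ᶠ M : ℕ in atTop, 0 < exitTail (N M) M 1 := by
  filter_upwards [h.tendsto_sqrt_mul_survival.eventually_const_lt sqrt_two_div_pi_pos] with M hM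
  exact pos_of_mul_pos_right hM (Real.sqrt_nonneg _)

lemma DiffusiveRegime.tendsto_inv_mul_survival (h : DiffusiveRegime N x a) :
    Tendsto (fun M : ℕ => ((M : ℝ) * exitTail (N M) M 1)⁻¹) atTop (𝓝 0) := by
  have h1 : Tendsto (fun M : ℕ => (√(M : ℝ))⁻¹) atTop (𝓝 0) :=
    tendsto_inv_atTop_zero.comp (Real.tendsto_sqrt_atTop.comp tendsto_natCast_atTop_atTop)
  have h2 := h1.mul (h.tendsto_sqrt_mul_survival.inv₀ sqrt_two_div_pi_pos.ne')
  rw [zero_mul] at h2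
  refine h2.congr fun M => ?_
  rw [← mul_inv, ← mul_assoc, Real.mul_self_sqrt (Nat.cast_nonneg _)]

lemma DiffusiveRegime.tendsto_sum_div_survival (h : DiffusiveRegime N x a) (t : ℝ) :
    Tendsto (fun M : ℕ => (∑ k ∈ Finset.range M, Real.exp (t / M) ^ k * exitTail (N M) k 1)
      / (M * exitTail (N M) M 1)) atTop
      (𝓝 (∫ v in (0 : ℝ)..1, v ^ (-(1 / 2) : ℝ) * Real.exp (v * t))) := by
  have h1 := (h.tendsto_sum_exitTail_one t).div h.tendsto_sqrt_mul_survival sqrt_two_div_pi_pos.ne'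
  rw [mul_div_cancel_left₀ _ sqrt_two_div_pi_pos.ne'] at h1
  refine h1.congr' ?_
  filter_upwards [eventually_ge_atTop 1] with M hM
  have hM' : (0 : ℝ) < M := by exact_mod_cast hM
  have := Real.sqrt_pos.2 hM'
  rw [Pi.div_apply, mul_div_mul_left _ _ this.ne', div_div]

lemma exitGF_eq (N : ℕ∞) (r : ℝ) (x i : ℕ) : exitGF N r x i =
    1 + (r - 1) * ∑ k ∈ Finset.range i, r ^ k * exitTail N k x - r ^ i * exitTail N i x := by
  unfold exitGF
  rw [Finset.mul_sum]
  congr 2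
  exact Finset.sum_congr rfl fun k _ => by ring

/-- The renewal denominator `1 - r E_1[r ^ T; T ≤ M]` is comparable to the probability `S(M, 1)`
that an excursion outlasts the energy `M`, and the ratio converges to `e^t - 𝓘(t)`. -/
lemma DiffusiveRegime.tendsto_denominator (h : DiffusiveRegime N x a) (t : ℝ) :
    Tendsto (fun M : ℕ => (1 - Real.exp (t / M) * exitGF (N M) (Real.exp (t / M)) 1 M)
      / exitTail (N M) M 1) atTop (𝓝 (Real.exp t - calI t)) := by
  have hr := tendsto_exp_div t
  have hr1 := tendsto_exp_div_sub_one t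
  have h1 := (hr1.mul h.tendsto_inv_mul_survival).neg
  have h2 := (hr.mul (hr1.mul (h.tendsto_sum_div_survival t)))
  have h3 := hr.mul_const (Real.exp t)
  have h4 := (h1.sub h2).add h3
  have e : -(t * 0) - 1 * (t * ∫ v in (0 : ℝ)..1, v ^ (-(1 / 2) : ℝ) * Real.exp (v * t))
      + 1 * Real.exp t = Real.exp t - calI t := by
    unfold calI; ring
  rw [e] at h4
  refine h4.congr' ?_
  filter_upwards [eventually_ge_atTop 1, h.eventually_survival_pos] with M hM hS
  have hM' : (0 : ℝ) < M := by exact_mod_cast hM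
  have hrM : Real.exp (t / M) ^ M = Real.exp t := by
    rw [exp_div_pow, div_self hM'.ne', mul_one]
  rw [exitGF_eq, hrM]
  field_simp
  ring

lemma DiffusiveRegime.eventually_mul_exitGF_lt_one (h : DiffusiveRegime N x a) {t : ℝ}
    (ht : 0 < Real.exp t - calI t) :
    ∀ᶠ M : ℕ in atTop, Real.exp (t / M) * exitGF (N M) (Real.exp (t / M)) 1 M < 1 := by
  filter_upwards [(h.tendsto_denominator t).eventually_const_lt ht, h.eventually_survival_pos]
    with M hM hS
  rwa [div_pos_iff_of_pos_right hS, sub_pos] at hM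

/-- The limit of `E r^λ` from the renewal state `(1, M)`. -/
lemma DiffusiveRegime.tendsto_renewal (h : DiffusiveRegime N x a) {t : ℝ}
    (ht : 0 < Real.exp t - calI t) :
    Tendsto (fun M : ℕ => Real.exp (t / M) ^ M * exitTail (N M) M 1 /
      (1 - Real.exp (t / M) * exitGF (N M) (Real.exp (t / M)) 1 M)) atTop
      (𝓝 (Real.exp t * (1 / (Real.exp t - calI t)))) := by
  have h1 := ((h.tendsto_denominator t).inv₀ ht.ne').const_mul (Real.exp t)
  rw [← one_div] at h1
  refine h1.congr' ?_
  filter_upwards [eventually_ge_atTop 1] with M hM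
  have hM' : (0 : ℝ) < M := by exact_mod_cast hM
  have hrM : Real.exp (t / M) ^ M = Real.exp t := by
    rw [exp_div_pow, div_self hM'.ne', mul_one]
  rw [hrM, inv_div, mul_div_assoc]

/-- Convergence of the moment generating function of the normalized lifetime. -/
lemma DiffusiveRegime.tendsto_lifetime_mgf (h : DiffusiveRegime N x a) {y : ℕ → ℕ} {u : ℝ}
    (hu : u ≤ 1) (hu0 : 0 < u) (hylim : Tendsto (fun M : ℕ => (y M : ℝ) / M) atTop (𝓝 u))
    (hy : ∀ M, 1 ≤ M → y M ≤ M) {t : ℝ} (ht : 0 < Real.exp t - calI t) :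
    Tendsto (fun M : ℕ => ∑' n : ℕ, Real.exp (t * (n / M)) * lifeProb (N M) M n (x M, y M)) atTop
      (𝓝 (Real.exp (t * u) * hitTail a u +
        (1 + t * (∫ v in (0 : ℝ)..u, Real.exp (t * v) * hitTail a v)
          - Real.exp (t * u) * hitTail a u) * (Real.exp t * (1 / (Real.exp t - calI t))))) := by
  have hr := tendsto_exp_div t
  have hpow : Tendsto (fun M : ℕ => Real.exp (t / M) ^ (y M)) atTop (𝓝 (Real.exp (t * u))) := by
    simp only [exp_div_pow]
    exact (Real.continuous_exp.tendsto _).comp (hylim.const_mul t)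
  have h1 := hpow.mul (h.tendsto_exitTail hu0 hylim)
  have h2 := ((tendsto_exp_div_sub_one t).mul (h.tendsto_sum_exitTail hu hu0 hylim hy t)).const_add 1
  have h3 := h1.add ((h2.sub h1).mul (hr.mul (h.tendsto_renewal ht)))
  rw [one_mul] at h3
  refine h3.congr' ?_
  filter_upwards [eventually_ge_atTop 1, h.eventually_mul_exitGF_lt_one ht] with M hM hA
  have hM' : (0 : ℝ) < M := by exact_mod_cast hM
  have := hasSum_pow_mul_lifeProb (h.two_le M hM) (Real.exp_pos (t / M)).le hA (x M) (y M)
    (h.le M hM)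
  simp only [exp_div_pow t M] at this
  rw [this.tsum_eq, exitGF_eq (N M) _ (x M)]
  simp only [exp_div_pow t M]
  field_simp

/-- The limit of the normalized mean lifetime: the mean of `min (u, a τ)`, plus the mean
`2 = 1 + E ξ` of the lifetime after the first visit to the boundary, if there is one before `u`. -/
noncomputable def meanLimit (a : ℝ≥0∞) (u : ℝ) : ℝ :=
  (∫ v in (0 : ℝ)..u, hitTail a v) + (1 - hitTail a u) * 2

lemma integral_rpow_neg_half : ∫ v in (0 : ℝ)..1, v ^ (-(1 / 2) : ℝ) = 2 := by
  rw [integral_rpow (Or.inl (by norm_num))]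
  norm_num

lemma DiffusiveRegime.tendsto_lifetime_mean (h : DiffusiveRegime N x a) {y : ℕ → ℕ} {u : ℝ}
    (hu : u ≤ 1) (hu0 : 0 < u) (hylim : Tendsto (fun M : ℕ => (y M : ℝ) / M) atTop (𝓝 u))
    (hy : ∀ M, 1 ≤ M → y M ≤ M) :
    Tendsto (fun M : ℕ => (∑' n : ℕ, (n : ℝ) * lifeProb (N M) M n (x M, y M)) / M) atTop
      (𝓝 (meanLimit a u)) := by
  have h1 := h.tendsto_sum_exitTail hu hu0 hylim hy 0
  have h2 := h.tendsto_sum_div_survival 0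
  simp only [zero_div, Real.exp_zero, one_pow, one_mul, zero_mul, mul_zero, mul_one] at h1 h2
  rw [integral_rpow_neg_half] at h2
  have hinv : Tendsto (fun M : ℕ => (M : ℝ)⁻¹) atTop (𝓝 0) :=
    tendsto_inv_atTop_zero.comp tendsto_natCast_atTop_atTop
  have h3 := h1.add (((h.tendsto_exitTail hu0 hylim).const_sub 1).mul
    (h2.add h.tendsto_inv_mul_survival))
  rw [add_zero] at h3
  refine h3.congr' ?_
  filter_upwards [eventually_ge_atTop 1, h.eventually_survival_pos] with M hM hS
  have hM' : (0 : ℝ) < M := by exact_mod_cast hM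
  rw [(hasSum_mul_lifeProb (h.two_le M hM) hS (x M) (y M) (h.le M hM)).tsum_eq]
  field_simp
  ring

end

/-! ### The explicit mean and the Lévy distribution -/

lemma gaussianPDFReal_div_sqrt {c v : ℝ} (hv : 0 < v) :
    gaussianPDFReal 0 1 (c / √v) = (√(2 * Real.pi))⁻¹ * Real.exp (-(c ^ 2 / (2 * v))) := by
  unfold gaussianPDFReal
  simp only [NNReal.coe_one, mul_one, sub_zero]
  congr 2
  rw [div_pow, Real.sq_sqrt hv.le]
  field_simp

lemma hasDerivAt_normalTail_div_sqrt (c : ℝ) {v : ℝ} (hv : 0 < v) :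
    HasDerivAt (fun v => normalTail (c / √v))
      ((√(2 * Real.pi))⁻¹ * Real.exp (-(c ^ 2 / (2 * v))) * (c / (2 * (v * √v)))) v := by
  have hs : 0 < √v := Real.sqrt_pos.2 hv
  have h1 : HasDerivAt (fun v => c / √v) (-(c / (2 * (v * √v)))) v := by
    have := (hasDerivAt_const v c).div (Real.hasDerivAt_sqrt hv.ne') hs.ne'
    refine this.congr_deriv ?_
    rw [Real.sq_sqrt hv.le]
    field_simp
    ring
  have h2 := (hasDerivAt_normalTail (c / √v)).comp v h1
  refine h2.congr_deriv ?_
  rw [gaussianPDFReal_div_sqrt hv]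
  ring

lemma tendsto_div_sqrt_nhdsGT_zero {c : ℝ} (hc : 0 < c) :
    Tendsto (fun v => c / √v) (𝓝[>] 0) atTop := by
  refine Tendsto.const_mul_atTop hc (tendsto_inv_nhdsGT_zero.comp ?_)
  refine tendsto_nhdsWithin_iff.2 ⟨?_, ?_⟩
  · have := Real.continuous_sqrt.tendsto 0
    rw [Real.sqrt_zero] at this
    exact this.mono_left nhdsWithin_le_nhds
  · filter_upwards [self_mem_nhdsWithin] with v hv
    exact Real.sqrt_pos.2 hv

lemma normalTail_mem_Icc (s : ℝ) : normalTail s ∈ Set.Icc (0 : ℝ) 1 :=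
  ⟨measureReal_nonneg, measureReal_le_one⟩

lemma measurable_hitTail (a : ℝ≥0∞) : Measurable (hitTail a) := by
  unfold hitTail
  split_ifs
  · exact measurable_const
  · have := continuous_normalTail.measurable
    fun_prop

lemma abs_hitTail_le_one (a : ℝ≥0∞) (v : ℝ) : |hitTail a v| ≤ 1 := by
  unfold hitTail
  split_ifs
  · simp
  · have := normalTail_mem_Icc (√(a.toReal / v))
    rw [abs_le]
    constructor <;> linarith [this.1, this.2]

lemma intervalIntegrable_hitTail (a : ℝ≥0∞) (s t : ℝ) :
    IntervalIntegrable (hitTail a) volume s t :=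
  (intervalIntegrable_const (c := (1 : ℝ))).mono_fun (measurable_hitTail a).aestronglyMeasurable
    (Eventually.of_forall fun v => by simpa using abs_hitTail_le_one a v)

lemma hitTail_zero (v : ℝ) : hitTail 0 v = 0 := by
  simp [hitTail, normalTail_zero]

lemma sqrt_two_mul_div_pi {b u : ℝ} (hb : 0 ≤ b) :
    √(2 * b * u / Real.pi) = 2 * ((√(2 * Real.pi))⁻¹ * √b * √u) := by
  have : 2 * b * u / Real.pi = 2 ^ 2 * ((2 * Real.pi)⁻¹ * b * u) := by
    field_simp
  rw [this, Real.sqrt_mul (by positivity), Real.sqrt_sq (by norm_num),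
    Real.sqrt_mul (by positivity), Real.sqrt_mul (by positivity), Real.sqrt_inv]

/-- The right-hand side is the antiderivative in `u` of `hitTail` that tends to `0` at `0`. -/
lemma integral_hitTail {b u : ℝ} (hb : 0 < b) (hu : 0 < u) :
    ∫ v in (0 : ℝ)..u, (1 - 2 * normalTail (√(b / v))) =
      u - (2 * u + 2 * b) * normalTail (√(b / u))
        + √(2 * b * u / Real.pi) * Real.exp (-(b / (2 * u))) := by
  have hc : 0 < √b := Real.sqrt_pos.2 hb
  have hsq : √b ^ 2 = b := Real.sq_sqrt hb.le
  set c := (√(2 * Real.pi))⁻¹ with hcdef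
  have hcpos : 0 < c := by positivity
  set F : ℝ → ℝ := fun v => v - (2 * v + 2 * b) * normalTail (√b / √v)
    + 2 * (c * √b * √v) * Real.exp (-(b / (2 * v))) with hF
  have hderiv : ∀ v, 0 < v → HasDerivAt F (1 - 2 * normalTail (√b / √v)) v := by
    intro v hv
    have hs : 0 < √v := Real.sqrt_pos.2 hv
    have h1 := hasDerivAt_normalTail_div_sqrt (√b) hv
    rw [hsq, ← hcdef] at h1
    have h2 : HasDerivAt (fun v => 2 * v + 2 * b) 2 v := by
      simpa using ((hasDerivAt_id v).const_mul 2).add_const (2 * b)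
    have h3 : HasDerivAt (fun v => Real.exp (-(b / (2 * v))))
        (Real.exp (-(b / (2 * v))) * (b / (2 * v ^ 2))) v := by
      have h4 : HasDerivAt (fun v => -(b / (2 * v))) (b / (2 * v ^ 2)) v := by
        have h5 : HasDerivAt (fun v : ℝ => 2 * v) 2 v := by
          simpa using (hasDerivAt_id v).const_mul 2
        have := ((hasDerivAt_const v b).div h5 (by positivity)).neg
        refine this.congr_deriv ?_
        field_simp
        ring
      exact h4.exp
    have h6 := ((Real.hasDerivAt_sqrt hv.ne').const_mul (c * √b)).const_mul 2
    have := ((hasDerivAt_id v).sub (h2.mul h1)).add (h6.mul h3)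
    refine this.congr_deriv ?_
    have hv2 : v = √v ^ 2 := (Real.sq_sqrt hv.le).symm
    generalize Real.exp (-(b / (2 * v))) = E
    generalize normalTail (√b / √v) = n
    generalize √v = s at *
    subst hv2
    field_simp
    ring
  have hlim : Tendsto F (𝓝[>] 0) (𝓝 0) := by
    have hid : Tendsto (fun v : ℝ => v) (𝓝[>] 0) (𝓝 0) := nhdsWithin_le_nhds
    have h1 := tendsto_normalTail_atTop.comp (tendsto_div_sqrt_nhdsGT_zero hc)
    have h2 := ((hid.const_mul 2).add_const (2 * b)).mul h1
    have h3 : Tendsto (fun v : ℝ => 2 * (c * √b * √v)) (𝓝[>] 0) (𝓝 0) := by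
      have : Continuous fun v : ℝ => 2 * (c * √b * √v) := by fun_prop
      have := this.tendsto 0
      simp only [Real.sqrt_zero, mul_zero] at this
      exact this.mono_left nhdsWithin_le_nhds
    have h4 : Tendsto (fun v : ℝ => 2 * (c * √b * √v) * Real.exp (-(b / (2 * v)))) (𝓝[>] 0)
        (𝓝 0) := by
      refine squeeze_zero' (Eventually.of_forall fun v => by positivity) ?_ h3
      filter_upwards [self_mem_nhdsWithin] with v hv
      have hv' : (0 : ℝ) < v := hv
      refine mul_le_of_le_one_right (by positivity) (Real.exp_le_one_iff.2 ?_)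
      rw [neg_nonpos]
      positivity
    have := (hid.sub h2).add h4
    simpa using this
  have hcont : Tendsto F (𝓝[<] u) (𝓝 (F u)) :=
    (hderiv u hu).continuousAt.tendsto.mono_left nhdsWithin_le_nhds
  have hint : IntervalIntegrable (fun v => 1 - 2 * normalTail (√b / √v)) volume 0 u := by
    have := intervalIntegrable_hitTail (ENNReal.ofReal b) 0 u
    unfold hitTail at this
    simp only [ENNReal.ofReal_ne_top, if_false, ENNReal.toReal_ofReal hb.le,
      Real.sqrt_div hb.le] at this
    exact this
  have := intervalIntegral.integral_eq_sub_of_hasDerivAt_of_tendsto hu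
    (fun v hv => hderiv v hv.1) hint hlim hcont
  simp only [Real.sqrt_div hb.le]
  rw [this, sub_zero, sqrt_two_mul_div_pi hb.le]

/-- The explicit mean `g` is the limit of the normalized mean lifetime. -/
lemma g_eq_meanLimit {a : ℝ≥0∞} {u : ℝ} (hu : 0 < u) : g a u = meanLimit a u := by
  unfold g meanLimit
  by_cases ha : a = ⊤
  · simp [ha, hitTail]
  rw [if_neg ha]
  rcases eq_or_ne a 0 with rfl | h0
  · simp only [hitTail_zero, intervalIntegral.integral_zero]
    simp [normalTail_zero]
    ring
  · have hb : 0 < a.toReal := ENNReal.toReal_pos h0 ha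
    simp only [hitTail, if_neg ha]
    rw [integral_hitTail hb hu]
    ring

/-- The distribution function `2 Φ̄(1 / √s)` of the Lévy law. -/
lemma levyHalf_Iic {s : ℝ} (hs : 0 < s) :
    levyHalf (Set.Iic s) = ENNReal.ofReal (2 * normalTail (1 / √s)) := by
  set f : ℝ → ℝ := fun t =>
    (2 * Real.pi * t ^ 3) ^ (-(1 / 2) : ℝ) * Real.exp (-(1 / (2 * t))) with hf
  -- The junk value of `1 / √t` at `t = 0` would spoil continuity there, hence the case distinction.
  set H : ℝ → ℝ := fun t => if t ≤ 0 then 0 else 2 * normalTail (1 / √t) with hH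
  have hHpos : ∀ t, 0 < t → H =ᶠ[𝓝 t] fun t => 2 * normalTail (1 / √t) := by
    intro t ht
    filter_upwards [eventually_gt_nhds ht] with v hv
    simp only [hH, if_neg (not_le.2 hv)]
  have hderiv : ∀ t, 0 < t → HasDerivAt H (f t) t := by
    intro t ht
    have h1 := ((hasDerivAt_normalTail_div_sqrt 1 ht).const_mul 2).congr_of_eventuallyEq
      (hHpos t ht)
    refine h1.congr_deriv ?_
    have hs : 0 < √t := Real.sqrt_pos.2 ht
    have e : (2 * Real.pi * t ^ 3) ^ (-(1 / 2) : ℝ) = (√(2 * Real.pi))⁻¹ * (t * √t)⁻¹ := by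
      rw [Real.rpow_neg (by positivity), ← Real.sqrt_eq_rpow, Real.sqrt_mul (by positivity),
        mul_inv, show t ^ 3 = t ^ 2 * t by ring, Real.sqrt_mul (sq_nonneg t), Real.sqrt_sq ht.le]
    simp only [hf]
    rw [e, one_pow]
    field_simp
  have hcont : ContinuousOn H (Set.Icc 0 s) := by
    intro t ht
    rcases ht.1.eq_or_lt with rfl | h
    · have h1 : ContinuousWithinAt H (Set.Ioi 0) 0 := by
        have h2 := (tendsto_normalTail_atTop.comp (tendsto_div_sqrt_nhdsGT_zero one_pos)).const_mul 2
        have h3 : H 0 = 2 * 0 := by simp [hH]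
        unfold ContinuousWithinAt
        rw [h3]
        refine h2.congr' ?_
        filter_upwards [self_mem_nhdsWithin] with v hv
        simp only [hH, if_neg (not_le.2 (Set.mem_Ioi.1 hv)), Function.comp]
      exact (continuousWithinAt_Ioi_iff_Ici.1 h1).mono Set.Icc_subset_Ici_self
    · exact (hderiv t h).continuousAt.continuousWithinAt
  have hnn : ∀ t, 0 < t → 0 ≤ f t := fun t ht => by positivity
  have hint : IntegrableOn f (Set.Ioc 0 s) :=
    intervalIntegral.integrableOn_deriv_of_nonneg hcont (fun t ht => hderiv t ht.1)
      (fun t ht => hnn t ht.1)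
  have hFTC := intervalIntegral.integral_eq_sub_of_hasDerivAt_of_le hs.le hcont
    (fun t ht => hderiv t ht.1)
    ((intervalIntegrable_iff_integrableOn_Ioc_of_le hs.le).2 hint)
  have hH0 : H 0 = 0 := by simp [hH]
  have hHs : H s = 2 * normalTail (1 / √s) := by simp only [hH, if_neg (not_le.2 hs)]
  rw [hH0, sub_zero, hHs, intervalIntegral.integral_of_le hs.le] at hFTC
  unfold levyHalf
  rw [withDensity_apply _ measurableSet_Iic, Measure.restrict_restrict measurableSet_Iic,
    Set.inter_comm, Set.Ioi_inter_Iic, ← hFTC, ofReal_integral_eq_lintegral_ofReal hint]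
  exact (ae_restrict_iff' measurableSet_Ioc).2 (Eventually.of_forall fun t ht => hnn t ht.1)

lemma levyHalf_Iic_zero : levyHalf (Set.Iic 0) = 0 := by
  unfold levyHalf
  rw [withDensity_apply _ measurableSet_Iic, Measure.restrict_restrict measurableSet_Iic,
    Set.inter_comm, Set.Ioi_inter_Iic, Set.Ioc_self, Measure.restrict_empty, lintegral_zero_measure]

lemma levyHalf_singleton (s : ℝ) : levyHalf {s} = 0 :=
  (withDensity_absolutelyContinuous _ _).trans
    Measure.restrict_le_self.absolutelyContinuous (measure_singleton s)

/-! ### Weak convergence on the half-line via Laplace transforms -/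

open scoped NNReal BoundedContinuousFunction

/-- The function `x ↦ e^{-x}` on `[0, ∞)`. -/
noncomputable def expNegBCF : ℝ≥0 →ᵇ ℝ :=
  BoundedContinuousFunction.ofNormedAddCommGroup (fun x : ℝ≥0 => Real.exp (-x)) (by fun_prop) 1
    (fun x => by
      rw [Real.norm_eq_abs, abs_of_pos (Real.exp_pos _), Real.exp_le_one_iff]
      simp)

/-- The algebra of polynomials in `e^{-x}`. -/
noncomputable def expPolyAlgebra : StarSubalgebra ℝ (ℝ≥0 →ᵇ ℝ) where
  carrier := {f | ∃ p : Polynomial ℝ, ∀ x : ℝ≥0, f x = p.eval (Real.exp (-x))}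
  mul_mem' := by
    rintro f g ⟨p, hp⟩ ⟨q, hq⟩
    exact ⟨p * q, fun x => by simp [hp, hq]⟩
  add_mem' := by
    rintro f g ⟨p, hp⟩ ⟨q, hq⟩
    exact ⟨p + q, fun x => by simp [hp, hq]⟩
  algebraMap_mem' c := ⟨Polynomial.C c, fun x => by simp⟩
  star_mem' := by
    rintro f ⟨p, hp⟩
    exact ⟨p, fun x => by simp [hp]⟩

lemma integrable_exp_neg_mul (μ : Measure ℝ≥0) [IsFiniteMeasure μ] {s : ℝ} (hs : 0 ≤ s) :
    Integrable (fun x : ℝ≥0 => Real.exp (-(s * x))) μ := by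
  refine Integrable.mono' (integrable_const 1)
    (by fun_prop : Measurable fun x : ℝ≥0 => Real.exp (-(s * x))).aestronglyMeasurable
    (Eventually.of_forall fun x => ?_)
  rw [Real.norm_eq_abs, abs_of_pos (Real.exp_pos _), Real.exp_le_one_iff, neg_nonpos]
  positivity

/-- Laplace transforms converging to a function that is continuous at `0` force tightness. -/
lemma isTightMeasureSet_of_tendsto_laplace {μ : ℕ → ProbabilityMeasure ℝ≥0} {L : ℝ → ℝ}
    (hL : Tendsto L (𝓝[>] 0) (𝓝 1))
    (h : ∀ s : ℝ, 0 < s →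
      Tendsto (fun n => ∫ x, Real.exp (-(s * x)) ∂(μ n : Measure ℝ≥0)) atTop (𝓝 (L s))) :
    IsTightMeasureSet {(μ n : Measure ℝ≥0) | n} := by
  rw [isTightMeasureSet_iff_exists_isCompact_measure_compl_le]
  intro ε hε
  wlog hε1 : ε ≠ ⊤
  · obtain ⟨K, hK, hK'⟩ := this hL h 1 one_pos ENNReal.one_ne_top
    refine ⟨K, hK, fun ν hν => ?_⟩
    rw [not_ne_iff.1 hε1]; exact le_top
  have hε0 : 0 < ε.toReal := ENNReal.toReal_pos hε.ne' hε1
  obtain ⟨s, hs, hsL⟩ : ∃ s, 0 < s ∧ 1 - ε.toReal / 2 < L s := by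
    obtain ⟨s, h1, h2⟩ := ((hL.eventually_const_lt (u := 1 - ε.toReal / 2)
      (by linarith)).and self_mem_nhdsWithin).exists
    exact ⟨s, h2, h1⟩
  obtain ⟨n0, hn0⟩ := eventually_atTop.1 ((h s hs).eventually_const_lt hsL)
  have hsingle : ∀ n, ∃ K : Set ℝ≥0, IsCompact K ∧ (μ n : Measure ℝ≥0) Kᶜ ≤ ε := by
    intro n
    obtain ⟨K, hK, hK'⟩ := isTightMeasureSet_iff_exists_isCompact_measure_compl_le.1
      (isTightMeasureSet_singleton (μ := (μ n : Measure ℝ≥0))) ε hε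
    exact ⟨K, hK, hK' _ rfl⟩
  choose K hK hK' using hsingle
  refine ⟨Set.Icc 0 (Real.toNNReal (1 / s)) ∪ ⋃ n ∈ Finset.range n0, K n,
    isCompact_Icc.union ((Finset.range n0).isCompact_biUnion fun n _ => hK n), ?_⟩
  rintro ν ⟨n, rfl⟩
  rcases lt_or_ge n n0 with hn | hn
  · refine (measure_mono ?_).trans (hK' n)
    refine Set.compl_subset_compl.2 fun x hx => Or.inr ?_
    simp only [Set.mem_iUnion]
    exact ⟨n, Finset.mem_range.2 hn, hx⟩
  · set A : Set ℝ≥0 := Set.Ioi (Real.toNNReal (1 / s)) with hA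
    have hsub : (Set.Icc 0 (Real.toNNReal (1 / s)) ∪ ⋃ n ∈ Finset.range n0, K n)ᶜ ⊆ A := by
      intro x hx
      by_contra hxA
      exact hx (Or.inl ⟨zero_le, not_lt.1 hxA⟩)
    refine (measure_mono hsub).trans ?_
    -- Markov's inequality for `1 - e^{-s x}`, which is at least `1 - e⁻¹ > 1/2` on `A`.
    have hpt : ∀ x : ℝ≥0, A.indicator (fun _ => (1 / 2 : ℝ)) x ≤ 1 - Real.exp (-(s * x)) := by
      intro x
      by_cases hx : x ∈ A
      · rw [Set.indicator_of_mem hx]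
        have h1 : 1 < s * x := by
          have : 1 / s < (x : ℝ) := (Real.toNNReal_lt_iff_lt_coe (by positivity)).1 hx
          rwa [div_lt_iff₀ hs, mul_comm] at this
        have h2 : Real.exp (-(s * x)) ≤ Real.exp (-1) := Real.exp_le_exp.2 (by linarith)
        have h3 := Real.exp_neg_one_lt_half
        linarith
      · rw [Set.indicator_of_notMem hx]
        have : Real.exp (-(s * x)) ≤ 1 := Real.exp_le_one_iff.2 (by
          rw [neg_nonpos]; positivity)
        linarith
    have hint := integrable_exp_neg_mul (μ n : Measure ℝ≥0) hs.le
    have hle := integral_mono (μ := (μ n : Measure ℝ≥0))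
      ((integrable_const (1 / 2 : ℝ)).indicator measurableSet_Ioi)
      ((integrable_const (1 : ℝ)).sub hint) hpt
    simp only [Pi.sub_apply] at hle
    rw [integral_indicator_const _ measurableSet_Ioi, integral_sub (integrable_const _) hint] at hle
    simp only [integral_const, probReal_univ, smul_eq_mul, mul_one] at hle
    have := hn0 n hn
    rw [← ENNReal.ofReal_toReal hε1]
    refine ENNReal.le_ofReal_iff_toReal_le (measure_ne_top _ _) hε0.le |>.2 ?_
    change (μ n : Measure ℝ≥0).real A ≤ _
    linarith

/-- Continuity theorem for Laplace transforms of probability measures on `[0, ∞)`. The laws are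
tight, and the polynomials in `e^{-x}`, whose integrals are combinations of values of the Laplace
transform at integers, separate points. -/
lemma tendsto_of_tendsto_laplace {μ : ℕ → ProbabilityMeasure ℝ≥0} {μ₀ : ProbabilityMeasure ℝ≥0}
    (h : ∀ s : ℝ, 0 < s → Tendsto (fun n => ∫ x, Real.exp (-(s * x)) ∂(μ n : Measure ℝ≥0)) atTop
      (𝓝 (∫ x, Real.exp (-(s * x)) ∂(μ₀ : Measure ℝ≥0)))) :
    Tendsto μ atTop (𝓝 μ₀) := by
  have hL : Tendsto (fun s : ℝ => ∫ x, Real.exp (-(s * x)) ∂(μ₀ : Measure ℝ≥0)) (𝓝[>] 0)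
      (𝓝 1) := by
    have h1 : (1 : ℝ) = ∫ x : ℝ≥0, (1 : ℝ) ∂(μ₀ : Measure ℝ≥0) := by simp
    rw [h1]
    refine tendsto_integral_filter_of_dominated_convergence (fun _ => 1) ?_ ?_
      (integrable_const _) ?_
    · exact Eventually.of_forall fun s =>
        (by fun_prop : Measurable fun x : ℝ≥0 => Real.exp (-(s * x))).aestronglyMeasurable
    · filter_upwards [self_mem_nhdsWithin] with s hs
      refine Eventually.of_forall fun x => ?_
      have hs' : 0 < s := hs
      rw [Real.norm_eq_abs, abs_of_pos (Real.exp_pos _), Real.exp_le_one_iff, neg_nonpos]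
      positivity
    · refine Eventually.of_forall fun x => ?_
      have : Continuous fun s : ℝ => Real.exp (-(s * x)) := by fun_prop
      have := this.tendsto 0
      simp only [zero_mul, neg_zero, Real.exp_zero] at this
      exact this.mono_left nhdsWithin_le_nhds
  refine ProbabilityMeasure.tendsto_of_tight_of_separatesPoints ℝ (A := expPolyAlgebra)
    (isTightMeasureSet_of_tendsto_laplace hL h) ?_ ?_
  · intro x y hxy
    refine ⟨fun z => Real.exp (-z), ?_, ?_⟩
    · refine ⟨(BoundedContinuousFunction.toContinuousMapStarₐ ℝ) expNegBCF, ?_, rfl⟩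
      exact ⟨expNegBCF, ⟨Polynomial.X, fun z => by simp [expNegBCF]⟩, rfl⟩
    · simpa using hxy
  · rintro g ⟨p, hp⟩
    have e : ∀ ν : ProbabilityMeasure ℝ≥0, ∫ x, g x ∂(ν : Measure ℝ≥0) =
        ∑ i ∈ Finset.range (p.natDegree + 1),
          p.coeff i * ∫ x, Real.exp (-((i : ℝ) * x)) ∂(ν : Measure ℝ≥0) := by
      intro ν
      have e1 : ∀ (i : ℕ) (x : ℝ≥0), Real.exp (-(x : ℝ)) ^ i = Real.exp (-((i : ℝ) * x)) := by
        intro i x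
        rw [← Real.exp_nat_mul]; ring_nf
      simp only [hp, Polynomial.eval_eq_sum_range, e1]
      rw [integral_finsetSum]
      · simp only [integral_const_mul]
      · exact fun i _ => (integrable_exp_neg_mul _ (Nat.cast_nonneg i)).const_mul _
    simp only [e]
    refine tendsto_finsetSum _ fun i _ => Tendsto.const_mul _ ?_
    rcases Nat.eq_zero_or_pos i with rfl | hi
    · simp
    · exact h i (by exact_mod_cast hi)

/-- Subsequential limits under a tightness condition, along an ultrafilter. -/
lemma exists_ultrafilter_limit {μ : ℕ → ProbabilityMeasure ℝ≥0}
    (h : IsTightMeasureSet {(μ n : Measure ℝ≥0) | n}) :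
    ∃ (U : Ultrafilter ℕ) (μ₀ : ProbabilityMeasure ℝ≥0), (U : Filter ℕ) ≤ atTop ∧
      Tendsto μ U (𝓝 μ₀) := by
  have h_compact : IsCompact (closure {μ n | n}) :=
    isCompact_closure_of_isTightMeasureSet (by simpa using h)
  obtain ⟨μ', -, hμ'⟩ := h_compact.ultrafilter_le_nhds ((hyperfilter ℕ).map μ)
    (.trans (by simp) (monotone_principal subset_closure))
  exact ⟨hyperfilter ℕ, μ', Nat.hyperfilter_le_atTop, hμ'⟩

/-- Convergence of exponential moments passes to the weak limit when it holds at a larger exponent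
as well. -/
lemma integral_exp_of_tendsto {U : Filter ℕ} [U.NeBot] {μ : ℕ → ProbabilityMeasure ℝ≥0}
    {μ₀ : ProbabilityMeasure ℝ≥0} (h : Tendsto μ U (𝓝 μ₀)) {t t' l l' : ℝ} (ht' : t < t')
    (hint : ∀ᶠ n in U, Integrable (fun x : ℝ≥0 => Real.exp (t * x)) (μ n : Measure ℝ≥0))
    (hint' : ∀ᶠ n in U, Integrable (fun x : ℝ≥0 => Real.exp (t' * x)) (μ n : Measure ℝ≥0))
    (hl : Tendsto (fun n => ∫ x, Real.exp (t * x) ∂(μ n : Measure ℝ≥0)) U (𝓝 l))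
    (hl' : Tendsto (fun n => ∫ x, Real.exp (t' * x) ∂(μ n : Measure ℝ≥0)) U (𝓝 l'))
    (ht : 0 ≤ t) :
    ∫ x, Real.exp (t * x) ∂(μ₀ : Measure ℝ≥0) = l := by
  -- Truncate `x` at level `R`; the larger exponent controls the error by `e^{-(t' - t) R}`.
  have hbd : ∀ (R : ℕ) (x : ℝ≥0), ‖Real.exp (t * min (x : ℝ) R)‖ ≤ Real.exp (t * R) := by
    intro R x
    rw [Real.norm_eq_abs, abs_of_pos (Real.exp_pos _)]
    exact Real.exp_le_exp.2 (mul_le_mul_of_nonneg_left (min_le_right _ _) ht)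
  let f : ℕ → (ℝ≥0 →ᵇ ℝ) := fun R => BoundedContinuousFunction.ofNormedAddCommGroup
    (fun x : ℝ≥0 => Real.exp (t * min (x : ℝ) R)) (by fun_prop) _ (hbd R)
  have hf : ∀ R x, f R x = Real.exp (t * min (x : ℝ) R) := fun R x => rfl
  have hfle : ∀ R x, f R x ≤ Real.exp (t * x) := fun R x => by
    rw [hf]
    exact Real.exp_le_exp.2 (mul_le_mul_of_nonneg_left (min_le_left _ _) ht)
  have hweak := (ProbabilityMeasure.tendsto_iff_forall_integral_tendsto.1 h)
  have hup : ∀ R, ∫ x, f R x ∂(μ₀ : Measure ℝ≥0) ≤ l := by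
    intro R
    refine le_of_tendsto_of_tendsto (hweak (f R)) hl ?_
    filter_upwards [hint] with n hn
    exact integral_mono (BoundedContinuousFunction.integrable _ _) hn (hfle R)
  have hlow : ∀ R : ℕ, l - Real.exp (-((t' - t) * R)) * l' ≤ ∫ x, f R x ∂(μ₀ : Measure ℝ≥0) := by
    intro R
    refine le_of_tendsto_of_tendsto (hl.sub (hl'.const_mul _)) (hweak (f R)) ?_
    filter_upwards [hint, hint'] with n hn hn'
    rw [← integral_const_mul, ← integral_sub hn (hn'.const_mul _)]
    refine integral_mono (hn.sub (hn'.const_mul _)) (BoundedContinuousFunction.integrable _ _) ?_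
    intro x
    simp only [hf]
    rcases le_total (x : ℝ) R with hx | hx
    · rw [min_eq_left hx]
      have : 0 ≤ Real.exp (-((t' - t) * R)) * Real.exp (t' * x) := by positivity
      linarith
    · rw [← Real.exp_add]
      have : Real.exp (t * x) ≤ Real.exp (-((t' - t) * R) + t' * x) := by
        refine Real.exp_le_exp.2 ?_
        nlinarith
      have := Real.exp_pos (t * min (x : ℝ) R)
      linarith
  have hlim : Tendsto (fun R => ∫ x, f R x ∂(μ₀ : Measure ℝ≥0)) atTop (𝓝 l) := by
    refine tendsto_of_tendsto_of_tendsto_of_le_of_le ?_ tendsto_const_nhds hlow hup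
    have h1 : Tendsto (fun R : ℕ => Real.exp (-((t' - t) * R))) atTop (𝓝 0) :=
      Real.tendsto_exp_neg_atTop_nhds_zero.comp
        (tendsto_natCast_atTop_atTop.const_mul_atTop (sub_pos.2 ht'))
    simpa using (h1.mul_const l').const_sub l
  have hmono : Tendsto (fun R => ∫⁻ x, ENNReal.ofReal (f R x) ∂(μ₀ : Measure ℝ≥0)) atTop
      (𝓝 (∫⁻ x, ENNReal.ofReal (Real.exp (t * x)) ∂(μ₀ : Measure ℝ≥0))) := by
    refine lintegral_tendsto_of_tendsto_of_monotone
      (fun R => (f R).continuous.measurable.ennreal_ofReal.aemeasurable) ?_ ?_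
    · refine Eventually.of_forall fun x R R' hR => ENNReal.ofReal_le_ofReal ?_
      simp only [hf]
      gcongr
    · refine Eventually.of_forall fun x => Tendsto.congr' ?_ tendsto_const_nhds
      filter_upwards [eventually_ge_atTop ⌈(x : ℝ)⌉₊] with R hR
      rw [hf, min_eq_left ((Nat.le_ceil _).trans (by exact_mod_cast hR))]
  have heq : ∫⁻ x, ENNReal.ofReal (Real.exp (t * x)) ∂(μ₀ : Measure ℝ≥0) = ENNReal.ofReal l := by
    refine tendsto_nhds_unique hmono ((ENNReal.tendsto_ofReal hlim).congr fun R => ?_)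
    rw [ofReal_integral_eq_lintegral_ofReal (BoundedContinuousFunction.integrable _ _)
      (Eventually.of_forall fun x => (Real.exp_pos _).le)]
  rw [integral_eq_lintegral_of_nonneg_ae (Eventually.of_forall fun x => (Real.exp_pos _).le)
    (by fun_prop : Measurable fun x : ℝ≥0 => Real.exp (t * x)).aestronglyMeasurable, heq]
  refine ENNReal.toReal_ofReal (ge_of_tendsto' hl fun n => integral_nonneg fun x =>
    (Real.exp_pos _).le)

/-! ### The Darling–Mandelbrot distribution -/

lemma calI_nonpos {t : ℝ} (ht : t ≤ 0) : calI t ≤ 0 := by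
  refine mul_nonpos_of_nonpos_of_nonneg ht (intervalIntegral.integral_nonneg zero_le_one ?_)
  intro v hv
  have := Real.rpow_nonneg hv.1 (-(1 / 2))
  positivity

lemma exp_sub_calI_pos_of_nonpos {t : ℝ} (ht : t ≤ 0) : 0 < Real.exp t - calI t := by
  linarith [Real.exp_pos t, calI_nonpos ht]

lemma nonneg_of_exp_sub_calI_nonpos {t : ℝ} (ht : Real.exp t - calI t ≤ 0) : 0 ≤ t := by
  by_contra h
  linarith [exp_sub_calI_pos_of_nonpos (not_le.1 h).le]

lemma tZero_nonneg : 0 ≤ tZero := Real.sInf_nonneg fun _ ht => nonneg_of_exp_sub_calI_nonpos ht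

lemma exp_sub_calI_pos_of_lt {t : ℝ} (ht : t < tZero) : 0 < Real.exp t - calI t := by
  by_contra h
  have hbdd : BddBelow {t : ℝ | Real.exp t - calI t ≤ 0} :=
    ⟨0, fun _ ht => nonneg_of_exp_sub_calI_nonpos ht⟩
  exact absurd (csInf_le hbdd (not_lt.1 h)) (not_le.2 ht)

/-- `𝓘(t) / t` tends to `∫₀¹ v^{-1/2} dv = 2` at `0`. -/
lemma tendsto_integral_rpow_mul_exp :
    Tendsto (fun t : ℝ => ∫ v in (0 : ℝ)..1, v ^ (-(1 / 2) : ℝ) * Real.exp (v * t)) (𝓝 0)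
      (𝓝 2) := by
  have h2 : (∫ v in (0 : ℝ)..1, v ^ (-(1 / 2) : ℝ) * Real.exp (v * 0)) = 2 := by
    simp only [mul_zero, Real.exp_zero, mul_one]
    rw [integral_rpow_neg_half]
  suffices key : Tendsto (fun t : ℝ => ∫ v in (0 : ℝ)..1, v ^ (-(1 / 2) : ℝ) * Real.exp (v * t))
      (𝓝 0) (𝓝 (∫ v in (0 : ℝ)..1, v ^ (-(1 / 2) : ℝ) * Real.exp (v * 0))) by
    rwa [h2] at key
  simp only [intervalIntegral.integral_of_le zero_le_one]
  refine tendsto_integral_filter_of_dominated_convergence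
    (fun v => v ^ (-(1 / 2) : ℝ) * Real.exp 1) ?_ ?_ (integrableOn_rpow_neg_half.mul_const _) ?_
  · exact Eventually.of_forall fun t => Measurable.aestronglyMeasurable (by fun_prop)
  · filter_upwards [eventually_le_nhds (show (0 : ℝ) < 1 by norm_num)] with t ht
    filter_upwards [ae_restrict_mem measurableSet_Ioc] with v hv
    have h1 := Real.rpow_nonneg hv.1.le (-(1 / 2))
    rw [Real.norm_eq_abs, abs_of_nonneg (by positivity)]
    refine mul_le_mul_of_nonneg_left (Real.exp_le_exp.2 ?_) h1
    nlinarith [hv.1, hv.2]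
  · refine Eventually.of_forall fun v => ?_
    have : Continuous fun t : ℝ => v ^ (-(1 / 2) : ℝ) * Real.exp (v * t) := by fun_prop
    exact this.tendsto 0

lemma tendsto_exp_sub_calI : Tendsto (fun t => Real.exp t - calI t) (𝓝 0) (𝓝 1) := by
  have h1 := Real.continuous_exp.tendsto 0
  have h2 := (tendsto_id (x := 𝓝 (0 : ℝ))).mul tendsto_integral_rpow_mul_exp
  have := h1.sub h2
  rw [Real.exp_zero, zero_mul, sub_zero] at this
  exact this

/-- The Darling–Mandelbrot law has mean `1`. -/
lemma IsDarlingMandelbrot.integral_id {μ : Measure ℝ} (hμ : IsDarlingMandelbrot μ) :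
    Integrable (fun x => x) μ ∧ ∫ x, x ∂μ = 1 := by
  have := hμ.isProbabilityMeasure
  -- The integrals of `G n` are the difference quotients at `0` of the moment generating function.
  set G : ℕ → ℝ → ℝ := fun n x => ((n : ℝ) + 1) * (1 - Real.exp (-(1 / ((n : ℝ) + 1)) * x)) with hG
  have htn : Tendsto (fun n : ℕ => -(1 / ((n : ℝ) + 1))) atTop (𝓝 0) := by
    simpa using (tendsto_one_div_add_atTop_nhds_zero_nat (𝕜 := ℝ)).neg
  have htneg : ∀ n : ℕ, -(1 / ((n : ℝ) + 1)) < 0 := fun n => by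
    rw [neg_lt_zero]; positivity
  have htne : Tendsto (fun n : ℕ => -(1 / ((n : ℝ) + 1))) atTop (𝓝[≠] 0) :=
    tendsto_nhdsWithin_iff.2 ⟨htn, Eventually.of_forall fun n => (htneg n).ne⟩
  have hslope : ∀ c : ℝ, Tendsto (fun n : ℕ => ((n : ℝ) + 1) *
      (1 - Real.exp (-(1 / ((n : ℝ) + 1)) * c))) atTop (𝓝 c) := by
    intro c
    have hd : HasDerivAt (fun y : ℝ => Real.exp (y * c)) c 0 := by
      simpa using ((hasDerivAt_id (0 : ℝ)).mul_const c).exp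
    refine (hd.tendsto_slope_zero.comp htne).congr fun n => ?_
    simp only [Function.comp, zero_add, zero_mul, Real.exp_zero, smul_eq_mul]
    field_simp
    ring
  have hGm : ∀ n, Measurable (G n) := fun n => by fun_prop
  have hbd : ∀ n x, 0 ≤ x → 0 ≤ G n x ∧ G n x ≤ x := by
    intro n x hx
    have hn : (0 : ℝ) < (n : ℝ) + 1 := by positivity
    have h1 : Real.exp (-(1 / ((n : ℝ) + 1)) * x) ≤ 1 := Real.exp_le_one_iff.2
      (mul_nonpos_of_nonpos_of_nonneg (htneg n).le hx)
    have h2 := Real.add_one_le_exp (-(1 / ((n : ℝ) + 1)) * x)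
    refine ⟨mul_nonneg hn.le (by linarith), ?_⟩
    have h3 : ((n : ℝ) + 1) * (1 - Real.exp (-(1 / ((n : ℝ) + 1)) * x)) ≤
        ((n : ℝ) + 1) * (1 / ((n : ℝ) + 1) * x) :=
      mul_le_mul_of_nonneg_left (by linarith) hn.le
    calc _ ≤ _ := h3
      _ = x := by field_simp
  have hexp : ∀ n : ℕ, Integrable (fun x => Real.exp (-(1 / ((n : ℝ) + 1)) * x)) μ := by
    intro n
    refine Integrable.mono' (integrable_const 1)
      (by fun_prop : Measurable fun x => Real.exp (-(1 / ((n : ℝ) + 1)) * x)).aestronglyMeasurable ?_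
    filter_upwards [hμ.nonneg] with x hx
    rw [Real.norm_eq_abs, abs_of_pos (Real.exp_pos _), Real.exp_le_one_iff]
    exact mul_nonpos_of_nonpos_of_nonneg (htneg n).le hx
  have hGint : ∀ n, Integrable (G n) μ := fun n =>
    ((integrable_const 1).sub (hexp n)).const_mul _
  have hGval : Tendsto (fun n => ∫ x, G n x ∂μ) atTop (𝓝 1) := by
    have h1 : Tendsto (fun n : ℕ => (((n : ℝ) + 1) * (Real.exp (-(1 / ((n : ℝ) + 1)) * 1) - 1)
        + ∫ v in (0 : ℝ)..1, v ^ (-(1 / 2) : ℝ) * Real.exp (v * -(1 / ((n : ℝ) + 1))))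
        / (Real.exp (-(1 / ((n : ℝ) + 1))) - calI (-(1 / ((n : ℝ) + 1))))) atTop
        (𝓝 ((-1 + 2) / 1)) := by
      refine Tendsto.div (Tendsto.add ?_ (tendsto_integral_rpow_mul_exp.comp htn))
        (tendsto_exp_sub_calI.comp htn) one_ne_zero
      exact (hslope 1).neg.congr fun n => by ring
    rw [show ((-1 : ℝ) + 2) / 1 = 1 by norm_num] at h1
    refine h1.congr fun n => ?_
    simp only [hG]
    rw [integral_const_mul, integral_sub (integrable_const _) (hexp n),
      hμ.mgf_eq _ ((htneg n).trans_le tZero_nonneg)]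
    simp only [integral_const, probReal_univ, smul_eq_mul, mul_one]
    have hpos := (exp_sub_calI_pos_of_nonpos (htneg n).le).ne'
    have ht : ((n : ℝ) + 1) * -(1 / ((n : ℝ) + 1)) = -1 := by field_simp
    have hI : calI (-(1 / ((n : ℝ) + 1))) = -(1 / ((n : ℝ) + 1)) *
      ∫ v in (0 : ℝ)..1, v ^ (-(1 / 2) : ℝ) * Real.exp (v * -(1 / ((n : ℝ) + 1))) := rfl
    rw [div_eq_iff hpos, mul_assoc, sub_mul, one_mul, one_div_mul_cancel hpos, hI]
    generalize (∫ v in (0 : ℝ)..1, v ^ (-(1 / 2) : ℝ) * Real.exp (v * -(1 / ((n : ℝ) + 1)))) = J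
    linear_combination J * ht
  have hGlim : ∀ᵐ x ∂μ, Tendsto (fun n => G n x) atTop (𝓝 x) :=
    Eventually.of_forall fun x => hslope x
  have hint : Integrable (fun x => x) μ := by
    refine integrable_of_tendsto hGlim (fun n => (hGm n).aestronglyMeasurable) ?_
    have h1 : Tendsto (fun n => ∫⁻ x, ‖G n x‖ₑ ∂μ) atTop (𝓝 (ENNReal.ofReal 1)) := by
      refine (ENNReal.tendsto_ofReal hGval).congr fun n => ?_
      have hnn : 0 ≤ᵐ[μ] G n := by
        filter_upwards [hμ.nonneg] with x hx using (hbd n x hx).1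
      rw [ofReal_integral_eq_lintegral_ofReal (hGint n) hnn]
      refine lintegral_congr_ae ?_
      filter_upwards [hnn] with x hx
      exact (Real.enorm_of_nonneg hx).symm
    rw [h1.liminf_eq]
    exact ENNReal.ofReal_ne_top
  refine ⟨hint, tendsto_nhds_unique ?_ hGval⟩
  refine tendsto_integral_of_dominated_convergence (fun x => |x|)
    (fun n => (hGm n).aestronglyMeasurable) hint.abs (fun n => ?_) hGlim
  filter_upwards [hμ.nonneg] with x hx
  rw [Real.norm_eq_abs, abs_of_nonneg (hbd n x hx).1, abs_of_nonneg hx]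
  exact (hbd n x hx).2

section LifetimeLaw

variable {N : ℕ∞} {M : ℕ} {z : ℕ × ℕ}

lemma ae_lifetime_ne_top (h : HasSum (fun n => lifeProb N M n z) 1) :
    ∀ᵐ ζ ∂(chainLaw N M z), lifetime N ζ ≠ ⊤ := by
  have hm : ∀ n : ℕ, MeasurableSet {ζ | lifetime N ζ = n} := fun n =>
    measurable_lifetime N (measurableSet_singleton _)
  have hU : chainLaw N M z (⋃ n : ℕ, {ζ | lifetime N ζ = n}) = 1 := by
    rw [measure_iUnion _ hm]
    · simp only [chainLaw_lifetime_eq]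
      rw [← ENNReal.ofReal_tsum_of_nonneg (fun n => lifeProb_nonneg _ _ _ _) h.summable, h.tsum_eq,
        ENNReal.ofReal_one]
    · intro i j hij
      refine Set.disjoint_left.2 fun ζ hi hj => hij ?_
      have : (i : ℕ∞) = j := hi.symm.trans hj
      exact_mod_cast this
  have := (prob_compl_eq_zero_iff (MeasurableSet.iUnion hm)).2 hU
  rw [ae_iff]
  refine measure_mono_null ?_ this
  intro ζ hζ
  simp only [ne_eq, not_not, Set.mem_ofPred_eq] at hζ
  simp [hζ]

lemma measurable_lifetime_toNat (N : ℕ∞) : Measurable fun ζ => (lifetime N ζ).toNat :=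
  (measurable_of_countable ENat.toNat).comp (measurable_lifetime N)

/-- Expectations of functions of the lifetime; `ENat.toNat ⊤ = 0` does not matter, since the lifetime
is almost surely finite. -/
lemma lintegral_lifetime (h : HasSum (fun n => lifeProb N M n z) 1) {F : ℕ → ℝ}
    (hF : ∀ n, 0 ≤ F n) (hs : Summable fun n => F n * lifeProb N M n z) :
    ∫⁻ ζ, ENNReal.ofReal (F (lifetime N ζ).toNat) ∂(chainLaw N M z) =
      ENNReal.ofReal (∑' n, F n * lifeProb N M n z) := by
  have hm := measurable_lifetime_toNat N
  rw [← lintegral_map (f := fun n : ℕ => ENNReal.ofReal (F n)) (measurable_of_countable _) hm,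
    lintegral_countable', ENNReal.ofReal_tsum_of_nonneg
      (fun n => mul_nonneg (hF n) (lifeProb_nonneg _ _ _ _)) hs]
  refine tsum_congr fun n => ?_
  rw [Measure.map_apply hm (measurableSet_singleton n), ENNReal.ofReal_mul (hF n),
    ← chainLaw_lifetime_eq]
  congr 1
  refine measure_congr ?_
  filter_upwards [ae_lifetime_ne_top h] with ζ hζ
  refine propext ?_
  change (lifetime N ζ).toNat = n ↔ lifetime N ζ = n
  constructor
  · intro h
    rw [← h, ENat.natCast_toNat hζ]
  · intro h
    rw [h, ENat.toNat_natCast]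

lemma integral_lifetime (h : HasSum (fun n => lifeProb N M n z) 1) {F : ℕ → ℝ}
    (hF : ∀ n, 0 ≤ F n) (hs : Summable fun n => F n * lifeProb N M n z) :
    Integrable (fun ζ => F (lifetime N ζ).toNat) (chainLaw N M z) ∧
      ∫ ζ, F (lifetime N ζ).toNat ∂(chainLaw N M z) = ∑' n, F n * lifeProb N M n z := by
  have hm : AEStronglyMeasurable (fun ζ => F (lifetime N ζ).toNat) (chainLaw N M z) :=
    ((measurable_of_countable F).comp (measurable_lifetime_toNat N)).aestronglyMeasurable
  have hl := lintegral_lifetime h hF hs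
  refine ⟨⟨hm, ?_⟩, ?_⟩
  · rw [hasFiniteIntegral_iff_ofReal (Eventually.of_forall fun ζ => hF _), hl]
    exact ENNReal.ofReal_lt_top
  · rw [integral_eq_lintegral_of_nonneg_ae (Eventually.of_forall fun ζ => hF _) hm, hl,
      ENNReal.toReal_ofReal]
    exact tsum_nonneg fun n => mul_nonneg (hF n) (lifeProb_nonneg _ _ _ _)

lemma lintegral_lifetime_eq (h : HasSum (fun n => lifeProb N M n z) 1)
    (hs : Summable fun n : ℕ => (n : ℝ) * lifeProb N M n z) :
    ∫⁻ ζ, (lifetime N ζ : ℝ≥0∞) ∂(chainLaw N M z) =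
      ENNReal.ofReal (∑' n : ℕ, (n : ℝ) * lifeProb N M n z) := by
  rw [← lintegral_lifetime h (fun n => Nat.cast_nonneg n) hs]
  refine lintegral_congr_ae ?_
  filter_upwards [ae_lifetime_ne_top h] with ζ hζ
  rw [ENNReal.ofReal_natCast]
  conv_lhs => rw [← ENat.natCast_toNat hζ]
  rfl

end LifetimeLaw

section

variable {N : ℕ → ℕ∞} {x : ℕ → ℕ} {a : ℝ≥0∞}

lemma DiffusiveRegime.eventually_hasSum (h : DiffusiveRegime N x a) (y : ℕ → ℕ) :
    ∀ᶠ M : ℕ in atTop, HasSum (fun n => lifeProb (N M) M n (x M, y M)) 1 := by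
  filter_upwards [eventually_ge_atTop 1, h.eventually_survival_pos] with M hM hS
  exact hasSum_lifeProb (h.two_le M hM) hS _ _ (h.le M hM)

lemma DiffusiveRegime.eventually_summable_exp (h : DiffusiveRegime N x a) (y : ℕ → ℕ) {t : ℝ}
    (ht : 0 < Real.exp t - calI t) :
    ∀ᶠ M : ℕ in atTop, Summable fun n : ℕ =>
      Real.exp (t * (n / M)) * lifeProb (N M) M n (x M, y M) := by
  filter_upwards [eventually_ge_atTop 1, h.eventually_mul_exitGF_lt_one ht] with M hM hA
  have := summable_pow_mul_lifeProb (h.two_le M hM) (Real.exp_pos (t / M)).le hA (x M) (y M)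
    (h.le M hM)
  simpa only [exp_div_pow] using this

end

/-- The Darling–Mandelbrot law exists: it is the limit law of the normalized lifetime in excess of
`1` on the half-line, started next to the boundary with full energy. -/
lemma exists_isDarlingMandelbrot : ∃ μ : Measure ℝ, IsDarlingMandelbrot μ := by
  have hreg : DiffusiveRegime (fun _ => ⊤) (fun _ => 1) 0 := by
    refine ⟨fun _ _ => le_top, fun _ _ => le_top, ?_, ?_⟩
    · simp only [Nat.cast_one, one_pow, ENat.toENNReal_top, ENNReal.top_sub ENNReal.one_ne_top]
      simpa using ENNReal.tendsto_inv_nat_nhds_zero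
    · simp
  set P : ℕ → Measure (ℕ → ℕ × ℕ) := fun M => chainLaw ⊤ M (1, M) with hP
  set X : ℕ → (ℕ → ℕ × ℕ) → ℝ≥0 := fun M ζ => ((lifetime ⊤ ζ).toNat : ℝ≥0) / M - 1 with hX
  have hXm : ∀ M, Measurable (X M) := fun M =>
    (measurable_of_countable fun n : ℕ => (n : ℝ≥0) / M - 1).comp (measurable_lifetime_toNat ⊤)
  set μ : ℕ → ProbabilityMeasure ℝ≥0 := fun M =>
    ⟨(P M).map (X M), Measure.isProbabilityMeasure_map (hXm M).aemeasurable⟩ with hμ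
  have hmain : ∀ t : ℝ, 0 < Real.exp t - calI t → ∀ᶠ M : ℕ in atTop,
      Integrable (fun x : ℝ≥0 => Real.exp (t * x)) (μ M : Measure ℝ≥0) ∧
      ∫ x, Real.exp (t * x) ∂(μ M : Measure ℝ≥0) =
        Real.exp (-t) * ∑' n : ℕ, Real.exp (t * (n / M)) * lifeProb ⊤ M n (1, M) := by
    intro t ht
    filter_upwards [eventually_ge_atTop 1, hreg.eventually_hasSum (fun M => M),
      hreg.eventually_summable_exp (fun M => M) ht] with M hM h1 hs
    have hM' : (0 : ℝ) < M := by exact_mod_cast hM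
    -- The truncation in `n / M - 1` is harmless, as the lifetime is at least `M`.
    have hterm : ∀ n : ℕ, Real.exp (t * (((n : ℝ≥0) / M - 1 : ℝ≥0) : ℝ)) *
        lifeProb ⊤ M n (1, M) =
        Real.exp (-t) * (Real.exp (t * (n / M)) * lifeProb ⊤ M n (1, M)) := by
      intro n
      rcases lt_or_ge n M with hn | hn
      · rw [lifeProb_eq_zero_of_lt le_top n 1 M le_top le_rfl hn]; simp
      · have h1 : (1 : ℝ≥0) ≤ (n : ℝ≥0) / M := by
          rw [one_le_div (by exact_mod_cast hM)]
          exact_mod_cast hn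
        rw [NNReal.coe_sub h1, ← mul_assoc, ← Real.exp_add]
        push_cast
        ring_nf
    have hs' : Summable fun n : ℕ => Real.exp (t * (((n : ℝ≥0) / M - 1 : ℝ≥0) : ℝ)) *
        lifeProb ⊤ M n (1, M) := by
      simp only [hterm]
      exact hs.mul_left _
    have hm : AEStronglyMeasurable (fun x : ℝ≥0 => Real.exp (t * x)) ((P M).map (X M)) :=
      (by fun_prop : Measurable fun x : ℝ≥0 => Real.exp (t * x)).aestronglyMeasurable
    obtain ⟨hi, he⟩ := integral_lifetime h1 (fun n => (Real.exp_pos _).le) hs'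
    simp only [hμ, ProbabilityMeasure.coe_mk]
    refine ⟨(integrable_map_measure hm (hXm M).aemeasurable).2 hi, ?_⟩
    rw [integral_map (hXm M).aemeasurable hm, he, ← tsum_mul_left]
    exact tsum_congr hterm
  have hlim : ∀ t : ℝ, 0 < Real.exp t - calI t → Tendsto
      (fun M => ∫ x, Real.exp (t * x) ∂(μ M : Measure ℝ≥0)) atTop
      (𝓝 (1 / (Real.exp t - calI t))) := by
    intro t ht
    have h1 := hreg.tendsto_lifetime_mgf (y := fun M => M) le_rfl one_pos tendsto_self_div
      (fun _ _ => le_rfl) ht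
    simp only [hitTail_zero, mul_zero, intervalIntegral.integral_zero, zero_add, add_zero,
      sub_zero, one_mul] at h1
    have h2 := h1.const_mul (Real.exp (-t))
    rw [← mul_assoc, ← Real.exp_add, neg_add_cancel, Real.exp_zero, one_mul] at h2
    refine h2.congr' ?_
    filter_upwards [hmain t ht] with M hM
    exact hM.2.symm
  have hL : Tendsto (fun s : ℝ => 1 / (Real.exp (-s) - calI (-s))) (𝓝[>] 0) (𝓝 1) := by
    have h1 : Tendsto (fun s : ℝ => -s) (𝓝[>] 0) (𝓝 0) := by
      have := (continuous_neg (G := ℝ)).tendsto 0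
      rw [neg_zero] at this
      exact this.mono_left nhdsWithin_le_nhds
    simpa using (tendsto_exp_sub_calI.comp h1).inv₀ one_ne_zero
  have htight := isTightMeasureSet_of_tendsto_laplace (μ := μ) hL (by
    intro s hs
    have := hlim (-s) (exp_sub_calI_pos_of_nonpos (by linarith))
    simpa only [neg_mul] using this)
  obtain ⟨U, μ₀, hU, hμ₀⟩ := exists_ultrafilter_limit htight
  refine ⟨(μ₀ : Measure ℝ≥0).map (fun x : ℝ≥0 => (x : ℝ)),
    Measure.isProbabilityMeasure_map (by fun_prop), ?_, ?_⟩
  · rw [ae_map_iff (by fun_prop) measurableSet_Ici]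
    exact Eventually.of_forall fun x => x.2
  · intro t ht
    rw [integral_map (by fun_prop)
      (by fun_prop : Measurable fun x : ℝ => Real.exp (t * x)).aestronglyMeasurable]
    have hpos := exp_sub_calI_pos_of_lt ht
    rcases lt_or_ge t 0 with ht0 | ht0
    · let f : BoundedContinuousFunction ℝ≥0 ℝ := BoundedContinuousFunction.ofNormedAddCommGroup
        (fun x : ℝ≥0 => Real.exp (t * x)) (by fun_prop) 1 (fun x => by
          rw [Real.norm_eq_abs, abs_of_pos (Real.exp_pos _), Real.exp_le_one_iff]
          exact mul_nonpos_of_nonpos_of_nonneg ht0.le x.2)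
      exact tendsto_nhds_unique (ProbabilityMeasure.tendsto_iff_forall_integral_tendsto.1 hμ₀ f)
        ((hlim t hpos).mono_left hU)
    · -- The integrand is unbounded, so convergence at some larger exponent below `t₀` is needed.
      obtain ⟨t', h1, h2⟩ := exists_between ht
      have hpos' := exp_sub_calI_pos_of_lt h2
      exact integral_exp_of_tendsto hμ₀ h1
        ((hmain t hpos).filter_mono hU |>.mono fun _ h => h.1)
        ((hmain t' hpos').filter_mono hU |>.mono fun _ h => h.1)
        ((hlim t hpos).mono_left hU) ((hlim t' hpos').mono_left hU) ht0

/-! ### The limit law -/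

section LimitLaw

variable {a : ℝ≥0∞} {u v : ℝ}

lemma ae_levyHalf_pos : ∀ᵐ s ∂levyHalf, 0 < s := by
  rw [ae_iff]
  convert levyHalf_Iic_zero using 2
  ext s
  simp

/-- The variable `a τ` has no atom at a positive real number. -/
lemma levyHalf_lt_ae_eq_le (a : ℝ≥0∞) (hv : 0 < v) :
    ({s : ℝ | ENNReal.ofReal v < a * ENNReal.ofReal s} : Set ℝ) =ᵐ[levyHalf]
      {s | ENNReal.ofReal v ≤ a * ENNReal.ofReal s} := by
  rcases eq_or_ne a ⊤ with rfl | ha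
  · filter_upwards [ae_levyHalf_pos] with s hs
    refine propext ?_
    have : (⊤ : ℝ≥0∞) * ENNReal.ofReal s = ⊤ :=
      ENNReal.top_mul (ENNReal.ofReal_pos.2 hs).ne'
    change ENNReal.ofReal v < _ ↔ ENNReal.ofReal v ≤ _
    simp [this]
  · have h0 : ∀ᵐ s ∂levyHalf, s ≠ v / a.toReal := by
      rw [ae_iff]
      simpa using levyHalf_singleton (v / a.toReal)
    filter_upwards [h0, ae_levyHalf_pos] with s hs hpos
    refine propext ?_
    change ENNReal.ofReal v < _ ↔ ENNReal.ofReal v ≤ _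
    rw [le_iff_lt_or_eq, iff_self_or]
    intro h
    exfalso
    rw [← ENNReal.ofReal_toReal ha, ← ENNReal.ofReal_mul ENNReal.toReal_nonneg,
      ENNReal.ofReal_eq_ofReal_iff hv.le (mul_nonneg ENNReal.toReal_nonneg hpos.le)] at h
    have hb : a.toReal ≠ 0 := by
      intro hb
      rw [hb, zero_mul] at h
      exact hv.ne' h
    exact hs (by rw [h]; field_simp)

/-- The tail of `a τ`, for `τ` with the Lévy law. -/
lemma levyHalf_real_lt [IsProbabilityMeasure levyHalf] (a : ℝ≥0∞) (hv : 0 < v) :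
    levyHalf.real {s : ℝ | ENNReal.ofReal v < a * ENNReal.ofReal s} = hitTail a v := by
  rcases eq_or_ne a ⊤ with rfl | ha
  · rw [hitTail, if_pos rfl, ← probReal_univ (μ := levyHalf)]
    refine measureReal_congr ?_
    filter_upwards [ae_levyHalf_pos] with s hs
    refine propext ?_
    change ENNReal.ofReal v < _ ↔ True
    simp [ENNReal.top_mul (ENNReal.ofReal_pos.2 hs).ne']
  · rcases eq_or_ne a 0 with rfl | ha0
    · simp [hitTail_zero]
    · have hb : 0 < a.toReal := ENNReal.toReal_pos ha0 ha
      have hset : {s : ℝ | ENNReal.ofReal v < a * ENNReal.ofReal s} =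
          (Set.Iic (v / a.toReal))ᶜ := by
        ext s
        rw [Set.compl_Iic]
        change ENNReal.ofReal v < _ ↔ v / a.toReal < s
        rw [← ENNReal.ofReal_toReal ha, ← ENNReal.ofReal_mul ENNReal.toReal_nonneg,
          ENNReal.ofReal_lt_ofReal_iff_of_nonneg hv.le, ENNReal.ofReal_toReal ha, div_lt_iff₀' hb]
      rw [hset, probReal_compl_eq_one_sub measurableSet_Iic, measureReal_def,
        levyHalf_Iic (div_pos hv hb), ENNReal.toReal_ofReal (by
          have := (normalTail_mem_Icc (1 / √(v / a.toReal))).1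
          positivity), hitTail, if_neg ha, one_div, ← Real.sqrt_inv, inv_div]

lemma levyHalf_real_le [IsProbabilityMeasure levyHalf] (a : ℝ≥0∞) (hv : 0 < v) :
    levyHalf.real {s : ℝ | ENNReal.ofReal v ≤ a * ENNReal.ofReal s} = hitTail a v := by
  rw [← levyHalf_real_lt a hv]
  exact (measureReal_congr (levyHalf_lt_ae_eq_le a hv)).symm

/-- The time `min (u, a τ)` of the first visit to the boundary, stopped when the initial energy is
used up, as a function of `τ`. -/
noncomputable def stoppedHit (a : ℝ≥0∞) (u s : ℝ) : ℝ :=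
  (min (ENNReal.ofReal u) (a * ENNReal.ofReal s)).toReal

lemma measurable_stoppedHit (a : ℝ≥0∞) (u : ℝ) : Measurable (stoppedHit a u) := by
  unfold stoppedHit; fun_prop

lemma stoppedHit_nonneg (a : ℝ≥0∞) (u s : ℝ) : 0 ≤ stoppedHit a u s := ENNReal.toReal_nonneg

lemma stoppedHit_le (hu : 0 < u) (s : ℝ) : stoppedHit a u s ≤ u := by
  have := ENNReal.toReal_mono ENNReal.ofReal_ne_top
    (min_le_left (ENNReal.ofReal u) (a * ENNReal.ofReal s))
  rwa [ENNReal.toReal_ofReal hu.le] at this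

lemma lt_stoppedHit_iff (hv : 0 ≤ v) (hvu : v < u) (s : ℝ) :
    v < stoppedHit a u s ↔ ENNReal.ofReal v < a * ENNReal.ofReal s := by
  rw [stoppedHit, ← ENNReal.ofReal_lt_iff_lt_toReal hv
    ((min_le_left _ _).trans_lt ENNReal.ofReal_lt_top).ne, lt_min_iff, and_iff_right]
  exact (ENNReal.ofReal_lt_ofReal_iff (hv.trans_lt hvu)).2 hvu

/-- The fundamental theorem of calculus for `v ↦ e^{t v}` on `[0, min (u, a τ)]`, written with the
event `{v < a τ}` so that Fubini's theorem applies. -/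
lemma exp_stoppedHit (hu : 0 < u) (t s : ℝ) : Real.exp (t * stoppedHit a u s) =
    1 + t * ∫ v in Set.Ioo 0 u,
      {v : ℝ | ENNReal.ofReal v < a * ENNReal.ofReal s}.indicator (fun v => Real.exp (t * v)) v := by
  set m := stoppedHit a u s with hm
  have hm0 : 0 ≤ m := stoppedHit_nonneg a u s
  have hmu : m ≤ u := stoppedHit_le hu s
  have h1 : (∫ v in Set.Ioo 0 u,
      {v : ℝ | ENNReal.ofReal v < a * ENNReal.ofReal s}.indicator (fun v => Real.exp (t * v)) v) =
      ∫ v in (0 : ℝ)..m, Real.exp (t * v) := by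
    have h2 : (∫ v in Set.Ioo 0 u,
      {v : ℝ | ENNReal.ofReal v < a * ENNReal.ofReal s}.indicator (fun v => Real.exp (t * v)) v) =
      ∫ v in Set.Ioo 0 u, (Set.Iio m).indicator (fun v => Real.exp (t * v)) v := by
      refine setIntegral_congr_fun measurableSet_Ioo fun v hv => ?_
      have := lt_stoppedHit_iff (a := a) hv.1.le hv.2 s
      by_cases h : v < m
      · rw [Set.indicator_of_mem (show v ∈ Set.Iio m from h), Set.indicator_of_mem]
        exact this.1 h
      · rw [Set.indicator_of_notMem (show v ∉ Set.Iio m from h), Set.indicator_of_notMem]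
        exact fun h' => h (this.2 h')
    have h3 : Set.Ioo 0 u ∩ Set.Iio m = Set.Ioo 0 m := by
      rw [Set.Ioo_inter_Iio, min_eq_right hmu]
    rw [h2, setIntegral_indicator measurableSet_Iio, intervalIntegral.integral_of_le hm0, h3,
      integral_Ioc_eq_integral_Ioo]
  rw [h1]
  have hd : ∀ v ∈ Set.uIcc 0 m, HasDerivAt (fun v => Real.exp (t * v)) (t * Real.exp (t * v)) v := by
    intro v _
    have := ((hasDerivAt_id v).const_mul t).exp
    simpa [mul_comm] using this
  have := intervalIntegral.integral_eq_sub_of_hasDerivAt hd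
    (Continuous.intervalIntegrable (by fun_prop) _ _)
  rw [← intervalIntegral.integral_const_mul, this]
  simp

lemma integral_exp_stoppedHit [IsProbabilityMeasure levyHalf] (a : ℝ≥0∞) (hu : 0 < u) (t : ℝ) :
    ∫ s, Real.exp (t * stoppedHit a u s) ∂levyHalf =
      1 + t * ∫ v in (0 : ℝ)..u, Real.exp (t * v) * hitTail a v := by
  have hmeas : MeasurableSet {p : ℝ × ℝ | ENNReal.ofReal p.2 < a * ENNReal.ofReal p.1} :=
    measurableSet_lt (by fun_prop) (by fun_prop)
  have hint : Integrable (Function.uncurry fun s v : ℝ =>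
      {v : ℝ | ENNReal.ofReal v < a * ENNReal.ofReal s}.indicator (fun v => Real.exp (t * v)) v)
      (levyHalf.prod (volume.restrict (Set.Ioo 0 u))) := by
    have h1 : Integrable (fun p : ℝ × ℝ => Real.exp (t * p.2))
        (levyHalf.prod (volume.restrict (Set.Ioo 0 u))) := by
      have h2 : Integrable (fun v : ℝ => Real.exp (t * v)) (volume.restrict (Set.Ioo 0 u)) :=
        ((by fun_prop : Continuous fun v : ℝ => Real.exp (t * v)).integrableOn_Icc
          (a := 0) (b := u)).mono_set Set.Ioo_subset_Icc_self
      exact h2.comp_snd _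
    exact h1.indicator hmeas
  have hE : Integrable (fun s => ∫ v in Set.Ioo 0 u,
      {v : ℝ | ENNReal.ofReal v < a * ENNReal.ofReal s}.indicator (fun v => Real.exp (t * v)) v)
      levyHalf := hint.integral_prod_left
  simp only [exp_stoppedHit hu]
  rw [integral_add (integrable_const _) (hE.const_mul t), integral_const_mul,
    integral_integral_swap hint]
  simp only [integral_const, probReal_univ, smul_eq_mul, mul_one]
  congr 2
  rw [intervalIntegral.integral_of_le hu.le, integral_Ioc_eq_integral_Ioo]
  refine setIntegral_congr_fun measurableSet_Ioo fun v hv => ?_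
  have : (fun s : ℝ => {v : ℝ | ENNReal.ofReal v < a * ENNReal.ofReal s}.indicator
      (fun v => Real.exp (t * v)) v) = {s : ℝ | ENNReal.ofReal v < a * ENNReal.ofReal s}.indicator
      (fun _ => Real.exp (t * v)) := by
    ext s
    simp only [Set.indicator_apply, Set.mem_ofPred_eq]
  change ∫ s, {v : ℝ | ENNReal.ofReal v < a * ENNReal.ofReal s}.indicator
      (fun v => Real.exp (t * v)) v ∂levyHalf = _
  rw [this, integral_indicator_const _ (measurableSet_lt (by fun_prop) (by fun_prop)),
    levyHalf_real_lt a hv.1, smul_eq_mul, mul_comm]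

lemma integral_indicator_exp_stoppedHit [IsProbabilityMeasure levyHalf] (a : ℝ≥0∞) (hu : 0 < u)
    {t : ℝ} (ht : t ≤ 0) :
    ∫ s, {s : ℝ | a * ENNReal.ofReal s < ENNReal.ofReal u}.indicator
        (fun s => Real.exp (t * stoppedHit a u s)) s ∂levyHalf =
      1 + t * (∫ v in (0 : ℝ)..u, Real.exp (t * v) * hitTail a v)
        - Real.exp (t * u) * hitTail a u := by
  have hA : MeasurableSet {s : ℝ | a * ENNReal.ofReal s < ENNReal.ofReal u} :=
    measurableSet_lt (by fun_prop) (by fun_prop)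
  have hm := measurable_stoppedHit a u
  have hi : Integrable (fun s => Real.exp (t * stoppedHit a u s)) levyHalf := by
    refine Integrable.mono' (integrable_const 1)
      (by fun_prop : Measurable fun s => Real.exp (t * stoppedHit a u s)).aestronglyMeasurable ?_
    refine Eventually.of_forall fun s => ?_
    rw [Real.norm_eq_abs, abs_of_pos (Real.exp_pos _), Real.exp_le_one_iff]
    exact mul_nonpos_of_nonpos_of_nonneg ht (stoppedHit_nonneg a u s)
  have h1 := integral_add_compl hA hi
  have h2 : ∫ s in {s : ℝ | a * ENNReal.ofReal s < ENNReal.ofReal u}ᶜ,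
      Real.exp (t * stoppedHit a u s) ∂levyHalf = Real.exp (t * u) * hitTail a u := by
    have h3 : ∫ s in {s : ℝ | a * ENNReal.ofReal s < ENNReal.ofReal u}ᶜ,
        Real.exp (t * stoppedHit a u s) ∂levyHalf =
        ∫ s in {s : ℝ | a * ENNReal.ofReal s < ENNReal.ofReal u}ᶜ, Real.exp (t * u) ∂levyHalf := by
      refine setIntegral_congr_fun hA.compl fun s hs => ?_
      have : ENNReal.ofReal u ≤ a * ENNReal.ofReal s := not_lt.1 hs
      simp only [stoppedHit, min_eq_left this, ENNReal.toReal_ofReal hu.le]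
    rw [h3, setIntegral_const, smul_eq_mul, mul_comm, ← levyHalf_real_le a hu]
    congr 2
    ext s
    simp
  rw [integral_indicator hA, ← integral_exp_stoppedHit a hu, ← h1, h2]
  ring

variable {Ω : Type*} [MeasurableSpace Ω] {P : Measure Ω} {ξ τ : Ω → ℝ}

lemma limitValue_eq (a : ℝ≥0∞) (u x s : ℝ) : limitValue a u x s = stoppedHit a u s +
    {s : ℝ | a * ENNReal.ofReal s < ENNReal.ofReal u}.indicator (fun _ => 1 + x) s := by
  rw [limitValue, stoppedHit, Set.indicator_apply]
  rfl

lemma aemeasurable_limitValue (a : ℝ≥0∞) (u : ℝ) (hξ : AEMeasurable ξ P) (hτ : AEMeasurable τ P) :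
    AEMeasurable (fun ω => limitValue a u (ξ ω) (τ ω)) P := by
  have h : Measurable fun s : ℝ => a * ENNReal.ofReal s := ENNReal.measurable_ofReal.const_mul a
  have hS : MeasurableSet {s : ℝ | a * ENNReal.ofReal s < ENNReal.ofReal u} :=
    measurableSet_lt h measurable_const
  have h1 : Measurable ({s : ℝ | a * ENNReal.ofReal s < ENNReal.ofReal u}.indicator
      (fun _ => (1 : ℝ))) := measurable_const.indicator hS
  have h2 : ∀ ω, limitValue a u (ξ ω) (τ ω) = stoppedHit a u (τ ω) +
      {s : ℝ | a * ENNReal.ofReal s < ENNReal.ofReal u}.indicator (fun _ => (1 : ℝ)) (τ ω)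
        * (1 + ξ ω) := by
    intro ω
    rw [limitValue_eq, Set.indicator_apply, Set.indicator_apply]
    split_ifs <;> simp
  simp only [h2]
  exact ((measurable_stoppedHit a u).comp_aemeasurable hτ).add
    ((h1.comp_aemeasurable hτ).mul (hξ.const_add 1))

lemma ae_limitValue_nonneg (a : ℝ≥0∞) (u : ℝ) (hξ : ∀ᵐ ω ∂P, 0 ≤ ξ ω) :
    ∀ᵐ ω ∂P, 0 ≤ limitValue a u (ξ ω) (τ ω) := by
  filter_upwards [hξ] with ω hω
  unfold limitValue
  refine add_nonneg ENNReal.toReal_nonneg ?_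
  split_ifs <;> linarith

/-- The Laplace transform of the limit variable coincides with the limit of the Laplace transforms
of the normalized lifetimes. -/
lemma integral_exp_limitValue [IsProbabilityMeasure P] (a : ℝ≥0∞) (hu : 0 < u) (hξ : AEMeasurable ξ P)
    (hDM : IsDarlingMandelbrot (P.map ξ)) (hτ : HasLaw τ levyHalf P) (hind : IndepFun ξ τ P)
    {t : ℝ} (ht : t < 0) :
    ∫ ω, Real.exp (t * limitValue a u (ξ ω) (τ ω)) ∂P =
      Real.exp (t * u) * hitTail a u +
        (1 + t * (∫ v in (0 : ℝ)..u, Real.exp (t * v) * hitTail a v)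
          - Real.exp (t * u) * hitTail a u) *
        (Real.exp t * (1 / (Real.exp t - calI t))) := by
  have hprob : IsProbabilityMeasure levyHalf := by
    rw [← hτ.map_eq]; exact Measure.isProbabilityMeasure_map hτ.aemeasurable
  have hA : MeasurableSet {s : ℝ | a * ENNReal.ofReal s < ENNReal.ofReal u} :=
    measurableSet_lt (by fun_prop) (by fun_prop)
  have hm := measurable_stoppedHit a u
  have hgm : Measurable ({s : ℝ | a * ENNReal.ofReal s < ENNReal.ofReal u}.indicator
      (fun s => Real.exp (t * stoppedHit a u s))) := Measurable.indicator (by fun_prop) hA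
  have hξ0 : ∀ᵐ ω ∂P, 0 ≤ ξ ω := ae_of_ae_map hξ hDM.nonneg
  -- On `{a τ < u}` the variable is `min (u, a τ) + 1 + ξ`, elsewhere it is `u`.
  have hpt : ∀ ω, Real.exp (t * limitValue a u (ξ ω) (τ ω)) =
      {s : ℝ | ENNReal.ofReal u ≤ a * ENNReal.ofReal s}.indicator (fun _ => Real.exp (t * u)) (τ ω)
      + Real.exp (t * (1 + ξ ω)) * {s : ℝ | a * ENNReal.ofReal s < ENNReal.ofReal u}.indicator
        (fun s => Real.exp (t * stoppedHit a u s)) (τ ω) := by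
    intro ω
    rw [limitValue_eq]
    rcases lt_or_ge (a * ENNReal.ofReal (τ ω)) (ENNReal.ofReal u) with h | h
    · rw [Set.indicator_of_mem (by exact h), Set.indicator_of_notMem (by exact not_le.2 h),
        Set.indicator_of_mem (by exact h), zero_add, ← Real.exp_add]
      ring_nf
    · rw [Set.indicator_of_notMem (by exact not_lt.2 h), Set.indicator_of_mem (by exact h),
        Set.indicator_of_notMem (by exact not_lt.2 h), mul_zero, add_zero, add_zero, stoppedHit,
        min_eq_left h, ENNReal.toReal_ofReal hu.le]
  have hB : MeasurableSet {s : ℝ | ENNReal.ofReal u ≤ a * ENNReal.ofReal s} :=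
    measurableSet_le (by fun_prop) (by fun_prop)
  have h1m : Measurable ({s : ℝ | ENNReal.ofReal u ≤ a * ENNReal.ofReal s}.indicator
      (fun _ => Real.exp (t * u))) := measurable_const.indicator hB
  have hi1 : Integrable (fun ω => {s : ℝ | ENNReal.ofReal u ≤ a * ENNReal.ofReal s}.indicator
      (fun _ => Real.exp (t * u)) (τ ω)) P := by
    refine Integrable.mono' (integrable_const (Real.exp (t * u)))
      (h1m.comp_aemeasurable hτ.aemeasurable).aestronglyMeasurable ?_
    refine Eventually.of_forall fun ω => ?_
    refine (norm_indicator_le_norm_self _ _).trans ?_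
    rw [Real.norm_eq_abs, abs_of_pos (Real.exp_pos _)]
  have hi2 : Integrable (fun ω => Real.exp (t * (1 + ξ ω)) *
      {s : ℝ | a * ENNReal.ofReal s < ENNReal.ofReal u}.indicator
        (fun s => Real.exp (t * stoppedHit a u s)) (τ ω)) P := by
    refine Integrable.mono' (integrable_const 1) (AEMeasurable.aestronglyMeasurable
      (AEMeasurable.mul (by fun_prop) (hgm.comp_aemeasurable hτ.aemeasurable))) ?_
    filter_upwards [hξ0] with ω hω
    rw [norm_mul]
    refine mul_le_one₀ ?_ (norm_nonneg _) ((norm_indicator_le_norm_self _ _).trans ?_)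
    · rw [Real.norm_eq_abs, abs_of_pos (Real.exp_pos _), Real.exp_le_one_iff]
      exact mul_nonpos_of_nonpos_of_nonneg ht.le (by linarith)
    · rw [Real.norm_eq_abs, abs_of_pos (Real.exp_pos _), Real.exp_le_one_iff]
      exact mul_nonpos_of_nonpos_of_nonneg ht.le (stoppedHit_nonneg a u _)
  simp only [hpt]
  rw [integral_add hi1 hi2, hind.integral_fun_comp_mul_comp (f := fun x => Real.exp (t * (1 + x)))
    hξ hτ.aemeasurable
    (by fun_prop : Measurable fun x : ℝ => Real.exp (t * (1 + x))).aestronglyMeasurable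
    hgm.aestronglyMeasurable]
  have e1 : ∫ ω, {s : ℝ | ENNReal.ofReal u ≤ a * ENNReal.ofReal s}.indicator
      (fun _ => Real.exp (t * u)) (τ ω) ∂P = Real.exp (t * u) * hitTail a u := by
    rw [← integral_map (φ := τ) hτ.aemeasurable h1m.aestronglyMeasurable, hτ.map_eq,
      integral_indicator_const _ hB, levyHalf_real_le a hu, smul_eq_mul, mul_comm]
  have e2 : ∫ ω, {s : ℝ | a * ENNReal.ofReal s < ENNReal.ofReal u}.indicator
        (fun s => Real.exp (t * stoppedHit a u s)) (τ ω) ∂P =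
      1 + t * (∫ v in (0 : ℝ)..u, Real.exp (t * v) * hitTail a v)
        - Real.exp (t * u) * hitTail a u := by
    rw [← integral_map (φ := τ) hτ.aemeasurable hgm.aestronglyMeasurable, hτ.map_eq]
    exact integral_indicator_exp_stoppedHit a hu ht.le
  have e3 : ∫ ω, Real.exp (t * (1 + ξ ω)) ∂P = Real.exp t * (1 / (Real.exp t - calI t)) := by
    rw [← hDM.mgf_eq t (ht.trans_le tZero_nonneg), integral_map hξ
      (by fun_prop : Measurable fun x : ℝ => Real.exp (t * x)).aestronglyMeasurable,
      ← integral_const_mul]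
    refine integral_congr_ae (Eventually.of_forall fun ω => ?_)
    simp only [← Real.exp_add]
    ring_nf
  rw [e1, e2, e3]
  ring

lemma ae_limitValue_zero (hu : 0 < u) :
    ∀ᵐ ω ∂P, limitValue 0 u (ξ ω) (τ ω) = 1 + ξ ω := by
  refine Eventually.of_forall fun ω => ?_
  simp [limitValue, hu]

lemma ae_limitValue_top (hu : 0 < u) (hτ : HasLaw τ levyHalf P) :
    ∀ᵐ ω ∂P, limitValue ⊤ u (ξ ω) (τ ω) = u := by
  have h0 : ∀ᵐ s ∂(P.map τ), 0 < s := by rw [hτ.map_eq]; exact ae_levyHalf_pos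
  filter_upwards [ae_of_ae_map hτ.aemeasurable h0] with ω hω
  have : (⊤ : ℝ≥0∞) * ENNReal.ofReal (τ ω) = ⊤ := ENNReal.top_mul (ENNReal.ofReal_pos.2 hω).ne'
  simp [limitValue, this, hu.le]

/-- The limit law of the normalized lifetime. The convergence is proved for laws on `ℝ≥0` by Laplace
transforms and then transferred to `ℝ`. -/
lemma DiffusiveRegime.tendstoInDistribution_lifetime [IsProbabilityMeasure P] {N : ℕ → ℕ∞} {x y : ℕ → ℕ}
    (h : DiffusiveRegime N x a) (hy : ∀ M, 1 ≤ M → y M ≤ M) (hu0 : 0 < u) (hu : u ≤ 1)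
    (hylim : Tendsto (fun M : ℕ => (y M : ℝ) / (M : ℝ)) atTop (𝓝 u))
    (hξ : AEMeasurable ξ P)
    (hDM : IsDarlingMandelbrot (P.map ξ)) (hτ : HasLaw τ levyHalf P) (hind : IndepFun ξ τ P) :
    TendstoInDistribution
      (fun (M : ℕ) (ζ : ℕ → ℕ × ℕ) => ((lifetime (N M) ζ).toNat : ℝ) / (M : ℝ)) atTop
      (fun ω => limitValue a u (ξ ω) (τ ω)) (fun M => chainLaw (N M) M (x M, y M)) P := by
  have hZm := aemeasurable_limitValue a u hξ hτ.aemeasurable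
  have hZ0 : ∀ᵐ ω ∂P, 0 ≤ limitValue a u (ξ ω) (τ ω) :=
    ae_limitValue_nonneg a u (ae_of_ae_map hξ hDM.nonneg)
  have hXm : ∀ M, Measurable fun ζ : ℕ → ℕ × ℕ => ((lifetime (N M) ζ).toNat : ℝ≥0) / (M : ℝ≥0) :=
    fun M => (measurable_of_countable fun n : ℕ => (n : ℝ≥0) / M).comp
      (measurable_lifetime_toNat (N M))
  have hNN : TendstoInDistribution
      (fun (M : ℕ) (ζ : ℕ → ℕ × ℕ) => ((lifetime (N M) ζ).toNat : ℝ≥0) / (M : ℝ≥0)) atTop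
      (fun ω => (limitValue a u (ξ ω) (τ ω)).toNNReal)
      (fun M => chainLaw (N M) M (x M, y M)) P := by
    refine ⟨fun M => (hXm M).aemeasurable, hZm.real_toNNReal, tendsto_of_tendsto_laplace ?_⟩
    intro s hs
    have ht : -s < 0 := by linarith
    have hpos := exp_sub_calI_pos_of_nonpos ht.le
    have h1 := h.tendsto_lifetime_mgf hu hu0 hylim hy hpos
    rw [← integral_exp_limitValue a hu0 hξ hDM hτ hind ht] at h1
    have hem : Measurable fun x : ℝ≥0 => Real.exp (-(s * x)) := by fun_prop
    simp only [ProbabilityMeasure.coe_mk]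
    rw [integral_map hZm.real_toNNReal hem.aestronglyMeasurable]
    have h2 : ∫ ω, Real.exp (-(s * ((limitValue a u (ξ ω) (τ ω)).toNNReal : ℝ))) ∂P =
        ∫ ω, Real.exp (-s * limitValue a u (ξ ω) (τ ω)) ∂P := by
      refine integral_congr_ae ?_
      filter_upwards [hZ0] with ω hω
      rw [Real.coe_toNNReal _ hω, neg_mul]
    rw [h2]
    refine h1.congr' ?_
    filter_upwards [h.eventually_hasSum y, h.eventually_summable_exp y hpos] with M hsum hexp
    rw [integral_map (hXm M).aemeasurable hem.aestronglyMeasurable,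
      ← (integral_lifetime hsum (fun n => (Real.exp_pos _).le) hexp).2]
    refine integral_congr_ae (Eventually.of_forall fun ζ => ?_)
    simp
  have := hNN.continuous_comp NNReal.continuous_coe
  refine this.congr (fun M => Eventually.of_forall fun ζ => by simp) ?_
  filter_upwards [hZ0] with ω hω
  simp [hω]

end LimitLaw

lemma DiffusiveRegime.tendsto_lintegral_lifetime {N : ℕ → ℕ∞} {x y : ℕ → ℕ} {a : ℝ≥0∞} {u : ℝ}
    (h : DiffusiveRegime N x a) (hy : ∀ M, 1 ≤ M → y M ≤ M) (hu0 : 0 < u) (hu : u ≤ 1)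
    (hylim : Tendsto (fun M : ℕ => (y M : ℝ) / (M : ℝ)) atTop (𝓝 u)) :
    Tendsto (fun M : ℕ => (∫⁻ ζ, (lifetime (N M) ζ : ℝ≥0∞) ∂(chainLaw (N M) M (x M, y M)))
      / (M : ℝ≥0∞)) atTop (𝓝 (ENNReal.ofReal (g a u))) := by
  have h1 := ENNReal.tendsto_ofReal (h.tendsto_lifetime_mean hu hu0 hylim hy)
  rw [g_eq_meanLimit hu0]
  refine h1.congr' ?_
  filter_upwards [eventually_ge_atTop 1, h.eventually_hasSum y, h.eventually_survival_pos]
    with M hM hsum hS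
  rw [lintegral_lifetime_eq hsum (hasSum_mul_lifeProb (h.two_le M hM) hS _ _ (h.le M hM)).summable,
    ENNReal.ofReal_div_of_pos (by exact_mod_cast hM), ENNReal.ofReal_natCast]

/-- For `a = 0` the mean does not depend on `u`. -/
lemma g_zero (u : ℝ) : g 0 u = 2 := by
  simp [g, normalTail_zero]
  ring

end EnergyWalk

theorem mainTheorem1
    (N : ℕ → ℕ∞) (x y : ℕ → ℕ) (a : ℝ≥0∞) (u : ℝ)
    (hN : ∀ M, 1 ≤ M → 2 ≤ N M)
    (hx : ∀ M, 1 ≤ M → (x M : ℕ∞) ≤ N M)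
    (hy : ∀ M, 1 ≤ M → y M ≤ M)
    (hu : u ∈ Set.Ioc (0 : ℝ) 1)
    (hxlim : Tendsto
      (fun M : ℕ => min ((x M : ℝ≥0∞) ^ 2) (((N M : ℝ≥0∞) - (x M : ℝ≥0∞)) ^ 2) / (M : ℝ≥0∞))
      atTop (𝓝 a))
    (hylim : Tendsto (fun M : ℕ => (y M : ℝ) / (M : ℝ)) atTop (𝓝 u))
    (hNlim : Tendsto (fun M : ℕ => (M : ℝ≥0∞) / (N M : ℝ≥0∞) ^ 2) atTop (𝓝 0)) :
    -- the Darling–Mandelbrot law exists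
    (∃ μ : Measure ℝ, EnergyWalk.IsDarlingMandelbrot μ) ∧
    -- the lifetime is almost surely finite for all large `M`
    (∀ᶠ M : ℕ in atTop, ∀ᵐ ζ ∂(EnergyWalk.chainLaw (N M) M (x M, y M)),
      EnergyWalk.lifetime (N M) ζ ≠ ⊤) ∧
    -- the limit law, and its form for `a = 0` and `a = ∞`
    (∀ (Ω : Type*) [MeasurableSpace Ω] (P : Measure Ω) [IsProbabilityMeasure P] (ξ τ : Ω → ℝ),
      AEMeasurable ξ P → EnergyWalk.IsDarlingMandelbrot (P.map ξ) →
      HasLaw τ EnergyWalk.levyHalf P → IndepFun ξ τ P →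
        TendstoInDistribution
          (fun (M : ℕ) (ζ : ℕ → ℕ × ℕ) =>
            ((EnergyWalk.lifetime (N M) ζ).toNat : ℝ) / (M : ℝ))
          atTop
          (fun ω => EnergyWalk.limitValue a u (ξ ω) (τ ω))
          (fun M => EnergyWalk.chainLaw (N M) M (x M, y M)) P ∧
        (a = 0 → (∀ᵐ ω ∂P, EnergyWalk.limitValue a u (ξ ω) (τ ω) = 1 + ξ ω) ∧
          Integrable ξ P ∧ ∫ ω, ξ ω ∂P = 1) ∧
        (a = ⊤ → ∀ᵐ ω ∂P, EnergyWalk.limitValue a u (ξ ω) (τ ω) = u)) ∧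
    -- the mean, and its form for `a = 0` and `a = ∞`
    Tendsto
      (fun M : ℕ =>
        (∫⁻ ζ, (EnergyWalk.lifetime (N M) ζ : ℝ≥0∞) ∂(EnergyWalk.chainLaw (N M) M (x M, y M)))
          / (M : ℝ≥0∞))
      atTop (𝓝 (ENNReal.ofReal (EnergyWalk.g a u))) ∧
    (a = 0 → EnergyWalk.g a u = 2) ∧
    (a = ⊤ → EnergyWalk.g a u = u) := by
  have h : EnergyWalk.DiffusiveRegime N x a := ⟨hN, hx, hxlim, hNlim⟩
  refine ⟨EnergyWalk.exists_isDarlingMandelbrot,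
    (h.eventually_hasSum y).mono fun M hM => EnergyWalk.ae_lifetime_ne_top hM, ?_,
    h.tendsto_lintegral_lifetime hy hu.1 hu.2 hylim, ?_, ?_⟩
  · intro Ω _ P _ ξ τ hξ hDM hτ hind
    refine ⟨h.tendstoInDistribution_lifetime hy hu.1 hu.2 hylim hξ hDM hτ hind, ?_, ?_⟩
    · rintro rfl
      obtain ⟨hi, he⟩ := hDM.integral_id
      have hid : AEStronglyMeasurable (fun x : ℝ => x) (P.map ξ) :=
        measurable_id.aestronglyMeasurable
      refine ⟨EnergyWalk.ae_limitValue_zero hu.1, (integrable_map_measure hid hξ).1 hi, ?_⟩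
      rw [← he, integral_map hξ hid]
    · rintro rfl
      exact EnergyWalk.ae_limitValue_top hu.1 hτ
  · rintro rfl
    exact EnergyWalk.g_zero u
  · rintro rfl
    rw [EnergyWalk.g, if_pos rfl]
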